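/- \textbf{Setting.} An anonymized histogram $h$ is a finite multiset of positive integers (counts); $\varphi_r(h)$ is the number of its elements equal to $r$, $\varphi_{r+}(h)=\sum_{s\ge r}\varphi_s(h)$. A dataset $D$ assigns counts $n_x(D)\in\mathbb N$ to labels $x$ (finitely many non-zero), and $h(D)$ is the multiset of its non-zero counts; $\ell_1(h_1,h_2)=\min\{\sum_x|n_x(D_1)-n_x(D_2)| : h(D_1)=h_1,\ h(D_2)=h_2\}$. Two histograms are neighbors if their distance is $1$. A randomized map $A$ on histograms is $\epsilon$-DP if $\Pr(A(h)\in S)\le e^{\epsilon}\Pr(A(h')\in S)$ for all neighbors $h,h'$ and all sets $S$ of outputs. $G(a)$ is the law on $\mathbb Z$ with $\Pr(z)=\frac{1-a}{1+a}a^{|z|}$, and $L(b)$ is the Laplace law with density $\frac1{2b}e^{-|x|/b}$. \textbf{The mechanism PrivHist.} Input: a histogram $h$ with $n=\sum_{n_x\in h}n_x$ items, and $\epsilon>0$. Put $\epsilon_1=\epsilon_2=\epsilon_3=\epsilon/3$. All noise variables below are independent (given the scales). (1) $N=\max(n+Z^a,0)$ with $Z^a\sim G(e^{-\epsilon_1})$.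 If $N=0$, output the empty histogram and $N$. (2) Let $T=\lceil\sqrt{N\min(\epsilon,1)}\,\rceil$, $M=\lceil \max(2\log(Ne^{\epsilon_2}),1)/\epsilon_2\rceil$, $Z^b\sim G(e^{-\epsilon_2})$; $\varphi^b_T=\varphi_T(h)+M-Z^b$, $\varphi^b_{T+1}=\varphi_{T+1}(h)+M+Z^b$, and $\varphi^b_r=\varphi_r(h)$ for all other $r$. Let $H^{b\ell}$ have the prevalences $\varphi^{b\ell}_r=\max(0,\sum_{s=T+1}^r\varphi^b_s-\sum_{s=T+1}^{r-1}\varphi^{b\ell}_s)$ for $r\ge T+1$, and $H^{bs}$ the prevalences $\varphi^{bs}_r=\max(0,\sum_{s=r}^{T}\varphi^b_s-\sum_{s=r+1}^{T}\varphi^{bs}_s)$ for $1\le r\le T$. (3) $\varphi^{cs}_{r+}=\varphi^{bs}_{r+}+Z^{cs}_r$ for $1\le r\le T$, with $Z^{cs}_r\sim G(e^{-\epsilon_2})$. (4) $H^{c\ell}$ consists of the numbers $N_{(i)}(H^{b\ell})+Z^{c\ell}_i$, where $N_{(i)}(H^{b\ell})$ is the $i$-th largest element of $H^{b\ell}$ and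 $Z^{c\ell}_i\sim G(e^{-\epsilon_2})$. (5) If $\epsilon>1$: let $(\varphi^{\rm mon}_{r+})_{1\le r\le T}$ be the nonincreasing vector minimizing $\sum_{r\le T}(\varphi^{\rm mon}_{r+}-\varphi^{cs}_{r+})^2$, let $H^{ds}$ have the cumulative prevalences $\mathrm{round}(\max(\varphi^{\rm mon}_{r+},0))$ for $r\le T$ and $0$ for $r>T$, let $H^{d\ell}=\{\max(x,T):x\in H^{c\ell}\}$, and obtain $H$ from the multiset union of $H^{ds}$ and $H^{d\ell}$ by removing the $M$ elements closest to $T+1$ and then the $M$ elements closest to $T$ (all elements if there are fewer; among equally close elements the smaller ones first). Output $(H,N)$. (6) If $\epsilon\le1$: let $\varphi^u_r=\varphi_r(h)$ for $r<2N$, $\varphi^u_{2N}=\varphi_{2N+}(h)$ and $\varphi^u_r=0$ for $r>2N$. Let $T'=\lceil10\sqrt{N/\epsilon_3^3}\,\rceil$, $q=\sqrt{\log(1/\epsilon_3)/(N\epsilon_3)}$ and $S=\{1,\dots,T\}\cup\{\lfloor T(1+q)^i\rfloor:0\le i\le\log_{1+q}(T'/T)\}\cup\{x\in H^{c\ell}:x\ge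 T'\}\cup\{2N\}=\{s_1<s_2<\cdots<s_m\}$, $s_0=0$. Put $\varphi^v_{s_i}=\sum_{j=s_i}^{s_{i+1}}\varphi^u_j\frac{s_{i+1}-j}{s_{i+1}-s_i}+\sum_{j=s_{i-1}}^{s_i-1}\varphi^u_j\frac{j-s_{i-1}}{s_i-s_{i-1}}$, where for $i=m$ the first sum is $\varphi^u_{s_m}$; $\varphi^w_{s_i+}=\sum_{j\ge i}\varphi^v_{s_j}+Z^{s_i}$ with $Z^{s_i}\sim L(1/(\epsilon_3(s_i-s_{i-1})))$; let $(\varphi^x_{s_i+})_i$ be the nonincreasing vector minimizing $\sum_i(\varphi^x_{s_i+}-\varphi^w_{s_i+})^2(s_i-s_{i-1})^2$, and let $H$ have all its elements in $S$ and the cumulative prevalences $\mathrm{round}(\max(\varphi^x_{s_i+},0))$ at $s_i$. Output $(H,N)$. \textbf{Estimators.} Let $\Delta^k$ be the set of distributions on $k$ symbols. For a symmetric property $f:\Delta^k\to\mathbb R$ (invariant under permutations of the probabilities) and real coefficients $f(r,n)$ let $\hat f(h)=\sum_{r\ge1}f(r,n)\varphi_r(h)$, with $n$ the number of items of $h$,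 and let $\hat f^{dp}(h)=\sum_{r\ge1}f(r,N)\varphi_r(H)$, where $(H,N)$ is the output of PrivHist on $h$. Let $L^n_{\hat f}=\max(|f(1,n)|,\sup_{r\ge1}|f(r,n)-f(r+1,n)|)$ and $f_{\max}=\sup_{p\in\Delta^k}|f(p)|$. For $n\ge1$ independent samples $X^n$ from $p$ with anonymized histogram $h(X^n)$, a sequence $\mathcal E(\hat f,n)$, $n\ge1$, is an error bound for $\hat f$ if $\sup_{p\in\Delta^k}\mathbb E|f(p)-\hat f(h(X^n))|\le\mathcal E(\hat f,n)$ for all $n\ge1$. Given an error bound, $n(\hat f,\alpha)\in\{1,2,\dots\}\cup\{\infty\}$ is the least $n\ge1$ such that $\mathcal E(\hat f,m)\le\alpha$ for all $m\ge n$; and $n(\hat f^{dp},\alpha)$ is the least $n\ge1$ such that $\sup_{p\in\Delta^k}\mathbb E|f(p)-\hat f^{dp}(h(X^m))|\le\alpha$ for all $m\ge n$. \textbf{Statement.} For every $\epsilon>0$ and all coefficients $f(r,n)$, the estimator $\hat f^{dp}$ is $\epsilon$-DP. Further, there is an absolute constant $c>0$, and for every $\beta<1/2$ a constant $C=C(\beta)>0$,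 such that for all $k$, every symmetric property $f$ on $\Delta^k$, and every $\hat f$ with $L^n_{\hat f}\le n^{\beta-1}$ for all $n\ge1$ and with an error bound $\mathcal E$ satisfying $|\mathcal E(\hat f,n)-\mathcal E(\hat f,n+1)|\le n^{\beta-1}$ for all $n\ge1$, the following holds for all $\alpha>0$: if $\epsilon>1$, then \[ n(\hat f^{dp},2\alpha)\le\max\Bigl(n(\hat f,\alpha),\ C\Bigl[\Bigl(\frac{1}{\alpha e^{c\epsilon}}\Bigr)^{\frac{2}{1-2\beta}}+\frac1\epsilon\log\max\Bigl(\frac{f_{\max}}{\alpha},1\Bigr)\Bigr]\Bigr), \] and if $0<\epsilon\le1$, then \[ n(\hat f^{dp},2\alpha)\le\max\Bigl(n(\hat f,\alpha),\ C\Bigl[\Bigl(\frac{\log(2/\epsilon)}{\alpha^2\epsilon}\Bigr)^{\frac{1}{1-2\beta}}+\frac1\epsilon\log\Bigl(\frac1\epsilon\max\Bigl(\frac{f_{\max}}{\alpha},1\Bigr)\Bigr)\Bigr]\Bigr). \] -/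

import Mathlib

open MeasureTheory
open scoped ENNReal

noncomputable section

namespace PrivHist

/-! ### Anonymized histograms -/

/-- An anonymized histogram: a finite multiset of positive counts. -/
@[ext] structure AnonHist where
  /-- the multiset of counts -/
  counts : Multiset ℕ
  /-- all counts are positive -/
  zero_notMem : 0 ∉ counts

/-- Anonymized histograms form a discrete space. -/
instance : MeasurableSpace AnonHist := ⊤

/-- The histogram made of the positive members of a multiset. -/
def AnonHist.ofCounts (s : Multiset ℕ) : AnonHist where
  counts := s.filter (fun a => 0 < a)
  zero_notMem := by simp

/-- The prevalence `φ_r(h)`: the number of elements of `h` that are equal to `r`. -/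
def AnonHist.prev (h : AnonHist) (r : ℕ) : ℕ := h.counts.count r

/-- The number of items of `h`: the sum of its counts. -/
def AnonHist.total (h : AnonHist) : ℕ := h.counts.sum

/-- The anonymized histogram `h(D)` of a dataset `D` of label-count pairs. -/
def histOf {X : Type*} (D : X →₀ ℕ) : AnonHist where
  counts := D.support.val.map D
  zero_notMem := by simp

/-- The `ℓ₁` distance of two datasets over the labels `ℕ`. -/
def datasetDist (D D' : ℕ →₀ ℕ) : ℕ :=
  ∑ x ∈ D.support ∪ D'.support, ((D x : ℤ) - (D' x : ℤ)).natAbs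

/-- The `ℓ₁` distance of two anonymized histograms: the least distance of two datasets that
have these histograms (there is an unlimited supply of labels). -/
def histDist (h h' : AnonHist) : ℕ :=
  sInf {d : ℕ | ∃ D D' : ℕ →₀ ℕ, histOf D = h ∧ histOf D' = h' ∧ datasetDist D D' = d}

/-- Two histograms are neighbors when their distance is `1`. -/
def Neighbor (h h' : AnonHist) : Prop := histDist h h' = 1

/-- A randomized algorithm on anonymized histograms, given by its output laws, is
`ε`-differentially private. -/
def IsDP {O : Type*} [MeasurableSpace O] (ε : ℝ) (A : AnonHist → Measure O) : Prop :=
  ∀ h h' : AnonHist, Neighbor h h' →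
    ∀ S : Set O, A h S ≤ ENNReal.ofReal (Real.exp ε) * A h' S

/-! ### Noise -/

/-- The two-sided geometric law `G(a)` on `ℤ`: the point `z` has mass `(1-a)/(1+a) * a^|z|`. -/
def twoSidedGeometric (a : ℝ) : Measure ℤ :=
  Measure.sum fun z : ℤ =>
    ENNReal.ofReal ((1 - a) / (1 + a) * a ^ z.natAbs) • Measure.dirac z

/-- The Laplace law `L(b)` on `ℝ`, with density `exp (-|x|/b) / (2b)`. -/
def laplace (b : ℝ) : Measure ℝ :=
  volume.withDensity fun x => ENNReal.ofReal (1 / (2 * b) * Real.exp (-|x| / b))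

/-! ### Isotonic regression and histograms from cumulative prevalences -/

/-- `x` minimizes `∑ w_i (x_i - y_i)²` among the nonincreasing vectors. -/
def IsIsotonicFit {m : ℕ} (w y x : Fin m → ℝ) : Prop :=
  Antitone x ∧ ∀ x' : Fin m → ℝ, Antitone x' →
    ∑ i, w i * (x i - y i) ^ 2 ≤ ∑ i, w i * (x' i - y i) ^ 2

/-- The minimizer (it exists and is unique for positive weights). -/
def isotonicFit {m : ℕ} (w y : Fin m → ℝ) : Fin m → ℝ := Classical.epsilon (IsIsotonicFit w y)

/-- The multiset of counts with values among `s 0 < s 1 < ⋯` in which the number of elements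
that are at least `s i` is `c i`, for a nonincreasing `c`. -/
def countsOfCumulative {m : ℕ} (s : Fin m → ℕ) (c : Fin m → ℕ) : Multiset ℕ :=
  ∑ i : Fin m,
    Multiset.replicate (c i - if h : (i : ℕ) + 1 < m then c ⟨i + 1, h⟩ else 0) (s i)

/-- Isotonic regression of noisy cumulative prevalences `y` at the points `s`, followed by
truncation at `0` and rounding to the nearest integer. -/
def roundedFit {m : ℕ} (s : Fin m → ℕ) (w y : Fin m → ℝ) : Multiset ℕ :=
  countsOfCumulative s fun i => (round (max (isotonicFit w y i) 0)).toNat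

/-! ### Splitting the histogram at the threshold `T` -/

/-- The prevalences `φ^b`: `M` fake elements are added at each of `T` and `T + 1`, and then `z`
elements are moved from `T` to `T + 1`. -/
def shiftedPrev (h : AnonHist) (T M : ℕ) (z : ℤ) (r : ℕ) : ℤ :=
  (h.prev r : ℤ) + (if r = T then (M : ℤ) - z else 0) + (if r = T + 1 then (M : ℤ) + z else 0)

/-- `smallCum T φ j` is the sum of `φ^{bs}_r` over the last `j` values `T - j < r ≤ T`, where
`φ^{bs}_r = max (0, ∑_{s=r}^{T} φ_s - ∑_{s=r+1}^{T} φ^{bs}_s)`. -/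
def smallCum (T : ℕ) (φ : ℕ → ℤ) : ℕ → ℤ
  | 0 => 0
  | j + 1 => smallCum T φ j + max 0 (∑ s ∈ Finset.Icc (T - j) T, φ s - smallCum T φ j)

/-- `largeCum T φ j` is the sum of `φ^{bℓ}_r` over the first `j` values `T < r ≤ T + j`, where
`φ^{bℓ}_r = max (0, ∑_{s=T+1}^{r} φ_s - ∑_{s=T+1}^{r-1} φ^{bℓ}_s)`. -/
def largeCum (T : ℕ) (φ : ℕ → ℤ) : ℕ → ℤ
  | 0 => 0
  | j + 1 =>
    largeCum T φ j + max 0 (∑ s ∈ Finset.Icc (T + 1) (T + 1 + j), φ s - largeCum T φ j)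

/-- The cumulative prevalences `φ^{bs}_{r+}` of the small part, for `1 ≤ r ≤ T`. -/
def smallCumPrev (h : AnonHist) (T M : ℕ) (z : ℤ) (r : ℕ) : ℤ :=
  smallCum T (shiftedPrev h T M z) (T + 1 - r)

/-- The counts of the large part `H^{bℓ}`. All counts of `h` are at most `h.total`, so
`φ^{bℓ}_r` vanishes for `r > T + 1 + h.total`. -/
def largeCounts (h : AnonHist) (T M : ℕ) (z : ℤ) : Multiset ℕ :=
  ∑ j ∈ Finset.range (h.total + 1),
    Multiset.replicate
      (largeCum T (shiftedPrev h T M z) (j + 1) - largeCum T (shiftedPrev h T M z) j).toNat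
      (T + 1 + j)

/-- The counts of the large part in nonincreasing order. -/
def largeList (h : AnonHist) (T M : ℕ) (z : ℤ) : List ℕ :=
  (largeCounts h T M z).sort (fun a b => b ≤ a)

/-! ### Post-processing in the low privacy regime -/

/-- Remove the `k` elements of `s` that are closest to `t` (all of `s` if it has fewer; among
equally close elements the smaller ones go first). -/
def removeClosest (k t : ℕ) (s : Multiset ℕ) : Multiset ℕ :=
  (((s.sort (fun a b => a ≤ b)).mergeSort
    (fun a b => decide (Nat.dist a t ≤ Nat.dist b t))).drop k : List ℕ)

/-- The post-processing for `ε > 1`, from the noisy cumulative prevalences `cs` (the entry `i`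
belongs to `r = i + 1`) and the noisy large counts `cl`. -/
def lowPrivacy (T M : ℕ) (cs : Fin T → ℤ) (cl : Multiset ℤ) : AnonHist :=
  let ds : Multiset ℕ := roundedFit (fun i : Fin T => (i : ℕ) + 1) (fun _ => 1) fun i => (cs i : ℝ)
  let dl : Multiset ℕ := cl.map fun x => (max x (T : ℤ)).toNat
  AnonHist.ofCounts (removeClosest M T (removeClosest M (T + 1) (ds + dl)))

/-! ### The high privacy regime -/

/-- The prevalences `φ^u`: all counts above `2N` are replaced by `2N`. -/
def clippedPrev (h : AnonHist) (N r : ℕ) : ℕ :=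
  if r < 2 * N then h.prev r
  else if r = 2 * N then (h.counts.filter fun a => 2 * N ≤ a).card else 0

/-- The upper end `T'` of the logarithmic grid. -/
def gridEnd (N : ℕ) (ε₃ : ℝ) : ℕ := ⌈10 * Real.sqrt ((N : ℝ) / ε₃ ^ 3)⌉₊

/-- The ratio parameter `q` of the logarithmic grid. -/
def gridRatio (N : ℕ) (ε₃ : ℝ) : ℝ := Real.sqrt (Real.log (1 / ε₃) / ((N : ℝ) * ε₃))

/-- The set `S` of boundaries. -/
def boundaries (cl : Multiset ℤ) (T N : ℕ) (ε₃ : ℝ) : Finset ℕ :=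
  Finset.Icc 1 T ∪
  (Finset.range (⌊Real.logb (1 + gridRatio N ε₃) ((gridEnd N ε₃ : ℝ) / (T : ℝ))⌋₊ + 1)).image
    (fun i => ⌊(T : ℝ) * (1 + gridRatio N ε₃) ^ i⌋₊) ∪
  ((cl.filter fun x => (gridEnd N ε₃ : ℤ) ≤ x).map Int.toNat).toFinset ∪
  {2 * N}

/-- The largest boundary below `s`, or `0`. -/
def prevBoundary (S : Finset ℕ) (s : ℕ) : ℕ := (S.filter fun x => x < s).sup id

/-- The least boundary above `s`; for the last boundary the value `s + 1`, with which the
smoothing leaves the elements at `s` where they are. -/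
def nextBoundary (S : Finset ℕ) (s : ℕ) : ℕ :=
  if h : (S.filter fun x => s < x).Nonempty then (S.filter fun x => s < x).min' h else s + 1

/-- The smoothed prevalence `φ^v_s` at a boundary `s ∈ S`. -/
def smoothedPrev (S : Finset ℕ) (φ : ℕ → ℕ) (s : ℕ) : ℝ :=
  ∑ j ∈ Finset.Icc s (nextBoundary S s),
    (φ j : ℝ) * (((nextBoundary S s : ℝ) - j) / ((nextBoundary S s : ℝ) - s)) +
  ∑ j ∈ Finset.Ico (prevBoundary S s) s,
    (φ j : ℝ) * (((j : ℝ) - prevBoundary S s) / ((s : ℝ) - prevBoundary S s))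

/-- The cumulative smoothed prevalence `φ^v_{s+}`. -/
def smoothedCumPrev (S : Finset ℕ) (φ : ℕ → ℕ) (s : ℕ) : ℝ :=
  ∑ x ∈ S.filter (fun x => s ≤ x), smoothedPrev S φ x

/-- The `i`-th smallest boundary (counted from `0`). -/
def boundary (S : Finset ℕ) (i : Fin S.card) : ℕ := S.orderEmbOfFin rfl i

/-- The gap between the `i`-th smallest boundary and its predecessor. -/
def boundaryGap (S : Finset ℕ) (i : Fin S.card) : ℝ :=
  (boundary S i : ℝ) - (prevBoundary S (boundary S i) : ℝ)

/-- The law of the output histogram for `ε ≤ 1`. -/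
def highPrivacy (h : AnonHist) (cl : Multiset ℤ) (T N : ℕ) (ε₃ : ℝ) : Measure AnonHist :=
  let S := boundaries cl T N ε₃
  (Measure.pi fun i : Fin S.card => laplace (1 / (ε₃ * boundaryGap S i))).map fun z =>
    AnonHist.ofCounts (roundedFit (boundary S) (fun i => boundaryGap S i ^ 2)
      fun i => smoothedCumPrev S (clippedPrev h N) (boundary S i) + z i)

/-! ### The mechanism -/

/-- The threshold `T`. -/
def threshold (ε : ℝ) (N : ℕ) : ℕ := ⌈Real.sqrt ((N : ℝ) * min ε 1)⌉₊

/-- The number `M` of fake elements. -/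
def fakeCount (ε : ℝ) (N : ℕ) : ℕ :=
  ⌈max (2 * Real.log ((N : ℝ) * Real.exp (ε / 3))) 1 / (ε / 3)⌉₊

/-- The law of the output `(H, N)` of the mechanism on input `h`, for the privacy parameter `ε`,
which is split evenly into `ε₁ = ε₂ = ε₃ = ε / 3`. -/
def privHist (ε : ℝ) (h : AnonHist) : Measure (AnonHist × ℕ) :=
  let G : Measure ℤ := twoSidedGeometric (Real.exp (-(ε / 3)))
  G.bind fun za =>
    let N : ℕ := (max ((h.total : ℤ) + za) 0).toNat
    if N = 0 then Measure.dirac (AnonHist.ofCounts 0, 0) else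
    let T := threshold ε N
    let M := fakeCount ε N
    G.bind fun zb =>
    let l := largeList h T M zb
    (Measure.pi fun _ : Fin T => G).bind fun zs =>
    (Measure.pi fun _ : Fin l.length => G).bind fun zl =>
      let cs : Fin T → ℤ := fun i => smallCumPrev h T M zb ((i : ℕ) + 1) + zs i
      let cl : Multiset ℤ := (List.ofFn fun i => (l.get i : ℤ) + zl i : List ℤ)
      if 1 < ε then Measure.dirac (lowPrivacy T M cs cl, N)
      else (highPrivacy h cl T N (ε / 3)).map fun H => (H, N)

/-! ### Estimation of symmetric properties -/

/-- `f` is a symmetric property of distributions on `k` symbols: permuting the probabilities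
does not change its value. -/
def IsSymmetricProperty {k : ℕ} (f : (Fin k → ℝ) → ℝ) : Prop :=
  ∀ p ∈ stdSimplex ℝ (Fin k), ∀ σ : Equiv.Perm (Fin k), f (p ∘ σ) = f p

/-- The linear estimate `∑_{r ≥ 1} a(r, n) φ_r(h)`. -/
def linearEstimate (a : ℕ → ℕ → ℝ) (n : ℕ) (h : AnonHist) : ℝ :=
  ∑ r ∈ h.counts.toFinset, a r n * (h.prev r : ℝ)

/-- The Lipschitz constant `max (|a(1, n)|, sup_{r ≥ 1} |a(r, n) - a(r + 1, n)|)`. -/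
def lipschitzConst (a : ℕ → ℕ → ℝ) (n : ℕ) : ℝ≥0∞ :=
  max (ENNReal.ofReal |a 1 n|) (⨆ r : ℕ, ⨆ _ : 1 ≤ r, ENNReal.ofReal |a r n - a (r + 1) n|)

/-- The non-private linear estimator, with `n` the number of items of the histogram. -/
def linearEstimator (a : ℕ → ℕ → ℝ) (h : AnonHist) : Measure ℝ :=
  Measure.dirac (linearEstimate a h.total h)

/-- The private plug-in estimator `∑_{r ≥ 1} a(r, N) φ_r(H)`, with `(H, N)` the output of the
mechanism. -/
def privateEstimator (ε : ℝ) (a : ℕ → ℕ → ℝ) (h : AnonHist) : Measure ℝ :=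
  (privHist ε h).map fun o => linearEstimate a o.2 o.1

/-- The label-count dataset of a sequence of samples. -/
def sampleCounts {k n : ℕ} (x : Fin n → Fin k) : Fin k →₀ ℕ := ∑ i, Finsupp.single (x i) 1

/-- The expected error `E |f(p) - A(h(X^n))|` for `n` independent samples from `p`. -/
def expectedError {k : ℕ} (f : (Fin k → ℝ) → ℝ) (A : AnonHist → Measure ℝ) (p : Fin k → ℝ)
    (n : ℕ) : ℝ≥0∞ :=
  ∑ x : Fin n → Fin k, ENNReal.ofReal (∏ i, p (x i)) *
    ∫⁻ y, ENNReal.ofReal |f p - y| ∂(A (histOf (sampleCounts x)))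

/-- The worst expected error over all distributions on `k` symbols. -/
def worstError {k : ℕ} (f : (Fin k → ℝ) → ℝ) (A : AnonHist → Measure ℝ) (n : ℕ) : ℝ≥0∞ :=
  ⨆ p ∈ stdSimplex ℝ (Fin k), expectedError f A p n

/-- The number of samples from which on the error bound `err` is at most `α` (and `∞` if there
is none). For a nonincreasing `err` this is the least `n ≥ 1` with `err n ≤ α`. -/
def sampleComplexity (err : ℕ → ℝ≥0∞) (α : ℝ) : ℝ≥0∞ :=
  ⨅ n : ℕ, ⨅ _ : 1 ≤ n ∧ ∀ m : ℕ, n ≤ m → err m ≤ ENNReal.ofReal α, (n : ℝ≥0∞)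

/-- The largest absolute value of the property. -/
def propertyMax {k : ℕ} (f : (Fin k → ℝ) → ℝ) : ℝ := ⨆ p : stdSimplex ℝ (Fin k), |f p|

end PrivHist

end

/-!
**Privacy.** Neighboring histograms arise from each other by raising one count from `r` to `r + 1`
(`step_of_neighbor`). The noise on the number of items hides its change at the price of a factor
`e^{ε/3}`. For a fixed noisy number `N`, let `δ` be the change of the noise `Z^b` that makes the
split histograms of `h` and `h'` agree if the count crosses the threshold, and `0` otherwise. Then
`|δ|`, the `ℓ₁` change of the cumulative prevalences of the small part and that of the sorted large
part add up to at most `1` (`Step.coupled`), so splitting and perturbing the two parts costs one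
more `e^{ε/3}`. For `ε > 1` the rest is post-processing; for `ε ≤ 1` the smoothed cumulative
prevalences, weighted by the gaps between boundaries, change by at most `1` in total
(`sum_gap_mul_abs_ramp_sub_le`), which the Laplace noise hides at the price of the last `e^{ε/3}`.
Each step compares the integrals of an arbitrary function against two laws; the result is
`isDP_privateEstimator`.

**Accuracy.** A linear estimate for `N` items is `phi g` of the histogram for a function `g` with
increments at most `N ^ (β - 1)`, so all that matters is how far the output is from `h` when tested
against functions with increments at most `1` (`UnitLip`, `LipClose`); transport between multisets
never has to be constructed.

* For `ε > 1`, removing `M` closest elements twice undoes the insertion of the fake elements up to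
  a factor `4` in the distance (`LipClose.removeClosest`). Isotonic regression projects onto a
  cone containing the true cumulative prevalences, and rounding turns an error `x` into at most
  `4 x ^ 2`, so the noise enters through its second moment, which is of order `e^{-ε/3}`
  (`lipClose_roundedFit`, `lipClose_lowPrivacy`, `lintegral_cost_low_le`).
* For `ε ≤ 1`, the error consists of the distances of the elements to the nearest boundary and of
  the Laplace noise, which contributes `1 / ε` per boundary whatever the gaps
  (`lintegral_highPrivacy_sub_le`). The boundaries resolve counts up to `T` exactly, those below
  `T'` up to `q y + 1` for a count `y`, and above `T'` the elements of the large part themselves are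
  boundaries (`phi_boundaryDist_le`, `card_boundaries_le`). The total is balanced at
  `√(log (1/ε) / ε)` (`lintegral_cost_high_le`).

In both regimes the cost is a factor times `rate n N = √N + n² / N^{3/2}`. The coefficients in use
are those for `N` rather than `n`; since one sample more or less changes the estimate by at most
its Lipschitz constant, the error on `n` samples is compared with the error on `N` samples
(`fixedError_le`), which the error bound controls. Averaging over `N` gives
`expectedError_privateEstimator_le`: the error is at most `α` plus terms of order `n ^ (β - 1/2)`,
plus the contributions of the exponentially unlikely events `N = 0`, where the estimate is `0` and
the error is at most the range of the property, and `2 N < n`. All of this is at most `2 α` for `n`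
as large as stated (`worstError_low_le`, `worstError_high_le`, `sampleComplexity_le_max`).
-/

namespace PrivHist

/-! ### The two-sided geometric and the Laplace law -/

/-- The mass function of the two-sided geometric law. -/
noncomputable def geoMass (a : ℝ) (z : ℤ) : ℝ := (1 - a) / (1 + a) * a ^ z.natAbs

theorem geoMass_nonneg {a : ℝ} (h0 : 0 ≤ a) (h1 : a ≤ 1) (z : ℤ) : 0 ≤ geoMass a z := by
  have : 0 ≤ 1 - a := by linarith
  unfold geoMass
  positivity

theorem lintegral_twoSidedGeometric (a : ℝ) (F : ℤ → ℝ≥0∞) :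
    ∫⁻ z, F z ∂twoSidedGeometric a = ∑' z, ENNReal.ofReal (geoMass a z) * F z := by
  simp [twoSidedGeometric, lintegral_sum_measure, lintegral_smul_measure, geoMass]

theorem tsum_geoMass {a : ℝ} (h0 : 0 ≤ a) (h1 : a < 1) :
    ∑' z, ENNReal.ofReal (geoMass a z) = 1 := by
  have hs := hasSum_geometric_of_lt_one h0 h1
  have h2 : HasSum (geoMass a) ((1 - a) / (1 + a) * (1 - a)⁻¹ +
      (1 - a) / (1 + a) * (a * (1 - a)⁻¹)) := by
    apply HasSum.of_nat_of_neg_add_one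
    · simpa [geoMass] using hs.mul_left ((1 - a) / (1 + a))
    · have := (hs.mul_left a).mul_left ((1 - a) / (1 + a))
      refine this.congr_fun fun n => ?_
      have : (-((n : ℤ) + 1)).natAbs = n + 1 := by omega
      rw [geoMass, this, pow_succ']
  rw [← ENNReal.ofReal_tsum_of_nonneg (geoMass_nonneg h0 h1.le) h2.summable, h2.tsum_eq]
  have e1 : (1 - a) ≠ 0 := by linarith
  have e2 : (1 + a) ≠ 0 := by linarith
  rw [← ENNReal.ofReal_one]
  congr 1
  field_simp

theorem isProbabilityMeasure_twoSidedGeometric {a : ℝ} (h0 : 0 ≤ a) (h1 : a < 1) :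
    IsProbabilityMeasure (twoSidedGeometric a) := by
  constructor
  rw [← lintegral_one, lintegral_twoSidedGeometric]
  simpa using tsum_geoMass h0 h1

/-- Translating the noise by `t` changes each probability by a factor of at most `a ^ (-|t|)`. -/
theorem lintegral_add_twoSidedGeometric_le {a : ℝ} (h0 : 0 < a) (h1 : a < 1) (t : ℤ)
    (F : ℤ → ℝ≥0∞) :
    ∫⁻ z, F (t + z) ∂twoSidedGeometric a ≤
      ENNReal.ofReal ((a⁻¹) ^ t.natAbs) * ∫⁻ z, F z ∂twoSidedGeometric a := by
  rw [lintegral_twoSidedGeometric, lintegral_twoSidedGeometric, ← ENNReal.tsum_mul_left,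
    ← (Equiv.addLeft (-t)).tsum_eq]
  refine ENNReal.tsum_le_tsum fun z => ?_
  simp only [Equiv.coe_addLeft, add_neg_cancel_left]
  rw [← mul_assoc, ← ENNReal.ofReal_mul (by positivity)]
  gcongr
  have h2 : 0 ≤ (1 - a) / (1 + a) := div_nonneg (by linarith) (by linarith)
  have h3 : a ^ t.natAbs * a ^ (-t + z).natAbs ≤ a ^ z.natAbs := by
    rw [← pow_add]
    exact pow_le_pow_of_le_one h0.le h1.le (by omega)
  unfold geoMass
  calc (1 - a) / (1 + a) * a ^ (-t + z).natAbs
      = (1 - a) / (1 + a) * (a⁻¹ ^ t.natAbs * (a ^ t.natAbs * a ^ (-t + z).natAbs)) := by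
        rw [← mul_assoc (a⁻¹ ^ _), ← mul_pow, inv_mul_cancel₀ h0.ne', one_pow, one_mul]
    _ ≤ (1 - a) / (1 + a) * (a⁻¹ ^ t.natAbs * a ^ z.natAbs) := by gcongr
    _ = _ := by ring

/-- On either side, the tail from `k` on is the law translated by `k` and multiplied by `a ^ k`. -/
theorem tail_twoSidedGeometric_le {a : ℝ} (h0 : 0 ≤ a) (h1 : a < 1) (k : ℕ) :
    ∫⁻ z, (if k ≤ z.natAbs then 1 else 0) ∂twoSidedGeometric a ≤ ENNReal.ofReal (2 * a ^ k) := by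
  have key : ∀ z : ℤ, ENNReal.ofReal (geoMass a z) * (if k ≤ z.natAbs then 1 else 0) ≤
      ENNReal.ofReal (a ^ k) * (ENNReal.ofReal (geoMass a (z + k)) +
        ENNReal.ofReal (geoMass a (z + -k))) := by
    intro z
    have hz := geoMass_nonneg h0 h1.le
    split_ifs with h
    · rw [← ENNReal.ofReal_add (hz _) (hz _), ← ENNReal.ofReal_mul (by positivity), mul_one]
      apply ENNReal.ofReal_le_ofReal
      rw [mul_add]
      have h2 : ∀ y : ℤ, z.natAbs = k + y.natAbs → geoMass a z = a ^ k * geoMass a y := by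
        intro y hy
        rw [geoMass, geoMass, hy, pow_add]
        ring
      have hk : 0 ≤ a ^ k := by positivity
      rcases le_total 0 z with h3 | h3
      · rw [h2 (z + -k) (by omega)]
        nlinarith [mul_nonneg hk (hz (z + k))]
      · rw [h2 (z + k) (by omega)]
        nlinarith [mul_nonneg hk (hz (z + -k))]
    · simp
  rw [lintegral_twoSidedGeometric]
  refine (ENNReal.tsum_le_tsum key).trans ?_
  have e : ∀ t : ℤ, ∑' z : ℤ, ENNReal.ofReal (geoMass a (z + t)) = 1 := fun t =>
    ((Equiv.addRight t).tsum_eq fun z => ENNReal.ofReal (geoMass a z)).trans (tsum_geoMass h0 h1)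
  rw [ENNReal.tsum_mul_left, ENNReal.tsum_add, e, e, mul_comm (2 : ℝ),
    ENNReal.ofReal_mul (by positivity)]
  norm_num

/-- The factor `a` in the bound is what makes errors decay exponentially in `ε`. -/
theorem sq_twoSidedGeometric_le {a : ℝ} (h0 : 0 ≤ a) (h1 : a < 1) :
    ∫⁻ z, ((z.natAbs ^ 2 : ℕ) : ℝ≥0∞) ∂twoSidedGeometric a ≤
      ENNReal.ofReal (4 * a / (1 - a) ^ 2) := by
  have e1 : 0 < 1 - a := by linarith
  have hs := hasSum_choose_mul_geometric_of_norm_lt_one 2 (r := a)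
    (by rwa [Real.norm_of_nonneg h0])
  set c : ℝ := (1 - a) / (1 + a) with hc
  have hc0 : 0 ≤ c := by positivity
  have hs2 := hs.mul_left (c * a * 2)
  have hterm : ∀ n : ℕ, ENNReal.ofReal (c * a ^ (n + 1)) * (((n + 1) ^ 2 : ℕ) : ℝ≥0∞) ≤
      ENNReal.ofReal (c * a * 2 * (((n + 2).choose 2 : ℕ) * a ^ n)) := by
    intro n
    rw [← ENNReal.ofReal_natCast, ← ENNReal.ofReal_mul (by positivity)]
    apply ENNReal.ofReal_le_ofReal
    have h2 : (((n + 2).choose 2 : ℕ) : ℝ) = (n + 2) * (n + 1) / 2 := by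
      rw [Nat.cast_choose_two]; push_cast; ring
    rw [h2, pow_succ]
    have : 0 ≤ c * a ^ n * a := by positivity
    push_cast
    nlinarith [mul_nonneg this (by positivity : (0 : ℝ) ≤ (n : ℝ) + 1)]
  have hsum : ∑' n : ℕ, ENNReal.ofReal (c * a ^ (n + 1)) * (((n + 1) ^ 2 : ℕ) : ℝ≥0∞) ≤
      ENNReal.ofReal (c * a * 2 * (1 / (1 - a) ^ 3)) := by
    refine (ENNReal.tsum_le_tsum hterm).trans ?_
    rw [← ENNReal.ofReal_tsum_of_nonneg (fun n => by positivity) hs2.summable, hs2.tsum_eq]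
  rw [lintegral_twoSidedGeometric,
    tsum_of_nat_of_neg_add_one ENNReal.summable ENNReal.summable,
    tsum_eq_zero_add' ENNReal.summable]
  have f1 : ∀ n : ℕ, (-((n : ℤ) + 1)).natAbs = n + 1 := fun n => by omega
  have f2 : ∀ n : ℕ, ((n : ℤ) + 1).natAbs = n + 1 := fun n => by omega
  simp only [geoMass, Nat.cast_add, Nat.cast_one, f1, f2, ← hc]
  simp only [Nat.cast_zero, Int.natAbs_zero, pow_zero]
  rw [show ((0 ^ 2 : ℕ) : ℝ≥0∞) = 0 by simp, mul_zero, zero_add]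
  refine (add_le_add hsum hsum).trans ?_
  rw [← ENNReal.ofReal_add (by positivity) (by positivity)]
  apply ENNReal.ofReal_le_ofReal
  have e2 : 0 < 1 + a := by linarith
  rw [hc]
  have : (1 - a) / (1 + a) * a * 2 * (1 / (1 - a) ^ 3) = 2 * a / (1 - a) ^ 2 / (1 + a) := by
    field_simp
  rw [this, show 4 * a / (1 - a) ^ 2 = 2 * a / (1 - a) ^ 2 + 2 * a / (1 - a) ^ 2 by ring]
  have : 2 * a / (1 - a) ^ 2 / (1 + a) ≤ 2 * a / (1 - a) ^ 2 :=
    div_le_self (by positivity) (by linarith)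
  linarith

theorem integral_exp_neg_abs {b : ℝ} (hb : 0 < b) :
    ∫ x : ℝ, 1 / (2 * b) * Real.exp (-|x| / b) = 1 := by
  have h := Real.integral_rpow_mul_exp_neg_mul_Ioi (a := 1) (r := 1 / b) one_pos (by positivity)
  have h2 := integral_comp_abs (f := fun x => 1 / (2 * b) * Real.exp (-x / b))
  rw [h2, integral_const_mul]
  have h3 : ∫ x in Set.Ioi (0 : ℝ), Real.exp (-x / b) = b := by
    rw [Real.Gamma_one] at h
    simp only [sub_self, Real.rpow_zero, one_mul, Real.rpow_one, mul_one, one_div_one_div] at h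
    refine Eq.trans ?_ h
    refine integral_congr_ae (Filter.Eventually.of_forall fun x => ?_)
    simp only
    congr 1
    ring
  rw [h3]
  field_simp

theorem integral_sq_exp_neg_abs {b : ℝ} (hb : 0 < b) :
    ∫ x : ℝ, 1 / (2 * b) * Real.exp (-|x| / b) * x ^ 2 = 2 * b ^ 2 := by
  have h := Real.integral_rpow_mul_exp_neg_mul_Ioi (a := 3) (r := 1 / b) (by norm_num)
    (by positivity)
  have h2 := integral_comp_abs (f := fun x => 1 / (2 * b) * (Real.exp (-x / b) * x ^ 2))
  simp only [sq_abs] at h2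
  simp only [mul_assoc (1 / (2 * b))]
  rw [h2, integral_const_mul]
  have h3 : ∫ x in Set.Ioi (0 : ℝ), Real.exp (-x / b) * x ^ 2 = 2 * b ^ 3 := by
    have hg : Real.Gamma 3 = 2 := by simp
    rw [hg, one_div_one_div] at h
    have e : (b : ℝ) ^ (3 : ℝ) = b ^ 3 := by
      rw [← Real.rpow_natCast]; norm_num
    rw [← e, mul_comm, ← h]
    refine integral_congr_ae (Filter.Eventually.of_forall fun x => ?_)
    have : x ^ ((3 : ℝ) - 1) = x ^ 2 := by
      rw [← Real.rpow_natCast]; norm_num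
    simp only [this]
    rw [mul_comm]
    congr 2
    ring
  rw [h3]
  field_simp

theorem measurable_laplace_density (b : ℝ) :
    Measurable fun x : ℝ => ENNReal.ofReal (1 / (2 * b) * Real.exp (-|x| / b)) := by
  fun_prop

theorem isProbabilityMeasure_laplace {b : ℝ} (hb : 0 < b) : IsProbabilityMeasure (laplace b) := by
  constructor
  rw [laplace, withDensity_apply _ MeasurableSet.univ, Measure.restrict_univ,
    ← ofReal_integral_eq_lintegral_ofReal, integral_exp_neg_abs hb, ENNReal.ofReal_one]
  · exact .of_integral_ne_zero (by rw [integral_exp_neg_abs hb]; norm_num)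
  · exact Filter.Eventually.of_forall fun x => by positivity

theorem sq_laplace {b : ℝ} (hb : 0 < b) :
    ∫⁻ x, ENNReal.ofReal (x ^ 2) ∂laplace b = ENNReal.ofReal (2 * b ^ 2) := by
  rw [laplace, lintegral_withDensity_eq_lintegral_mul _ (measurable_laplace_density b)
    (by fun_prop), ← integral_sq_exp_neg_abs hb, ofReal_integral_eq_lintegral_ofReal]
  · congr 1 with x
    simp only [Pi.mul_apply]
    exact (ENNReal.ofReal_mul (by positivity)).symm
  · exact .of_integral_ne_zero (by rw [integral_sq_exp_neg_abs hb]; positivity)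
  · exact Filter.Eventually.of_forall fun x => by positivity

/-- Translating the noise by `t` changes the density by a factor of at most `exp (|t| / b)`. -/
theorem laplace_map_add_le {b : ℝ} (hb : 0 < b) (t : ℝ) :
    (laplace b).map (fun x => t + x) ≤ ENNReal.ofReal (Real.exp (|t| / b)) • laplace b := by
  refine Measure.le_iff.2 fun S hS => ?_
  have hm := measurable_laplace_density b
  rw [Measure.map_apply (by fun_prop) hS, Measure.smul_apply, laplace,
    withDensity_apply _ ((by fun_prop : Measurable fun x : ℝ => t + x) hS),
    withDensity_apply _ hS, smul_eq_mul, ← lintegral_const_mul _ hm,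
    ← lintegral_indicator ((by fun_prop : Measurable fun x : ℝ => t + x) hS),
    ← lintegral_indicator hS, ← lintegral_sub_right_eq_self _ t]
  refine lintegral_mono fun x => ?_
  by_cases hx : x ∈ S
  · rw [Set.indicator_of_mem (by simpa using hx), Set.indicator_of_mem hx,
      ← ENNReal.ofReal_mul (by positivity)]
    apply ENNReal.ofReal_le_ofReal
    rw [mul_left_comm, ← Real.exp_add]
    gcongr
    rw [← add_div]
    gcongr
    have := abs_sub_abs_le_abs_sub x t
    have := abs_add_le (x - t) t
    simp only [sub_add_cancel] at this
    linarith
  · rw [Set.indicator_of_notMem (by simpa using hx)]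
    positivity

/-! ### Products of noise laws -/

/-- Domination of measures passes to finite products. -/
theorem pi_le_prod_smul_pi {ι : Type*} [Fintype ι] {α : ι → Type*} [∀ i, MeasurableSpace (α i)]
    (μ ν : ∀ i, Measure (α i)) [∀ i, SigmaFinite (μ i)] (c : ι → ℝ)
    (hc : ∀ i, 0 < c i) (h : ∀ i, ν i ≤ ENNReal.ofReal (c i) • μ i) :
    Measure.pi ν ≤ ENNReal.ofReal (∏ i, c i) • Measure.pi μ := by
  have hpos : 0 < ∏ i, c i := Finset.prod_pos fun i _ => hc i
  have : ∀ i, SigmaFinite (ν i) := fun i => by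
    have : SigmaFinite (ENNReal.ofReal (c i) • μ i) :=
      inferInstanceAs (SigmaFinite ((Real.toNNReal (c i)) • μ i))
    exact Measure.sigmaFinite_of_le _ (h i)
  set d : ℝ≥0∞ := ENNReal.ofReal (∏ i, c i) with hd
  have hd0 : d ≠ 0 := by simpa [hd] using hpos
  have hdt : d ≠ ∞ := ENNReal.ofReal_ne_top
  have key : (d⁻¹ • Measure.pi ν).toOuterMeasure ≤
      OuterMeasure.pi fun i => (μ i).toOuterMeasure := by
    refine OuterMeasure.le_pi.2 fun s _ => ?_
    change (d⁻¹ • Measure.pi ν) (Set.univ.pi s) ≤ ∏ i, μ i (s i)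
    rw [Measure.smul_apply, Measure.pi_pi, smul_eq_mul]
    have h2 : ∏ i, ν i (s i) ≤ d * ∏ i, μ i (s i) := by
      rw [hd, ENNReal.ofReal_prod_of_nonneg fun i _ => (hc i).le, ← Finset.prod_mul_distrib]
      exact Finset.prod_le_prod' fun i _ => h i (s i)
    calc d⁻¹ * ∏ i, ν i (s i) ≤ d⁻¹ * (d * ∏ i, μ i (s i)) := by gcongr
      _ = _ := by rw [← mul_assoc, ENNReal.inv_mul_cancel hd0 hdt, one_mul]
  have key2 : d⁻¹ • Measure.pi ν ≤ Measure.pi μ := by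
    refine Measure.le_iff.2 fun S hS => ?_
    calc (d⁻¹ • Measure.pi ν) S ≤ (OuterMeasure.pi fun i => (μ i).toOuterMeasure) S := key S
      _ ≤ _ := by
        rw [Measure.pi]
        exact le_toMeasure_apply _ _ _
  refine Measure.le_iff.2 fun S hS => ?_
  have := key2 S
  rw [Measure.smul_apply, smul_eq_mul] at this ⊢
  calc Measure.pi ν S = d * (d⁻¹ * Measure.pi ν S) := by
        rw [← mul_assoc, ENNReal.mul_inv_cancel hd0 hdt, one_mul]
    _ ≤ _ := by gcongr

/-- Translating independent geometric noise by `v` instead of `w`. -/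
theorem lintegral_pi_geometric_add_le {a : ℝ} (h0 : 0 < a) (h1 : a < 1) {n : ℕ} (v w : Fin n → ℤ)
    (F : (Fin n → ℤ) → ℝ≥0∞) :
    ∫⁻ z, F (v + z) ∂(Measure.pi fun _ => twoSidedGeometric a) ≤
      ENNReal.ofReal ((a⁻¹) ^ ∑ i, (v i - w i).natAbs) *
        ∫⁻ z, F (w + z) ∂(Measure.pi fun _ => twoSidedGeometric a) := by
  have := isProbabilityMeasure_twoSidedGeometric h0.le h1
  have hm : ∀ t : ℤ, Measurable fun z : ℤ => t + z := fun t => .of_discrete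
  have hmap : ∀ u : Fin n → ℤ, ∫⁻ z, F (u + z) ∂(Measure.pi fun _ => twoSidedGeometric a) =
      ∫⁻ z, F z ∂(Measure.pi fun i => (twoSidedGeometric a).map fun z => u i + z) := by
    intro u
    have : ∀ i, IsProbabilityMeasure ((twoSidedGeometric a).map fun z => u i + z) := fun i =>
      Measure.isProbabilityMeasure_map (hm _).aemeasurable
    rw [← Measure.pi_map_pi fun i => (hm (u i)).aemeasurable, lintegral_map .of_discrete .of_discrete]
    rfl
  have : ∀ i, IsProbabilityMeasure ((twoSidedGeometric a).map fun z => w i + z) := fun i =>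
    Measure.isProbabilityMeasure_map (hm _).aemeasurable
  rw [hmap, hmap, ← smul_eq_mul, ← lintegral_smul_measure, ← Finset.prod_pow_eq_pow_sum]
  refine lintegral_mono' (pi_le_prod_smul_pi _ _ _ (fun i => by positivity) fun i => ?_) le_rfl
  refine Measure.le_iff.2 fun S _ => ?_
  rw [Measure.smul_apply, smul_eq_mul, ← lintegral_indicator_one (.of_discrete),
    ← lintegral_indicator_one (.of_discrete), lintegral_map .of_discrete .of_discrete,
    lintegral_map .of_discrete .of_discrete]
  have := lintegral_add_twoSidedGeometric_le h0 h1 (v i - w i)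
    fun z => S.indicator 1 (w i + z)
  refine le_trans (le_of_eq ?_) this
  congr 1 with z
  congr 1
  ring

/-- Translating independent Laplace noise by `v` instead of `w`. -/
theorem pi_laplace_map_add_le {n : ℕ} {b : Fin n → ℝ} (hb : ∀ i, 0 < b i) (v w : Fin n → ℝ) :
    (Measure.pi fun i => laplace (b i)).map (fun z i => v i + z i) ≤
      ENNReal.ofReal (Real.exp (∑ i, |v i - w i| / b i)) •
        (Measure.pi fun i => laplace (b i)).map (fun z i => w i + z i) := by
  have : ∀ i, IsProbabilityMeasure (laplace (b i)) := fun i => isProbabilityMeasure_laplace (hb i)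
  have hm : ∀ t : ℝ, Measurable fun z : ℝ => t + z := fun t => by fun_prop
  have : ∀ (u : Fin n → ℝ) i, IsProbabilityMeasure ((laplace (b i)).map fun z => u i + z) :=
    fun u i => Measure.isProbabilityMeasure_map (hm _).aemeasurable
  rw [Measure.pi_map_pi fun i => (hm (v i)).aemeasurable,
    Measure.pi_map_pi fun i => (hm (w i)).aemeasurable, Real.exp_sum]
  refine pi_le_prod_smul_pi _ _ _ (fun i => Real.exp_pos _) fun i => ?_
  have h := Measure.map_mono (laplace_map_add_le (hb i) (v i - w i)) (hm (w i))
  rw [Measure.map_map (hm _) (hm _), Measure.map_smul] at h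
  convert! h using 2
  ext z
  simp only [Function.comp]
  ring

/-- A function of a single coordinate is integrated against the corresponding factor. -/
theorem lintegral_pi_eval {ι : Type*} [Fintype ι] {α : ι → Type*} [∀ i, MeasurableSpace (α i)]
    (μ : ∀ i, Measure (α i)) [∀ i, IsProbabilityMeasure (μ i)] (i : ι) (f : α i → ℝ≥0∞)
    (hf : Measurable f) : ∫⁻ x, f (x i) ∂(Measure.pi μ) = ∫⁻ x, f x ∂μ i :=
  (measurePreserving_eval μ i).lintegral_comp hf

/-- Chebyshev's inequality for a sum of independent two-sided geometric variables. -/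
theorem chebyshev_sum_geometric {a : ℝ} (h0 : 0 ≤ a) (h1 : a < 1) (n : ℕ) {c : ℝ} (hc : 0 < c) :
    (Measure.pi fun _ : Fin n => twoSidedGeometric a) {z | c ≤ |∑ i, (z i : ℝ)|} ≤
      ENNReal.ofReal (n * (4 * a / (1 - a) ^ 2) / c ^ 2) := by
  have := isProbabilityMeasure_twoSidedGeometric h0 h1
  set G := twoSidedGeometric a with hG
  set X : ℤ → ℝ := fun z => (z : ℝ) with hX
  have hXm : AEStronglyMeasurable X G := (Measurable.of_discrete).aestronglyMeasurable
  have hsq : ∫⁻ z, ENNReal.ofReal (X z ^ 2) ∂G ≤ ENNReal.ofReal (4 * a / (1 - a) ^ 2) := by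
    refine le_trans (le_of_eq ?_) (sq_twoSidedGeometric_le h0 h1)
    congr 1 with z
    rw [← ENNReal.ofReal_natCast]
    congr 1
    push_cast
    rw [Nat.cast_natAbs, Int.cast_abs, sq_abs]
  have hnn : 0 ≤ 4 * a / (1 - a) ^ 2 := by positivity
  have hint : Integrable (fun z => X z ^ 2) G := by
    refine ⟨(Measurable.of_discrete).aestronglyMeasurable, ?_⟩
    rw [hasFiniteIntegral_iff_ofReal (Filter.Eventually.of_forall fun z => sq_nonneg _)]
    exact hsq.trans_lt ENNReal.ofReal_lt_top
  have hL : MemLp X 2 G := (memLp_two_iff_integrable_sq hXm).2 hint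
  have hmean : ∫ z, X z ∂G = 0 := by
    have hneg : G.map (fun z => -z) = G := by
      refine Measure.ext fun S _ => ?_
      rw [Measure.map_apply .of_discrete (.of_discrete), ← lintegral_indicator_one .of_discrete,
        ← lintegral_indicator_one .of_discrete, hG, lintegral_twoSidedGeometric,
        lintegral_twoSidedGeometric, ← (Equiv.neg ℤ).tsum_eq]
      refine tsum_congr fun z => ?_
      change ENNReal.ofReal (geoMass a (-z)) * S.indicator 1 (- -z) = _
      rw [neg_neg, geoMass, Int.natAbs_neg, geoMass]
    have h2 : ∫ z, X z ∂G = ∫ z, X (-z) ∂G := by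
      conv_lhs => rw [← hneg]
      rw [integral_map (Measurable.of_discrete).aemeasurable
        (Measurable.of_discrete).aestronglyMeasurable]
    simp only [hX, Int.cast_neg, integral_neg] at h2
    simp only [hX]
    linarith
  have hvar : ProbabilityTheory.variance X G ≤ 4 * a / (1 - a) ^ 2 := by
    refine (ProbabilityTheory.variance_le_expectation_sq hXm).trans ?_
    change ∫ z, X z ^ 2 ∂G ≤ _
    rw [integral_eq_lintegral_of_nonneg_ae (Filter.Eventually.of_forall fun z => sq_nonneg _)
      (Measurable.of_discrete).aestronglyMeasurable]
    exact ENNReal.toReal_le_of_le_ofReal hnn hsq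
  have hvs := ProbabilityTheory.variance_sum_pi (μ := fun _ : Fin n => G) (X := fun _ => X)
    fun _ => hL
  have hLp : MemLp (∑ i : Fin n, fun ω : Fin n → ℤ => X (ω i)) 2 (Measure.pi fun _ : Fin n => G) :=
    memLp_finsetSum' _ fun i _ =>
      hL.comp_measurePreserving (measurePreserving_eval (fun _ : Fin n => G) i)
  have hcheb := ProbabilityTheory.meas_ge_le_variance_div_sq hLp hc
  have hm0 : ∫ ω, (∑ i : Fin n, fun ω : Fin n → ℤ => X (ω i)) ω
      ∂(Measure.pi fun _ : Fin n => G) = 0 := by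
    simp only [Finset.sum_apply]
    rw [integral_finsetSum]
    · refine Finset.sum_eq_zero fun i _ => ?_
      have hp := measurePreserving_eval (fun _ : Fin n => G) i
      have h3 := integral_map (f := X) hp.aemeasurable (Measurable.of_discrete).aestronglyMeasurable
      rw [hp.map_eq, hmean] at h3
      exact h3.symm
    · exact fun i _ => (hL.comp_measurePreserving
        (measurePreserving_eval (fun _ : Fin n => G) i)).integrable one_le_two
  rw [hm0, hvs] at hcheb
  simp only [sub_zero, Finset.sum_apply, Finset.sum_const, Finset.card_univ, Fintype.card_fin,
    nsmul_eq_mul] at hcheb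
  refine hcheb.trans (ENNReal.ofReal_le_ofReal ?_)
  gcongr

/-! ### Isotonic regression -/

section Isotonic

variable {m : ℕ} {w y x : Fin m → ℝ}

/-- Compactness gives a best fit; the weights have to be positive for the search to be confined to
a bounded set. -/
theorem exists_isIsotonicFit (hw : ∀ i, 0 < w i) (y : Fin m → ℝ) : ∃ x, IsIsotonicFit w y x := by
  set f : (Fin m → ℝ) → ℝ := fun x => ∑ i, w i * (x i - y i) ^ 2 with hf
  have hf0 : ∀ x, 0 ≤ f x := fun x => Finset.sum_nonneg fun i _ =>
    mul_nonneg (hw i).le (sq_nonneg _)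
  have hfc : Continuous f := by fun_prop
  -- an antitone vector outside this box is a worse fit than the zero vector
  set K : Set (Fin m → ℝ) := Set.univ.pi fun i =>
    Set.Icc (y i - Real.sqrt (f 0 / w i)) (y i + Real.sqrt (f 0 / w i)) with hK
  have hKc : IsCompact K := isCompact_univ_pi fun i => isCompact_Icc
  have hA : IsClosed {x : Fin m → ℝ | Antitone x} := by
    simp only [Antitone, Set.ofPred_forall]
    exact isClosed_iInter fun i => isClosed_iInter fun j => isClosed_iInter fun _ =>
      isClosed_le (continuous_apply j) (continuous_apply i)
  have hout : ∀ x, f x ≤ f 0 → x ∈ K := by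
    intro x hx i _
    have h1 : w i * (x i - y i) ^ 2 ≤ f 0 := le_trans
      (Finset.single_le_sum (f := fun i => w i * (x i - y i) ^ 2)
        (fun j _ => mul_nonneg (hw j).le (sq_nonneg _)) (Finset.mem_univ i)) hx
    have h2 : |x i - y i| ≤ Real.sqrt (f 0 / w i) := by
      apply Real.abs_le_sqrt
      rw [le_div_iff₀ (hw i)]
      linarith
    rw [abs_le] at h2
    constructor <;> linarith
  obtain ⟨x, hx, hmin⟩ := (hKc.inter_right hA).exists_isMinOn
    ⟨0, hout 0 le_rfl, antitone_const⟩ hfc.continuousOn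
  refine ⟨x, hx.2, fun x' hx' => ?_⟩
  by_cases h : f x' ≤ f 0
  · exact hmin ⟨hout x' h, hx'⟩
  · exact (hmin ⟨hout 0 le_rfl, antitone_const⟩ : f x ≤ f 0).trans (not_le.1 h).le

theorem isIsotonicFit_isotonicFit (hw : ∀ i, 0 < w i) (y : Fin m → ℝ) :
    IsIsotonicFit w y (isotonicFit w y) :=
  Classical.epsilon_spec (exists_isIsotonicFit hw y)

/-- The residual of the fit makes an obtuse angle with every antitone direction. -/
theorem IsIsotonicFit.inner_nonneg (hx : IsIsotonicFit w y x) {b : Fin m → ℝ} (hb : Antitone b) :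
    0 ≤ ∑ i, w i * ((b i - x i) * (x i - y i)) := by
  by_contra! hneg
  set p := ∑ i, w i * ((b i - x i) * (x i - y i)) with hp
  set q := ∑ i, w i * (b i - x i) ^ 2 with hq
  have key : ∀ t : ℝ, 0 ≤ t → t ≤ 1 → 0 ≤ 2 * t * p + t ^ 2 * q := by
    intro t h0 h1
    have hA : Antitone fun i => x i + t * (b i - x i) := by
      intro i j hij
      have := mul_le_mul_of_nonneg_left (hx.1 hij) (by linarith : 0 ≤ 1 - t)
      have := mul_le_mul_of_nonneg_left (hb hij) h0
      simp only
      nlinarith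
    have h2 := hx.2 _ hA
    have h3 : ∑ i, w i * (x i + t * (b i - x i) - y i) ^ 2 =
        ∑ i, w i * (x i - y i) ^ 2 + (2 * t * p + t ^ 2 * q) := by
      rw [hp, hq, Finset.mul_sum, Finset.mul_sum, ← Finset.sum_add_distrib,
        ← Finset.sum_add_distrib]
      refine Finset.sum_congr rfl fun i _ => ?_
      ring
    linarith
  have hq1 := key 1 zero_le_one le_rfl
  have hqp : 0 < q := by linarith
  have hle : -p / q ≤ 1 := by
    rw [div_le_one hqp]
    linarith
  have := key (-p / q) (by have : 0 < -p := by linarith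
                           positivity) hle
  have e : 2 * (-p / q) * p + (-p / q) ^ 2 * q = -(p ^ 2 / q) := by
    field_simp
    ring
  rw [e] at this
  have : 0 < p ^ 2 / q := div_pos (by nlinarith) hqp
  linarith

/-- Projecting onto the antitone vectors does not increase the distance to an antitone vector. -/
theorem IsIsotonicFit.dist_le (hx : IsIsotonicFit w y x) (hw : ∀ i, 0 < w i) {b : Fin m → ℝ}
    (hb : Antitone b) : ∑ i, w i * (x i - b i) ^ 2 ≤ ∑ i, w i * (y i - b i) ^ 2 := by
  have h := hx.inner_nonneg hb
  have e : ∑ i, w i * (y i - b i) ^ 2 = ∑ i, w i * (x i - b i) ^ 2 +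
      ∑ i, w i * (y i - x i) ^ 2 + 2 * ∑ i, w i * ((b i - x i) * (x i - y i)) := by
    rw [Finset.mul_sum, ← Finset.sum_add_distrib, ← Finset.sum_add_distrib]
    refine Finset.sum_congr rfl fun i _ => ?_
    ring
  have : 0 ≤ ∑ i, w i * (y i - x i) ^ 2 :=
    Finset.sum_nonneg fun i _ => mul_nonneg (hw i).le (sq_nonneg _)
  linarith

/-- The fit is the projection onto a convex cone, so it does not increase distances. -/
theorem IsIsotonicFit.dist_le_dist {y' x' : Fin m → ℝ} (hx : IsIsotonicFit w y x)
    (hx' : IsIsotonicFit w y' x') (hw : ∀ i, 0 < w i) :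
    ∑ i, w i * (x i - x' i) ^ 2 ≤ ∑ i, w i * (y i - y' i) ^ 2 := by
  have h1 := hx.inner_nonneg hx'.1
  have h2 := hx'.inner_nonneg hx.1
  have e : ∑ i, w i * (y i - y' i) ^ 2 = ∑ i, w i * (x i - x' i) ^ 2 +
      ∑ i, w i * ((y i - y' i) - (x i - x' i)) ^ 2 +
      2 * (∑ i, w i * ((x' i - x i) * (x i - y i)) + ∑ i, w i * ((x i - x' i) * (x' i - y' i))) := by
    simp only [Finset.mul_sum, ← Finset.sum_add_distrib]
    refine Finset.sum_congr rfl fun i _ => ?_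
    ring
  have : 0 ≤ ∑ i, w i * ((y i - y' i) - (x i - x' i)) ^ 2 :=
    Finset.sum_nonneg fun i _ => mul_nonneg (hw i).le (sq_nonneg _)
  linarith

/-- The fit has the same weighted mean as the data. -/
theorem IsIsotonicFit.sum_eq (hx : IsIsotonicFit w y x) : ∑ i, w i * x i = ∑ i, w i * y i := by
  have h : ∀ c : ℝ, 0 ≤ c * (∑ i, w i * x i - ∑ i, w i * y i) := by
    intro c
    have := hx.inner_nonneg (b := fun i => x i + c) (hx.1.add_const c)
    rw [← Finset.sum_sub_distrib, Finset.mul_sum]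
    refine this.trans (le_of_eq (Finset.sum_congr rfl fun i _ => ?_))
    ring
  have := h 1
  have := h (-1)
  linarith

theorem continuous_isotonicFit (hw : ∀ i, 0 < w i) : Continuous (isotonicFit w) := by
  refine continuous_pi fun i => continuous_iff_continuousAt.2 fun y => ?_
  rw [ContinuousAt, tendsto_iff_dist_tendsto_zero]
  have hcont : Continuous fun z : Fin m → ℝ =>
      Real.sqrt ((∑ j, w j * (z j - y j) ^ 2) / w i) := by fun_prop
  have hlim := hcont.tendsto y
  simp only [sub_self, ne_eq, OfNat.ofNat_ne_zero, not_false_eq_true, zero_pow, mul_zero,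
    Finset.sum_const_zero, zero_div, Real.sqrt_zero] at hlim
  refine squeeze_zero (fun z => dist_nonneg) (fun z => ?_) hlim
  rw [Real.dist_eq]
  apply Real.abs_le_sqrt
  rw [le_div_iff₀ (hw i), mul_comm]
  refine le_trans ?_ ((isIsotonicFit_isotonicFit hw z).dist_le_dist
    (isIsotonicFit_isotonicFit hw y) hw)
  exact Finset.single_le_sum
    (f := fun j => w j * (isotonicFit w z j - isotonicFit w y j) ^ 2)
    (fun j _ => mul_nonneg (hw j).le (sq_nonneg _)) (Finset.mem_univ i)

/-- Although multisets carry no measurable structure here, any function of the rounded fit is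
measurable, since the fit is rounded to a countable set. -/
theorem measurable_of_roundedFit {β : Type*} [MeasurableSpace β] (hw : ∀ i, 0 < w i)
    (s : Fin m → ℕ) (F : Multiset ℕ → β) : Measurable fun y => F (roundedFit s w y) := by
  have h1 : Measurable fun y : Fin m → ℝ => fun i => (round (max (isotonicFit w y i) 0)).toNat := by
    refine measurable_pi_lambda _ fun i => ?_
    have h2 : Measurable fun y : Fin m → ℝ => round (max (isotonicFit w y i) 0) := by
      simp only [round_eq]
      refine Int.measurable_floor.comp ?_
      have : Measurable fun y : Fin m → ℝ => isotonicFit w y i :=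
        ((continuous_apply i).comp (continuous_isotonicFit hw)).measurable
      fun_prop
    exact (Measurable.of_discrete (f := Int.toNat)).comp h2
  exact (Measurable.of_discrete (f := fun c => F (countsOfCumulative s c))).comp h1

end Isotonic

/-! ### Rounding -/

/-- Rounding to the nearest integer at most doubles the distance to a given integer. -/
theorem abs_round_sub_le_two_mul (x : ℝ) (k : ℕ) :
    |(((round (max x 0)).toNat : ℕ) : ℝ) - k| ≤ 2 * |x - k| := by
  have h0 : 0 ≤ round (max x 0) := by
    rw [round_eq]
    exact Int.floor_nonneg.2 (by positivity)
  have hc : (((round (max x 0)).toNat : ℕ) : ℝ) = (round (max x 0) : ℝ) := by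
    rw [← Int.cast_natCast, Int.toNat_of_nonneg h0]
  rw [hc]
  have h1 := abs_sub_round (max x 0)
  have h2 : |max x 0 - k| ≤ |x - k| := by
    have := abs_max_sub_max_le_abs x k 0
    rwa [max_eq_left (Nat.cast_nonneg k : (0 : ℝ) ≤ k)] at this
  have h3 : |(round (max x 0) : ℝ) - k| ≤ 1 / 2 + |x - k| := by
    calc |(round (max x 0) : ℝ) - k|
        = |-(max x 0 - round (max x 0)) + (max x 0 - k)| := by congr 1; ring
      _ ≤ |max x 0 - round (max x 0)| + |max x 0 - k| := by
          rw [← abs_neg (max x 0 - round (max x 0))]; exact abs_add_le _ _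
      _ ≤ _ := add_le_add h1 h2
  by_cases hz : round (max x 0) = (k : ℤ)
  · rw [hz]
    simp
  · have h4 : (1 : ℝ) ≤ |(round (max x 0) : ℝ) - k| := by
      have : (1 : ℤ) ≤ |round (max x 0) - k| := Int.one_le_abs (sub_ne_zero.2 hz)
      exact_mod_cast this
    linarith

/-- Since a nonzero rounding error is at least `1`, it is bounded by a square. -/
theorem abs_round_sub_le_four_mul_sq (x : ℝ) (k : ℕ) :
    |(((round (max x 0)).toNat : ℕ) : ℝ) - k| ≤ 4 * (x - k) ^ 2 := by
  have h := abs_round_sub_le_two_mul x k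
  by_cases hz : (round (max x 0)).toNat = k
  · rw [hz]
    simp only [sub_self, abs_zero]
    positivity
  · have h4 : (1 : ℝ) ≤ |(((round (max x 0)).toNat : ℕ) : ℝ) - k| := by
      have : (1 : ℤ) ≤ |((round (max x 0)).toNat : ℤ) - k| :=
        Int.one_le_abs (sub_ne_zero.2 (by exact_mod_cast hz))
      exact_mod_cast this
    rw [← sq_abs]
    nlinarith [abs_nonneg (x - k)]

theorem le_round_of_sub_half_le {x : ℝ} {k : ℕ} (h : (k : ℝ) - 1 / 2 ≤ x) :
    k ≤ (round (max x 0)).toNat := by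
  have h2 : (k : ℤ) ≤ round (max x 0) := by
    rw [round_eq, Int.le_floor]
    have := le_max_left x 0
    push_cast
    linarith
  omega

/-! ### Lipschitz functionals of multisets -/

/-- The functions that change by at most `1` per step and vanish at `0`. The distance of two
multisets of counts, padded with zeros, is the largest difference of the sums of such functions. -/
def UnitLip (g : ℕ → ℝ) : Prop := g 0 = 0 ∧ ∀ r, |g (r + 1) - g r| ≤ 1

/-- The sum of `g` over a multiset. -/
noncomputable def phi (g : ℕ → ℝ) (s : Multiset ℕ) : ℝ := (s.map g).sum

/-- The two multisets are at distance at most `D`, tested against `UnitLip` functions. -/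
def LipClose (s t : Multiset ℕ) (D : ℝ) : Prop := ∀ g, UnitLip g → |phi g s - phi g t| ≤ D

@[simp] theorem phi_zero (g : ℕ → ℝ) : phi g 0 = 0 := by simp [phi]

@[simp] theorem phi_add (g : ℕ → ℝ) (s t : Multiset ℕ) : phi g (s + t) = phi g s + phi g t := by
  simp [phi]

@[simp] theorem phi_replicate (g : ℕ → ℝ) (n a : ℕ) : phi g (Multiset.replicate n a) = n * g a := by
  simp [phi]

theorem phi_cons (g : ℕ → ℝ) (a : ℕ) (s : Multiset ℕ) : phi g (a ::ₘ s) = g a + phi g s := by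
  simp [phi]

theorem phi_sum {ι : Type*} (g : ℕ → ℝ) (I : Finset ι) (s : ι → Multiset ℕ) :
    phi g (∑ i ∈ I, s i) = ∑ i ∈ I, phi g (s i) := by
  classical
  induction I using Finset.induction_on with
  | empty => simp
  | insert a I ha ih => simp [Finset.sum_insert ha, ih]

theorem phi_filter_pos {g : ℕ → ℝ} (hg : g 0 = 0) (s : Multiset ℕ) :
    phi g (s.filter fun a => 0 < a) = phi g s := by
  induction s using Multiset.induction_on with
  | empty => simp
  | cons a s ih =>
    rcases Nat.eq_zero_or_pos a with rfl | h
    · rw [Multiset.filter_cons_of_neg _ (by simp), ih, phi_cons, hg, zero_add]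
    · rw [Multiset.filter_cons_of_pos (p := fun a => 0 < a) _ h, phi_cons, phi_cons, ih]

theorem UnitLip.abs_sub_le {g : ℕ → ℝ} (hg : UnitLip g) (a b : ℕ) :
    |g a - g b| ≤ |(a : ℝ) - b| := by
  have key : ∀ a k : ℕ, |g (a + k) - g a| ≤ k := by
    intro a k
    induction k with
    | zero => simp
    | succ k ih =>
      have h1 := hg.2 (a + k)
      have h2 := abs_add_le (g (a + k + 1) - g (a + k)) (g (a + k) - g a)
      rw [sub_add_sub_cancel] at h2
      push_cast
      rw [← add_assoc]
      linarith
  rcases le_total a b with h | h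
  · obtain ⟨k, rfl⟩ := Nat.exists_eq_add_of_le h
    rw [abs_sub_comm, abs_sub_comm (a : ℝ)]
    simpa using key a k
  · obtain ⟨k, rfl⟩ := Nat.exists_eq_add_of_le h
    simpa using key b k

theorem UnitLip.abs_le {g : ℕ → ℝ} (hg : UnitLip g) (a : ℕ) : |g a| ≤ a := by
  have := hg.abs_sub_le a 0
  simpa [hg.1] using this

theorem UnitLip.abs_phi_le {g : ℕ → ℝ} (hg : UnitLip g) (s : Multiset ℕ) : |phi g s| ≤ s.sum := by
  induction s using Multiset.induction_on with
  | empty => simp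
  | cons a s ih =>
    rw [phi_cons, Multiset.sum_cons, Nat.cast_add]
    exact (abs_add_le _ _).trans (add_le_add (hg.abs_le a) ih)

theorem unitLip_cast : UnitLip fun n => (n : ℝ) := ⟨by simp, fun r => by simp⟩

theorem phi_cast (s : Multiset ℕ) : phi (fun n => (n : ℝ)) s = s.sum := by
  induction s using Multiset.induction_on with
  | empty => simp
  | cons a s ih => rw [phi_cons, Multiset.sum_cons, ih]; push_cast; rfl

theorem LipClose.sum_le {s t : Multiset ℕ} {D : ℝ} (h : LipClose s t D) :
    (s.sum : ℝ) ≤ t.sum + D := by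
  have := h _ unitLip_cast
  rw [phi_cast, phi_cast, abs_le] at this
  linarith

theorem LipClose.trans {s t u : Multiset ℕ} {D E : ℝ} (h : LipClose s t D) (h' : LipClose t u E) :
    LipClose s u (D + E) := fun g hg => by
  have := abs_add_le (phi g s - phi g t) (phi g t - phi g u)
  rw [sub_add_sub_cancel] at this
  linarith [h g hg, h' g hg]

theorem LipClose.add {s t s' t' : Multiset ℕ} {D E : ℝ} (h : LipClose s t D)
    (h' : LipClose s' t' E) : LipClose (s + s') (t + t') (D + E) := fun g hg => by
  have := abs_add_le (phi g s - phi g t) (phi g s' - phi g t')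
  rw [phi_add, phi_add, add_sub_add_comm]
  linarith [h g hg, h' g hg]

/-- Two multisets can be compared through the empty one, at the price of all their items. -/
theorem lipClose_of_sum_le {s t : Multiset ℕ} {D : ℝ} (h : (s.sum : ℝ) + t.sum ≤ D) :
    LipClose s t D := fun g hg => by
  have h1 := hg.abs_phi_le s
  have h2 := hg.abs_phi_le t
  have := abs_sub (phi g s) (phi g t)
  linarith

/-! ### Histograms from cumulative prevalences -/

/-- The preceding value of a finite sequence, with `0` before the first one. -/
def predVal {m : ℕ} (s : Fin m → ℕ) (i : Fin m) : ℕ :=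
  if h : 0 < (i : ℕ) then s ⟨i - 1, by omega⟩ else 0

/-- Summation by parts. -/
theorem phi_countsOfCumulative {m : ℕ} {g : ℕ → ℝ} (hg : g 0 = 0) (s c : Fin m → ℕ)
    (hc : Antitone c) :
    phi g (countsOfCumulative s c) = ∑ i, (c i : ℝ) * (g (s i) - g (predVal s i)) := by
  -- summation by parts, with the sequences extended to all natural numbers
  set C : ℕ → ℝ := fun n => if h : n < m then (c ⟨n, h⟩ : ℝ) else 0 with hC
  set S : ℕ → ℝ := fun n => if h : 0 < n ∧ n ≤ m then g (s ⟨n - 1, by omega⟩) else 0 with hS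
  have h1 : phi g (countsOfCumulative s c) = ∑ n ∈ Finset.range m, (C n - C (n + 1)) * S (n + 1) := by
    rw [countsOfCumulative, phi_sum, ← Fin.sum_univ_eq_sum_range]
    refine Finset.sum_congr rfl fun i _ => ?_
    have hi := i.2
    rw [phi_replicate]
    simp only [hC, hS, hi, dif_pos, Nat.succ_pos, true_and, Nat.succ_le_of_lt hi, Nat.add_sub_cancel]
    congr 1
    split_ifs with h
    · rw [Nat.cast_sub (hc (by simp [Fin.le_def]))]
    · simp
  have h2 : ∑ i, (c i : ℝ) * (g (s i) - g (predVal s i)) =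
      ∑ n ∈ Finset.range m, C n * (S (n + 1) - S n) := by
    rw [← Fin.sum_univ_eq_sum_range]
    refine Finset.sum_congr rfl fun i _ => ?_
    have hi := i.2
    simp only [hC, hS, hi, dif_pos, Nat.succ_pos, Nat.succ_le_of_lt hi,
      Nat.add_sub_cancel, predVal, hi.le, and_true]
    congr 2
    split_ifs with h
    · rfl
    · exact hg
  rw [h1, h2]
  have h3 : ∀ k, ∑ n ∈ Finset.range k, (C n - C (n + 1)) * S (n + 1) =
      ∑ n ∈ Finset.range k, C n * (S (n + 1) - S n) - C k * S k := by
    intro k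
    induction k with
    | zero => simp [hS]
    | succ k ih =>
      rw [Finset.sum_range_succ, Finset.sum_range_succ, ih]
      ring
  rw [h3, show C m = 0 by simp [hC]]
  ring

/-! ### Removal of the closest elements -/

/-- All that is used of the removal of the closest elements; in particular, the order among equally
close ones does not matter. -/
theorem removeClosest_spec (k t : ℕ) (s : Multiset ℕ) :
    ∃ A : Multiset ℕ, A + removeClosest k t s = s ∧ A.card = min k s.card ∧
      ∀ a ∈ A, ∀ b ∈ removeClosest k t s, Nat.dist a t ≤ Nat.dist b t := by
  set L : List ℕ := (s.sort (fun a b => a ≤ b)).mergeSort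
    (fun a b => decide (Nat.dist a t ≤ Nat.dist b t)) with hL
  have hLs : (L : Multiset ℕ) = s := by
    rw [hL, Multiset.coe_eq_coe.2 (List.mergeSort_perm _ _), Multiset.sort_eq]
  have hlen : L.length = s.card := by rw [← hLs, Multiset.coe_card]
  refine ⟨(L.take k : List ℕ), ?_, ?_, ?_⟩
  · change ((L.take k : List ℕ) : Multiset ℕ) + ((L.drop k : List ℕ) : Multiset ℕ) = s
    rw [Multiset.coe_add, List.take_append_drop, hLs]
  · rw [Multiset.coe_card, List.length_take, hlen]
  · have hp : L.Pairwise fun a b => decide (Nat.dist a t ≤ Nat.dist b t) = true :=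
      List.pairwise_mergeSort (fun a b c => by simpa using fun h h' => h.trans h')
        (fun a b => by simpa using le_total _ _) _
    rw [← List.take_append_drop k L, List.pairwise_append] at hp
    intro a ha b hb
    simpa using hp.2.2 a ha b hb

theorem card_filter_removeClosest (k t : ℕ) (s : Multiset ℕ) (p : ℕ → Prop) [DecidablePred p] :
    (s.filter p).card ≤ ((removeClosest k t s).filter p).card + k := by
  obtain ⟨A, hA, hc, -⟩ := removeClosest_spec k t s
  have h1 := congrArg (fun u => (Multiset.filter p u).card) hA
  simp only [Multiset.filter_add, Multiset.card_add] at h1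
  have h2 := Multiset.card_le_card (Multiset.filter_le p A)
  have := min_le_left k s.card
  omega

theorem sum_removeClosest_le (k t : ℕ) (s : Multiset ℕ) : (removeClosest k t s).sum ≤ s.sum := by
  obtain ⟨A, hA, -, -⟩ := removeClosest_spec k t s
  have := congrArg Multiset.sum hA
  rw [Multiset.sum_add] at this
  omega

/-- Removing the elements closest to `t` undoes the insertion of `k` copies of `t`, up to the
distance that the multiset has moved in between. By Lipschitz duality, the total displacement of
the removed elements is at most that distance. -/
theorem LipClose.removeClosest {k t : ℕ} {s u : Multiset ℕ} {D : ℝ}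
    (h : LipClose s (u + Multiset.replicate k t) D)
    (hgood : k ≤ (s.filter fun x => x ≤ 2 * t).card) :
    LipClose (removeClosest k t s) u (2 * D) := by
  obtain ⟨A, hA, hc, hAR⟩ := removeClosest_spec k t s
  set R := PrivHist.removeClosest k t s with hR
  have hks : k ≤ s.card := hgood.trans (Multiset.card_le_card (Multiset.filter_le _ _))
  rw [min_eq_left hks] at hc
  set ρ := A.toFinset.sup fun a => Nat.dist a t with hρ
  have hAρ : ∀ a ∈ A, Nat.dist a t ≤ ρ := fun a ha =>
    Finset.le_sup (f := fun a => Nat.dist a t) (Multiset.mem_toFinset.2 ha)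
  have hRρ : ∀ b ∈ R, ρ ≤ Nat.dist b t := fun b hb =>
    Finset.sup_le fun a ha => hAR a (Multiset.mem_toFinset.1 ha) b hb
  have hρt : ρ ≤ t := by
    refine Finset.sup_le fun a ha => ?_
    rw [Multiset.mem_toFinset] at ha
    by_contra! hlt
    have e := congrArg (fun u => (Multiset.filter (fun x => x ≤ 2 * t) u).card) hA
    simp only [Multiset.filter_add, Multiset.card_add] at e
    have e1 : R.filter (fun x => x ≤ 2 * t) = 0 := by
      rw [Multiset.filter_eq_nil]
      intro b hb hb2
      have := hAR a ha b hb
      unfold Nat.dist at *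
      omega
    have e2 : (A.filter fun x => x ≤ 2 * t).card < A.card := by
      refine Multiset.card_lt_card (lt_of_le_of_ne (Multiset.filter_le _ _) fun he => ?_)
      have := (Multiset.filter_eq_self.1 he) a ha
      unfold Nat.dist at *
      omega
    rw [e1, Multiset.card_zero] at e
    omega
  -- as `ρ ≤ t`, the distance to `t` capped at `ρ` and shifted by `-ρ` vanishes at `0`; it also
  -- vanishes on the remaining elements
  set g₁ : ℕ → ℝ := fun x => (min (Nat.dist x t) ρ : ℕ) - (ρ : ℝ) with hg₁
  have hlip : UnitLip g₁ := by
    constructor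
    · have : min (Nat.dist 0 t) ρ = ρ := by unfold Nat.dist; omega
      simp only [hg₁, this, sub_self]
    · intro r
      simp only [hg₁, sub_sub_sub_cancel_right]
      rw [abs_le]
      have a1 : min (Nat.dist (r + 1) t) ρ ≤ min (Nat.dist r t) ρ + 1 := by
        unfold Nat.dist; omega
      have a2 : min (Nat.dist r t) ρ ≤ min (Nat.dist (r + 1) t) ρ + 1 := by
        unfold Nat.dist; omega
      have a1' : ((min (Nat.dist (r + 1) t) ρ : ℕ) : ℝ) ≤ (min (Nat.dist r t) ρ : ℕ) + 1 := by
        exact_mod_cast a1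
      have a2' : ((min (Nat.dist r t) ρ : ℕ) : ℝ) ≤ (min (Nat.dist (r + 1) t) ρ : ℕ) + 1 := by
        exact_mod_cast a2
      constructor <;> linarith
  have hphiR : ∀ B : Multiset ℕ, (∀ b ∈ B, ρ ≤ Nat.dist b t) → phi g₁ B = 0 := by
    intro B
    induction B using Multiset.induction_on with
    | empty => simp
    | cons b B ih =>
      intro hB
      rw [phi_cons, ih fun b hb => hB b (Multiset.mem_cons_of_mem hb), hg₁]
      simp [min_eq_right (hB b (Multiset.mem_cons_self b B))]
  have hphiA : ∀ B : Multiset ℕ, (∀ b ∈ B, Nat.dist b t ≤ ρ) →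
      phi g₁ B = phi (fun x => (Nat.dist x t : ℝ)) B - B.card * ρ := by
    intro B
    induction B using Multiset.induction_on with
    | empty => simp
    | cons b B ih =>
      intro hB
      rw [phi_cons, phi_cons, ih fun b hb => hB b (Multiset.mem_cons_of_mem hb), hg₁]
      simp only [min_eq_left (hB b (Multiset.mem_cons_self b B)), Multiset.card_cons]
      push_cast
      ring
  have hphiu : phi g₁ u ≤ 0 := by
    have : ∀ x ∈ u.map g₁, x ≤ 0 := by
      intro x hx
      obtain ⟨y, -, rfl⟩ := Multiset.mem_map.1 hx
      simp only [hg₁, sub_nonpos, Nat.cast_le]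
      exact min_le_right _ _
    have h3 := Multiset.sum_le_card_nsmul (u.map g₁) 0 this
    simpa [phi] using h3
  have hcost : phi (fun x => (Nat.dist x t : ℝ)) A ≤ D := by
    have h1 := (abs_le.1 (h g₁ hlip)).2
    rw [← hA, phi_add, hphiA A hAρ, hphiR R hRρ, phi_add, phi_replicate, hc] at h1
    have : g₁ t = -ρ := by simp [hg₁, Nat.dist]
    rw [this] at h1
    linarith
  intro g hg
  have h1 := h g hg
  rw [← hA, phi_add, phi_add, phi_replicate] at h1
  have hmove : ∀ B : Multiset ℕ, |phi g B - B.card * g t| ≤ phi (fun x => (Nat.dist x t : ℝ)) B := by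
    intro B
    induction B using Multiset.induction_on with
    | empty => simp
    | cons b B ih =>
      rw [phi_cons, phi_cons, Multiset.card_cons]
      have h2 := hg.abs_sub_le b t
      have h3 : |(b : ℝ) - t| = (Nat.dist b t : ℝ) := by
        rcases le_total b t with hbt | hbt
        · rw [Nat.dist_eq_sub_of_le hbt, Nat.cast_sub hbt, abs_sub_comm, abs_of_nonneg]
          simpa using hbt
        · rw [Nat.dist_eq_sub_of_le_right hbt, Nat.cast_sub hbt, abs_of_nonneg]
          simpa using hbt
      have h4 := abs_add_le (g b - g t) (phi g B - B.card * g t)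
      have e : g b - g t + (phi g B - B.card * g t) =
          g b + phi g B - ((B.card + 1 : ℕ) : ℝ) * g t := by push_cast; ring
      rw [e] at h4
      linarith
  have h5 := hmove A
  rw [hc] at h5
  have h6 := abs_sub (phi g A + phi g R - (phi g u + k * g t)) (phi g A - k * g t)
  have e : phi g A + phi g R - (phi g u + k * g t) - (phi g A - k * g t) = phi g R - phi g u := by
    ring
  rw [e] at h6
  linarith

/-! ### Splitting at the threshold -/

theorem sum_count_eq_card_filter (s : Multiset ℕ) (I : Finset ℕ) :
    ∑ j ∈ I, s.count j = (s.filter fun x => x ∈ I).card := by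
  induction s using Multiset.induction_on with
  | empty => simp
  | cons a s ih =>
    simp only [Multiset.count_cons, Finset.sum_add_distrib, ih, Finset.sum_ite_eq',
      Multiset.filter_cons]
    split_ifs <;> simp

/-- For prevalences that are nonnegative below `T`, the clipping of the small part only acts on
the sums as a whole. -/
theorem smallCum_succ {T : ℕ} {φ : ℕ → ℤ} (hφ : ∀ s < T, 0 ≤ φ s) :
    ∀ j ≤ T, smallCum T φ (j + 1) = max 0 (∑ s ∈ Finset.Icc (T - j) T, φ s) := by
  intro j
  induction j with
  | zero => intro _; simp [smallCum]
  | succ j ih =>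
    intro hj
    have h1 : ∑ s ∈ Finset.Icc (T - (j + 1)) T, φ s =
        φ (T - (j + 1)) + ∑ s ∈ Finset.Icc (T - j) T, φ s := by
      rw [← Finset.insert_Icc_succ_left_eq_Icc (by omega), Finset.sum_insert (by simp)]
      congr 3
      rw [Order.succ_eq_add_one]
      omega
    have h2 := hφ (T - (j + 1)) (by omega)
    rw [smallCum, ih (by omega), h1]
    omega

theorem largeCum_eq {T : ℕ} {φ : ℕ → ℤ} (hφ : ∀ s > T + 1, 0 ≤ φ s) :
    ∀ j, largeCum T φ j = max 0 (∑ s ∈ Finset.Ico (T + 1) (T + 1 + j), φ s) := by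
  intro j
  induction j with
  | zero => simp [largeCum]
  | succ j ih =>
    have h0 : Finset.Icc (T + 1) (T + 1 + j) = Finset.Ico (T + 1) (T + 1 + j + 1) := by
      ext; simp
    rw [largeCum, ih, h0, ← add_assoc, Finset.sum_Ico_succ_top (by omega)]
    rcases Nat.eq_zero_or_pos j with rfl | hj
    · simp
    · have := hφ (T + 1 + j) (by omega)
      omega

/-- The number of elements of `h` in `[r, T]`. -/
def midCard (h : AnonHist) (T r : ℕ) : ℕ := (h.counts.filter fun x => r ≤ x ∧ x ≤ T).card

/-- The number of elements of `h` in `[T + 1, T + j]`. -/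
def highCard (h : AnonHist) (T j : ℕ) : ℕ := (h.counts.filter fun x => T < x ∧ x ≤ T + j).card

/-- All cumulative prevalences of the small part carry the same offset `M - z`, from the fake
elements at `T`. -/
theorem smallCumPrev_eq (h : AnonHist) {T M : ℕ} (z : ℤ) {r : ℕ} (hr : 1 ≤ r) (hrT : r ≤ T) :
    smallCumPrev h T M z r = max 0 (midCard h T r + M - z) := by
  rw [smallCumPrev, show T + 1 - r = (T - r) + 1 by omega, smallCum_succ _ _ (by omega)]
  · congr 1
    rw [show T - (T - r) = r by omega]
    simp only [shiftedPrev, Finset.sum_add_distrib, Finset.sum_ite_eq', Finset.mem_Icc]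
    rw [if_pos ⟨hrT, le_rfl⟩, if_neg (by omega), ← Nat.cast_sum]
    simp only [AnonHist.prev]
    rw [sum_count_eq_card_filter, midCard]
    simp only [Finset.mem_Icc]
    ring
  · intro s hs
    simp only [shiftedPrev]
    rw [if_neg (by omega), if_neg (by omega)]
    omega

/-- The counting function of the large part carries the offset `M + z`, from the fake elements at
`T + 1`, clipped at `0` as a whole. -/
theorem largeCum_shiftedPrev (h : AnonHist) (T M : ℕ) (z : ℤ) (j : ℕ) :
    largeCum T (shiftedPrev h T M z) j = if j = 0 then 0 else max 0 (highCard h T j + M + z) := by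
  rw [largeCum_eq]
  · split_ifs with hj
    · simp [hj]
    congr 1
    simp only [shiftedPrev, Finset.sum_add_distrib, Finset.sum_ite_eq', Finset.mem_Ico]
    rw [if_neg (by omega), if_pos (by omega), ← Nat.cast_sum]
    simp only [AnonHist.prev]
    rw [sum_count_eq_card_filter, highCard]
    have : (h.counts.filter fun x => x ∈ Finset.Ico (T + 1) (T + 1 + j)) =
        h.counts.filter fun x => T < x ∧ x ≤ T + j := by
      refine Multiset.filter_congr fun x _ => ?_
      simp only [Finset.mem_Ico]
      omega
    rw [this]
    ring
  · intro s hs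
    simp only [shiftedPrev]
    rw [if_neg (by omega), if_neg (by omega)]
    omega

theorem highCard_mono (h : AnonHist) (T : ℕ) {j j' : ℕ} (hj : j ≤ j') :
    highCard h T j ≤ highCard h T j' :=
  Multiset.card_le_card (Multiset.monotone_filter_right _ fun x hx => ⟨hx.1, by omega⟩)

theorem highCard_eq_of_total_le (h : AnonHist) (T : ℕ) {j j' : ℕ} (hj : h.total ≤ j)
    (hj' : h.total ≤ j') : highCard h T j = highCard h T j' := by
  unfold highCard
  congr 1
  refine Multiset.filter_congr fun x hx => ?_
  have : x ≤ h.total := Multiset.le_sum_of_mem hx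
  omega

theorem highCard_succ (h : AnonHist) (T j : ℕ) :
    highCard h T (j + 1) = highCard h T j + h.prev (T + 1 + j) := by
  unfold highCard AnonHist.prev
  induction h.counts using Multiset.induction_on with
  | empty => simp
  | cons a s ih =>
    simp only [Multiset.filter_cons, Multiset.count_cons, Multiset.card_add, ih]
    split_ifs <;> simp <;> omega

theorem count_largeCounts (h : AnonHist) (T M : ℕ) (z : ℤ) (v : ℕ) :
    (largeCounts h T M z).count v = if T < v then
      (largeCum T (shiftedPrev h T M z) (v - T) - largeCum T (shiftedPrev h T M z) (v - T - 1)).toNat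
      else 0 := by
  rw [largeCounts, Multiset.count_sum']
  simp only [Multiset.count_replicate]
  split_ifs with hv
  · by_cases hlt : v - T - 1 < h.total + 1
    · rw [Finset.sum_eq_single (v - T - 1)]
      · rw [if_pos (by omega), show v - T - 1 + 1 = v - T by omega]
      · intro b _ hb
        rw [if_neg (by omega)]
      · intro hb
        simp only [Finset.mem_range] at hb
        omega
    · rw [Finset.sum_eq_zero, largeCum_shiftedPrev, largeCum_shiftedPrev, if_neg (by omega),
        if_neg (by omega), highCard_eq_of_total_le h T (j := v - T) (j' := v - T - 1) (by omega)
        (by omega)]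
      · simp
      · intro b hb
        simp only [Finset.mem_range] at hb
        rw [if_neg (by omega)]
  · refine Finset.sum_eq_zero fun b _ => ?_
    rw [if_neg (by omega)]

/-- If `M + z` is negative, the clipping takes elements out of the large part of `h`. -/
theorem largeCounts_le (h : AnonHist) (T M : ℕ) (z : ℤ) :
    largeCounts h T M z ≤
      (h.counts.filter fun x => T < x) + Multiset.replicate (M + z).toNat (T + 1) := by
  rw [Multiset.le_iff_count]
  intro v
  rw [count_largeCounts, Multiset.count_add, Multiset.count_replicate, Multiset.count_filter]
  split_ifs with h1 h2 h2 <;> try omega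
  · subst h2
    have := highCard_succ h T 0
    simp only [largeCum_shiftedPrev, AnonHist.prev, add_zero, zero_add] at this ⊢
    have h0 : highCard h T 0 = 0 := by
      simp only [highCard, Multiset.card_eq_zero, Multiset.filter_eq_nil]
      omega
    rw [show T + 1 - T = 1 by omega]
    simp only [one_ne_zero, if_false, Nat.sub_self, if_true]
    omega
  · have := highCard_succ h T (v - T - 1)
    rw [show T + 1 + (v - T - 1) = v by omega, show v - T - 1 + 1 = v - T by omega] at this
    simp only [largeCum_shiftedPrev, AnonHist.prev] at this ⊢
    rw [if_neg (by omega), if_neg (by omega)]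
    omega

theorem largeCounts_eq (h : AnonHist) (T M : ℕ) {z : ℤ} (hz : 0 ≤ M + z) :
    largeCounts h T M z =
      (h.counts.filter fun x => T < x) + Multiset.replicate (M + z).toNat (T + 1) := by
  ext v
  rw [count_largeCounts, Multiset.count_add, Multiset.count_replicate, Multiset.count_filter]
  split_ifs with h1 h2 h2 <;> try omega
  · subst h2
    have := highCard_succ h T 0
    simp only [largeCum_shiftedPrev, AnonHist.prev, add_zero, zero_add] at this ⊢
    have h0 : highCard h T 0 = 0 := by
      simp only [highCard, Multiset.card_eq_zero, Multiset.filter_eq_nil]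
      omega
    rw [show T + 1 - T = 1 by omega]
    simp only [one_ne_zero, if_false, Nat.sub_self, if_true]
    omega
  · have := highCard_succ h T (v - T - 1)
    rw [show T + 1 + (v - T - 1) = v by omega, show v - T - 1 + 1 = v - T by omega] at this
    simp only [largeCum_shiftedPrev, AnonHist.prev] at this ⊢
    rw [if_neg (by omega), if_neg (by omega)]
    omega

/-! ### The effect of one item on the split histogram -/

/-- One count of `h` is increased by `1` in `h'`; the count `0` stands for a new label. -/
def Step (h h' : AnonHist) : Prop :=
  ∃ (t : Multiset ℕ) (r : ℕ),
    h.counts = (r ::ₘ t).filter (fun a => 0 < a) ∧ h'.counts = (r + 1) ::ₘ t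

/-- As `g 0 = 0`, a new label need not be distinguished from the raised count of an old one. -/
theorem Step.exists_phi {h h' : AnonHist} (hs : Step h h') :
    ∃ (t : Multiset ℕ) (r : ℕ), ∀ g : ℕ → ℝ, g 0 = 0 →
      phi g h.counts = g r + phi g t ∧ phi g h'.counts = g (r + 1) + phi g t := by
  obtain ⟨t, r, h1, h2⟩ := hs
  refine ⟨t, r, fun g hg => ⟨?_, ?_⟩⟩
  · rw [h1, phi_filter_pos hg, phi_cons]
  · rw [h2, phi_cons]

theorem Step.total {h h' : AnonHist} (hs : Step h h') : h'.total = h.total + 1 := by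
  obtain ⟨t, r, hp⟩ := hs.exists_phi
  obtain ⟨h1, h2⟩ := hp (fun n => (n : ℝ)) (by simp)
  rw [phi_cast] at h1 h2
  rw [Nat.cast_succ] at h2
  have : (h'.counts.sum : ℝ) = h.counts.sum + 1 := by linarith
  exact_mod_cast this

theorem Step.card_filter {h h' : AnonHist} (hs : Step h h') :
    ∃ (t : Multiset ℕ) (r : ℕ), ∀ (p : ℕ → Prop) [DecidablePred p], ¬ p 0 →
      (h.counts.filter p).card = (t.filter p).card + (if p r then 1 else 0) ∧
      (h'.counts.filter p).card = (t.filter p).card + (if p (r + 1) then 1 else 0) := by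
  obtain ⟨t, r, h1, h2⟩ := hs
  refine ⟨t, r, fun p _ hp => ⟨?_, ?_⟩⟩
  · have : h.counts.filter p = (r ::ₘ t).filter p := by
      rw [h1, Multiset.filter_filter]
      refine Multiset.filter_congr fun x _ => ⟨fun hx => hx.1, fun hx => ⟨hx, ?_⟩⟩
      rcases Nat.eq_zero_or_pos x with rfl | h0
      · exact absurd hx hp
      · exact h0
    rw [this, Multiset.filter_cons, Multiset.card_add]
    split_ifs <;> simp
    omega
  · rw [h2, Multiset.filter_cons, Multiset.card_add]
    split_ifs <;> simp
    omega

/-- Raising an element by `1` alters a single entry of the decreasing list, if the raised element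
is the first among those equal to it. -/
theorem exists_sort_cons_eq (r : ℕ) (X : Multiset ℕ) :
    ∃ A B : List ℕ, (r ::ₘ X).sort (fun a b => b ≤ a) = A ++ r :: B ∧
      ((r + 1) ::ₘ X).sort (fun a b => b ≤ a) = A ++ (r + 1) :: B := by
  set A := (X.filter fun x => r < x).sort (fun a b => b ≤ a) with hA
  set B := (X.filter fun x => ¬ r < x).sort (fun a b => b ≤ a) with hB
  have hmA : ∀ x ∈ A, r < x := fun x hx => by
    rw [hA, Multiset.mem_sort, Multiset.mem_filter] at hx
    exact hx.2
  have hmB : ∀ x ∈ B, x ≤ r := fun x hx => by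
    rw [hB, Multiset.mem_sort, Multiset.mem_filter] at hx
    exact not_lt.1 hx.2
  have key : ∀ y, (y = r ∨ y = r + 1) →
      (y ::ₘ X).sort (fun a b => b ≤ a) = A ++ y :: B := by
    intro y hy
    have hp : ((y ::ₘ X).sort (fun a b => b ≤ a)).Perm (A ++ y :: B) := by
      rw [← Multiset.coe_eq_coe, Multiset.sort_eq, ← Multiset.coe_add, ← Multiset.cons_coe, hA, hB,
        Multiset.sort_eq, Multiset.sort_eq, Multiset.add_cons, Multiset.filter_add_not]
    have hs1 : ((y ::ₘ X).sort (fun a b => b ≤ a)).Pairwise fun a b => b ≤ a :=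
      Multiset.pairwise_sort _ _
    have hs2 : (A ++ y :: B).Pairwise fun a b => b ≤ a := by
      rw [List.pairwise_append, List.pairwise_cons]
      refine ⟨Multiset.pairwise_sort _ _, ⟨fun x hx => ?_, Multiset.pairwise_sort _ _⟩, ?_⟩
      · have := hmB x hx; omega
      · intro a ha b hb
        have h1 := hmA a ha
        rcases List.mem_cons.1 hb with rfl | hb
        · omega
        · have := hmB b hb; omega
    exact hp.eq_of_pairwise (fun a b _ _ h1 h2 => le_antisymm h2 h1) hs1 hs2
  exact ⟨A, B, key r (Or.inl rfl), key (r + 1) (Or.inr rfl)⟩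

theorem exists_ofFn_of_append_cons (A B : List ℕ) (r r' : ℕ) :
    ∃ (n : ℕ) (v v' : Fin n → ℕ), A ++ r :: B = List.ofFn v ∧ A ++ r' :: B = List.ofFn v' ∧
      ∑ i, ((v i : ℤ) - v' i).natAbs ≤ ((r : ℤ) - r').natAbs := by
  set n := A.length + (B.length + 1) with hn
  refine ⟨n, fun i => (A ++ r :: B)[(i : ℕ)]'(by simp; omega),
    fun i => (A ++ r' :: B)[(i : ℕ)]'(by simp; omega), ?_, ?_, ?_⟩
  · refine List.ext_getElem (by simp; omega) fun i h1 h2 => by rw [List.getElem_ofFn]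
  · refine List.ext_getElem (by simp; omega) fun i h1 h2 => by rw [List.getElem_ofFn]
  · rw [Finset.sum_eq_single ⟨A.length, by omega⟩]
    · simp
    · intro i _ hi
      have hi' : (i : ℕ) ≠ A.length := fun h => hi (Fin.ext h)
      simp only [List.getElem_append]
      split_ifs with h
      · simp
      · have : (i : ℕ) - A.length ≠ 0 := by omega
        obtain ⟨k, hk⟩ := Nat.exists_eq_succ_of_ne_zero this
        simp [hk]
    · simp

/-- The split histograms of `h` and `h'`, with the shifts `z` and `δ + z`, together with the
shift differ by at most one item. -/
def Coupled (h h' : AnonHist) (T M : ℕ) : Prop :=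
  ∃ δ : ℤ, ∀ z : ℤ, ∃ (n : ℕ) (v v' : Fin n → ℕ),
    largeList h T M z = List.ofFn v ∧ largeList h' T M (δ + z) = List.ofFn v' ∧
      δ.natAbs +
        ∑ i : Fin T, (smallCumPrev h T M z (i + 1) - smallCumPrev h' T M (δ + z) (i + 1)).natAbs +
        ∑ i, ((v i : ℤ) - v' i).natAbs ≤ 1

theorem Coupled.symm {h h' : AnonHist} {T M : ℕ} (hc : Coupled h h' T M) : Coupled h' h T M := by
  obtain ⟨δ, hδ⟩ := hc
  refine ⟨-δ, fun z => ?_⟩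
  obtain ⟨n, v, v', h1, h2, h3⟩ := hδ (-δ + z)
  rw [add_neg_cancel_left] at h2 h3
  refine ⟨n, v', v, h2, h1, ?_⟩
  rw [Int.natAbs_neg]
  have hc : ∀ a b : ℤ, (a - b).natAbs = (b - a).natAbs := fun a b => by omega
  simpa only [hc (smallCumPrev h' _ _ _ _), hc ((v' _ : ℕ) : ℤ)] using h3

/-- Raising a count below `T` changes at most one cumulative prevalence of the small part, and
raising one above `T` changes at most one element of the large part, without a shift. A count that
rises from `T` to `T + 1` moves an element from the small part to the large one, which the shift by
`-1` undoes. -/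
theorem Step.coupled {h h' : AnonHist} (hs : Step h h') (T M : ℕ) : Coupled h h' T M := by
  obtain ⟨t, r, hp⟩ := hs.card_filter
  have hmid : ∀ s, 1 ≤ s → midCard h T s = (t.filter fun x => s ≤ x ∧ x ≤ T).card +
        (if s ≤ r ∧ r ≤ T then 1 else 0) ∧
      midCard h' T s = (t.filter fun x => s ≤ x ∧ x ≤ T).card +
        (if s ≤ r + 1 ∧ r + 1 ≤ T then 1 else 0) :=
    fun s h1 => hp (fun x => s ≤ x ∧ x ≤ T) (by omega)
  have hhigh : ∀ j, highCard h T j = (t.filter fun x => T < x ∧ x ≤ T + j).card +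
        (if T < r ∧ r ≤ T + j then 1 else 0) ∧
      highCard h' T j = (t.filter fun x => T < x ∧ x ≤ T + j).card +
        (if T < r + 1 ∧ r + 1 ≤ T + j then 1 else 0) :=
    fun j => hp (fun x => T < x ∧ x ≤ T + j) (by omega)
  have hsame : ∀ L : List ℕ, ∃ (n : ℕ) (v : Fin n → ℕ), L = List.ofFn v := fun L =>
    ⟨_, _, (List.ofFn_get L).symm⟩
  have hlist : ∀ z z' : ℤ, (∀ j, largeCum T (shiftedPrev h T M z) j =
      largeCum T (shiftedPrev h' T M z') j) → largeList h T M z = largeList h' T M z' := by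
    intro z z' he
    have : largeCounts h T M z = largeCounts h' T M z' := by
      ext v
      rw [count_largeCounts, count_largeCounts, he, he]
    rw [largeList, largeList, this]
  rcases lt_trichotomy r T with hr | rfl | hr
  · -- the item moves within the small part
    refine ⟨0, fun z => ?_⟩
    obtain ⟨n, v, hv⟩ := hsame (largeList h T M z)
    refine ⟨n, v, v, hv, ?_, ?_⟩
    · rw [← hv, zero_add, eq_comm]
      refine hlist _ _ fun j => ?_
      rw [largeCum_shiftedPrev, largeCum_shiftedPrev, (hhigh j).1, (hhigh j).2,
        if_neg (by omega : ¬ (T < r ∧ r ≤ T + j)), if_neg (by omega : ¬ (T < r + 1 ∧ r + 1 ≤ T + j))]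
    · simp only [sub_self, Int.natAbs_zero, Finset.sum_const_zero, add_zero, zero_add]
      rw [Finset.sum_eq_single ⟨r, hr⟩]
      · rw [smallCumPrev_eq h z (by simp) hr, smallCumPrev_eq h' z (by simp) hr,
          (hmid _ (by simp)).1, (hmid _ (by simp)).2]
        split_ifs <;> omega
      · intro i _ hi
        have hi' : (i : ℕ) ≠ r := fun h => hi (Fin.ext h)
        rw [smallCumPrev_eq h z (by simp) i.2, smallCumPrev_eq h' z (by simp) i.2,
          (hmid _ (by simp)).1, (hmid _ (by simp)).2]
        have := i.2
        split_ifs <;> omega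
      · simp
  · -- the item crosses the threshold, which the shift makes up for
    refine ⟨-1, fun z => ?_⟩
    obtain ⟨n, v, hv⟩ := hsame (largeList h r M z)
    refine ⟨n, v, v, hv, ?_, ?_⟩
    · rw [← hv, eq_comm]
      refine hlist _ _ fun j => ?_
      rw [largeCum_shiftedPrev, largeCum_shiftedPrev, (hhigh j).1, (hhigh j).2]
      split_ifs <;> omega
    · simp only [sub_self, Int.natAbs_zero, Finset.sum_const_zero, add_zero]
      rw [Finset.sum_eq_zero]
      · simp
      · intro i _
        rw [smallCumPrev_eq h z (by simp) i.2, smallCumPrev_eq h' _ (by simp) i.2,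
          (hmid _ (by simp)).1, (hmid _ (by simp)).2]
        have := i.2
        split_ifs <;> omega
  · -- the item moves within the large part
    refine ⟨0, fun z => ?_⟩
    rw [zero_add]
    have hsmall : ∑ i : Fin T, (smallCumPrev h T M z (i + 1) -
        smallCumPrev h' T M z (i + 1)).natAbs = 0 := by
      refine Finset.sum_eq_zero fun i _ => ?_
      rw [smallCumPrev_eq h z (by simp) i.2, smallCumPrev_eq h' _ (by simp) i.2,
        (hmid _ (by simp)).1, (hmid _ (by simp)).2, if_neg (by omega), if_neg (by omega)]
      simp
    rw [hsmall]
    have hne : ∀ j, j ≠ r - T → largeCum T (shiftedPrev h T M z) j =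
        largeCum T (shiftedPrev h' T M z) j := by
      intro j hj
      rw [largeCum_shiftedPrev, largeCum_shiftedPrev, (hhigh j).1, (hhigh j).2]
      split_ifs <;> omega
    set P := largeCum T (shiftedPrev h T M z) with hP
    set P' := largeCum T (shiftedPrev h' T M z) with hP'
    by_cases heq : P (r - T) = P' (r - T)
    · -- the clipping has taken the item out of both large parts
      obtain ⟨n, v, hv⟩ := hsame (largeList h T M z)
      refine ⟨n, v, v, hv, ?_, by simp⟩
      rw [← hv, eq_comm]
      refine hlist _ _ fun j => ?_
      by_cases hj : j = r - T
      · rw [hj]; exact heq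
      · exact hne j hj
    · -- otherwise `r` is in the large part of `h`, and is raised in that of `h'`
      have e1 : P (r - T) = P' (r - T) + 1 ∧ P (r - T - 1) ≤ P' (r - T) ∧
          P (r - T) ≤ P (r - T + 1) := by
        have m1 := highCard_mono h T (show r - T - 1 ≤ r - T by omega)
        have m2 := highCard_mono h T (show r - T ≤ r - T + 1 by omega)
        simp only [hP, hP', largeCum_shiftedPrev, (hhigh _).1, (hhigh _).2] at heq m1 m2 ⊢
        rw [if_neg (by omega : ¬ r - T = 0), if_pos (by omega : T < r ∧ r ≤ T + (r - T)),
          if_neg (by omega : ¬ (T < r + 1 ∧ r + 1 ≤ T + (r - T)))] at heq ⊢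
        rw [if_neg (by omega : ¬ (T < r ∧ r ≤ T + (r - T - 1))),
          if_pos (by omega : T < r ∧ r ≤ T + (r - T))] at m1
        rw [if_neg (by omega : ¬ (T < r ∧ r ≤ T + (r - T - 1))),
          if_neg (by omega : ¬ r - T + 1 = 0)]
        have m3 : (t.filter fun x => T < x ∧ x ≤ T + (r - T - 1)).card ≤
            (t.filter fun x => T < x ∧ x ≤ T + (r - T)).card :=
          Multiset.card_le_card (Multiset.monotone_filter_right _ fun x hx => ⟨hx.1, by omega⟩)
        split_ifs at m2 ⊢ <;> omega
      have hcount : (largeCounts h T M z).count r = (P (r - T) - P (r - T - 1)).toNat := by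
        rw [count_largeCounts, if_pos hr]
      have hmem : r ∈ largeCounts h T M z := by
        rw [← Multiset.count_pos, hcount]
        omega
      obtain ⟨X, hX⟩ := Multiset.exists_cons_of_mem hmem
      have hX' : largeCounts h' T M z = (r + 1) ::ₘ X := by
        ext v
        have c1 := congrArg (Multiset.count v) hX
        rw [count_largeCounts, Multiset.count_cons] at c1
        rw [count_largeCounts, Multiset.count_cons]
        rw [← hP] at c1
        rw [← hP']
        rcases eq_or_ne v r with rfl | h1
        · rw [if_pos hr, if_pos rfl] at c1
          rw [if_pos hr, if_neg (by omega), ← hne (v - T - 1) (by omega)]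
          omega
        · rcases eq_or_ne v (r + 1) with rfl | h2
          · rw [if_pos (by omega), if_neg (by omega), show r + 1 - T - 1 = r - T by omega,
              show r + 1 - T = r - T + 1 by omega] at c1
            rw [if_pos (by omega), if_pos rfl, show r + 1 - T - 1 = r - T by omega,
              show r + 1 - T = r - T + 1 by omega, ← hne (r - T + 1) (by omega)]
            omega
          · rw [if_neg h1] at c1
            rw [if_neg h2]
            split_ifs at c1 ⊢ with hv
            · rw [← hne (v - T) (by omega), ← hne (v - T - 1) (by omega)]
              exact c1
            · exact c1
      obtain ⟨A, B, hA, hB⟩ := exists_sort_cons_eq r X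
      obtain ⟨n, v, v', h1, h2, h3⟩ := exists_ofFn_of_append_cons A B r (r + 1)
      refine ⟨n, v, v', ?_, ?_, ?_⟩
      · rw [largeList, hX, hA, h1]
      · rw [largeList, hX', hB, h2]
      · simp only [Int.natAbs_zero, zero_add]
        refine h3.trans ?_
        push_cast
        omega

/-- A dataset pair attaining distance `1` differs in the count of a single label. -/
theorem step_of_neighbor {h h' : AnonHist} (hn : Neighbor h h') : Step h h' ∨ Step h' h := by
  have hmem : (1 : ℕ) ∈ {d : ℕ | ∃ D D' : ℕ →₀ ℕ, histOf D = h ∧ histOf D' = h' ∧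
      datasetDist D D' = d} := by
    have h1 : histDist h h' = 1 := hn
    have hne : {d : ℕ | ∃ D D' : ℕ →₀ ℕ, histOf D = h ∧ histOf D' = h' ∧
        datasetDist D D' = d}.Nonempty := by
      by_contra he
      rw [Set.not_nonempty_iff_eq_empty] at he
      rw [histDist, he, Nat.sInf_empty] at h1
      omega
    have := Nat.sInf_mem hne
    rwa [← histDist, h1] at this
  obtain ⟨D, D', rfl, rfl, hd⟩ := hmem
  clear hn
  have hstep : ∀ (D D' : ℕ →₀ ℕ) (x : ℕ), (∀ y ≠ x, D y = D' y) → D' x = D x + 1 →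
      Step (histOf D) (histOf D') := by
    intro D D' x hne hx
    have hx' : x ∈ D'.support := by rw [Finsupp.mem_support_iff]; omega
    refine ⟨((D'.support.erase x).val.map D'), D x, ?_, ?_⟩
    · have he : (D'.support.erase x).val.map D' = (D'.support.erase x).val.map D :=
        Multiset.map_congr rfl fun y hy => (hne y (Finset.ne_of_mem_erase hy)).symm
      rw [he, ← Multiset.map_cons, Finset.erase_val, Multiset.cons_erase hx']
      simp only [histOf]
      rw [Multiset.filter_map]
      congr 1
      have : D.support = D'.support.filter fun y => 0 < D y := by
        ext y
        simp only [Finsupp.mem_support_iff, Finset.mem_filter]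
        rcases eq_or_ne y x with rfl | hy
        · omega
        · rw [hne y hy]; omega
      rw [this]
      rfl
    · rw [← hx, ← Multiset.map_cons, Finset.erase_val, Multiset.cons_erase hx']
      rfl
  rw [datasetDist] at hd
  obtain ⟨x, hx, hx0⟩ := Finset.exists_ne_zero_of_sum_ne_zero (by omega :
    ∑ x ∈ D.support ∪ D'.support, ((D x : ℤ) - (D' x : ℤ)).natAbs ≠ 0)
  rw [← Finset.add_sum_erase _ _ hx] at hd
  have hx1 : ((D x : ℤ) - (D' x : ℤ)).natAbs = 1 := by omega
  have hrest : ∀ y ∈ D.support ∪ D'.support, y ≠ x → ((D y : ℤ) - (D' y : ℤ)).natAbs = 0 :=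
    fun y hy hyx => Finset.sum_eq_zero_iff.1 (by omega :
      ∑ x ∈ (D.support ∪ D'.support).erase x, ((D x : ℤ) - (D' x : ℤ)).natAbs = 0) y
      (Finset.mem_erase.2 ⟨hyx, hy⟩)
  have hne : ∀ y ≠ x, D y = D' y := by
    intro y hy
    by_cases hyS : y ∈ D.support ∪ D'.support
    · have := hrest y hyS hy
      omega
    · simp only [Finset.mem_union, Finsupp.mem_support_iff, not_or, not_not] at hyS
      omega
  rcases (by omega : D' x = D x + 1 ∨ D x = D' x + 1) with hlt | hlt
  · exact Or.inl (hstep D D' x hne hlt)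
  · exact Or.inr (hstep D' D x (fun y hy => (hne y hy).symm) hlt)

/-! ### Smoothing onto the boundaries -/

/-- The share of an element `j` that smoothing places at or above the boundary `s`: it rises
linearly from `0` at the preceding boundary to `1` at `s`. -/
noncomputable def ramp (S : Finset ℕ) (s j : ℕ) : ℝ :=
  ((min j s : ℕ) - (min j (prevBoundary S s) : ℕ) : ℝ) / ((s : ℝ) - prevBoundary S s)

theorem prevBoundary_lt {S : Finset ℕ} {s : ℕ} (hs : 0 < s) : prevBoundary S s < s := by
  rw [prevBoundary, Finset.sup_lt_iff (by simpa using hs)]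
  intro x hx
  exact (Finset.mem_filter.1 hx).2

theorem le_prevBoundary {S : Finset ℕ} {s x : ℕ} (hx : x ∈ S) (hxs : x < s) :
    x ≤ prevBoundary S s :=
  Finset.le_sup (f := id) (Finset.mem_filter.2 ⟨hx, hxs⟩)

/-- The smoothed cumulative prevalence as a sum over the interval before `s` and the elements
from `s` on. -/
theorem smoothedCumPrev_eq_sum {S : Finset ℕ} (φ : ℕ → ℕ) :
    ∀ (n s : ℕ), s ∈ S → (S.filter fun x => s < x).card = n →
      smoothedCumPrev S φ s = ∑ j ∈ Finset.Ico (prevBoundary S s) s,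
        (φ j : ℝ) * (((j : ℝ) - prevBoundary S s) / ((s : ℝ) - prevBoundary S s)) +
        ∑ j ∈ Finset.Ico s (S.sup id + 1), (φ j : ℝ) := by
  intro n
  induction n using Nat.strong_induction_on with
  | _ n ih =>
  intro s hs hn
  by_cases hne : (S.filter fun x => s < x).Nonempty
  · -- the next boundary `t`
    set t := (S.filter fun x => s < x).min' hne with ht
    have htm := Finset.min'_mem _ hne
    rw [← ht, Finset.mem_filter] at htm
    obtain ⟨htS, hst⟩ := htm
    have hnext : nextBoundary S s = t := by rw [nextBoundary, dif_pos hne]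
    have hmin : ∀ x ∈ S, s < x → t ≤ x := fun x hx hsx =>
      Finset.min'_le _ _ (Finset.mem_filter.2 ⟨hx, hsx⟩)
    have hprev : prevBoundary S t = s := by
      apply le_antisymm
      · refine Finset.sup_le fun x hx => ?_
        rw [Finset.mem_filter] at hx
        by_contra! hlt
        have := hmin x hx.1 hlt
        omega
      · exact le_prevBoundary hs hst
    have hsplit : S.filter (fun x => s ≤ x) = insert s (S.filter fun x => t ≤ x) := by
      ext x
      simp only [Finset.mem_filter, Finset.mem_insert]
      constructor
      · rintro ⟨hx, hsx⟩
        rcases eq_or_lt_of_le hsx with h | h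
        · exact Or.inl h.symm
        · exact Or.inr ⟨hx, hmin x hx h⟩
      · rintro (rfl | ⟨hx, htx⟩)
        · exact ⟨hs, le_rfl⟩
        · exact ⟨hx, by omega⟩
    have hrec := ih (S.filter fun x => t < x).card
      (by rw [← hn]
          refine Finset.card_lt_card ⟨fun x hx => ?_, fun hsub => ?_⟩
          · rw [Finset.mem_filter] at hx ⊢; exact ⟨hx.1, by omega⟩
          · have := hsub (Finset.mem_filter.2 ⟨htS, hst⟩)
            simp at this) t htS rfl
    have hstep : smoothedCumPrev S φ s = smoothedPrev S φ s + smoothedCumPrev S φ t := by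
      rw [smoothedCumPrev, hsplit, Finset.sum_insert (by simp; omega)]
      rfl
    rw [hstep, hrec, smoothedPrev, hnext, hprev]
    have htS' : t ≤ S.sup id := Finset.le_sup (f := id) htS
    have h1 : Finset.Icc s t = Finset.Ico s (t + 1) := by ext; simp
    rw [h1, Finset.sum_Ico_succ_top hst.le,
      ← Finset.sum_Ico_consecutive (fun j => (φ j : ℝ)) hst.le (by omega : t ≤ S.sup id + 1)]
    have h2 : ∑ j ∈ Finset.Ico s t, (φ j : ℝ) =
        ∑ j ∈ Finset.Ico s t, (φ j : ℝ) * (((t : ℝ) - j) / ((t : ℝ) - s)) +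
        ∑ j ∈ Finset.Ico s t, (φ j : ℝ) * (((j : ℝ) - s) / ((t : ℝ) - s)) := by
      rw [← Finset.sum_add_distrib]
      refine Finset.sum_congr rfl fun j _ => ?_
      have : (t : ℝ) - s ≠ 0 := sub_ne_zero.2 (by exact_mod_cast hst.ne')
      field_simp
      ring
    rw [h2]
    simp only [sub_self, zero_div, mul_zero, add_zero]
    ring
  · have hlast : ∀ x ∈ S, x ≤ s := fun x hx => by
      by_contra! hlt
      exact hne ⟨x, Finset.mem_filter.2 ⟨hx, hlt⟩⟩
    have hsup : S.sup id = s := le_antisymm (Finset.sup_le hlast) (Finset.le_sup (f := id) hs)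
    have hS : S.filter (fun x => s ≤ x) = {s} := by
      ext x
      simp only [Finset.mem_filter, Finset.mem_singleton]
      constructor
      · rintro ⟨hx, hsx⟩
        exact le_antisymm (hlast x hx) hsx
      · rintro rfl
        exact ⟨hs, le_rfl⟩
    rw [smoothedCumPrev, hS, Finset.sum_singleton, smoothedPrev, nextBoundary, dif_neg hne, hsup]
    have h1 : Finset.Icc s (s + 1) = {s, s + 1} := by ext; simp; omega
    rw [h1, Finset.sum_pair (by omega)]
    push_cast
    simp
    ring

/-- An element at `j` contributes `ramp S s j` to the smoothed cumulative prevalence at `s`: the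
triangular smoothing kernels at the boundaries from `s` on add up to a ramp. -/
theorem smoothedCumPrev_eq_sum_ramp {S : Finset ℕ} (h0 : 0 ∉ S) (φ : ℕ → ℕ) {s : ℕ} (hs : s ∈ S) :
    smoothedCumPrev S φ s = ∑ j ∈ Finset.range (S.sup id + 1), (φ j : ℝ) * ramp S s j := by
  have hs0 : 0 < s := Nat.pos_of_ne_zero fun h => h0 (h ▸ hs)
  have hp := prevBoundary_lt (S := S) hs0
  have hsup : s ≤ S.sup id := Finset.le_sup (f := id) hs
  rw [smoothedCumPrev_eq_sum φ _ s hs rfl, Finset.range_eq_Ico,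
    ← Finset.sum_Ico_consecutive _ (Nat.zero_le (prevBoundary S s)) (by omega),
    ← Finset.sum_Ico_consecutive _ hp.le (by omega : s ≤ S.sup id + 1)]
  have h1 : ∑ j ∈ Finset.Ico 0 (prevBoundary S s), (φ j : ℝ) * ramp S s j = 0 := by
    refine Finset.sum_eq_zero fun j hj => ?_
    rw [Finset.mem_Ico] at hj
    rw [ramp, min_eq_left (by omega), min_eq_left (by omega)]
    simp
  rw [h1, zero_add]
  congr 1
  · refine Finset.sum_congr rfl fun j hj => ?_
    rw [Finset.mem_Ico] at hj
    rw [ramp, min_eq_left (by omega), min_eq_right (by omega)]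
  · refine Finset.sum_congr rfl fun j hj => ?_
    rw [Finset.mem_Ico] at hj
    have : (s : ℝ) - prevBoundary S s ≠ 0 := sub_ne_zero.2 (by exact_mod_cast hp.ne')
    rw [ramp, min_eq_right (by omega), min_eq_right (by omega), div_self this, mul_one]

theorem sum_count_mul (s : Multiset ℕ) (n : ℕ) (hs : ∀ x ∈ s, x < n) (W : ℕ → ℝ) :
    ∑ j ∈ Finset.range n, (s.count j : ℝ) * W j = phi W s := by
  induction s using Multiset.induction_on with
  | empty => simp
  | cons a s ih =>
    rw [phi_cons, ← ih fun x hx => hs x (Multiset.mem_cons_of_mem hx)]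
    simp only [Multiset.count_cons, Nat.cast_add, add_mul, Finset.sum_add_distrib]
    rw [add_comm]
    congr 1
    simp [hs a (Multiset.mem_cons_self a s)]

theorem clippedPrev_eq_count (h : AnonHist) (N j : ℕ) :
    clippedPrev h N j = (h.counts.map fun y => min y (2 * N)).count j := by
  rw [Multiset.count_map, clippedPrev]
  split_ifs with h1 h2
  · rw [AnonHist.prev, Multiset.count_eq_card_filter_eq]
    congr 1
    refine Multiset.filter_congr fun x _ => ?_
    omega
  · congr 1
    refine Multiset.filter_congr fun x _ => ?_
    omega
  · rw [eq_comm, Multiset.card_eq_zero, Multiset.filter_eq_nil]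
    intro x _
    omega

/-- The smoothed cumulative prevalences are additive over the elements of the histogram. -/
theorem smoothedCumPrev_clippedPrev {S : Finset ℕ} (h0 : 0 ∉ S) (h : AnonHist) {N : ℕ}
    (hN : 2 * N ∈ S) {s : ℕ} (hs : s ∈ S) :
    smoothedCumPrev S (clippedPrev h N) s = phi (fun y => ramp S s (min y (2 * N))) h.counts := by
  rw [smoothedCumPrev_eq_sum_ramp h0 _ hs]
  simp only [clippedPrev_eq_count]
  rw [sum_count_mul]
  · rw [phi, phi, Multiset.map_map]
    rfl
  · intro x hx
    obtain ⟨y, -, rfl⟩ := Multiset.mem_map.1 hx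
    have : 2 * N ≤ S.sup id := Finset.le_sup (f := id) hN
    omega

theorem smoothedCumPrev_antitone (S : Finset ℕ) (φ : ℕ → ℕ) {s t : ℕ}
    (h0 : 0 ∉ S) (hst : s ≤ t) : smoothedCumPrev S φ t ≤ smoothedCumPrev S φ s := by
  refine Finset.sum_le_sum_of_subset_of_nonneg (fun x hx => ?_) fun x hx _ => ?_
  · rw [Finset.mem_filter] at hx ⊢
    exact ⟨hx.1, by omega⟩
  · have hx0 : 0 < x := Nat.pos_of_ne_zero fun h => h0 (h ▸ (Finset.mem_filter.1 hx).1)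
    have hnext : x ≤ nextBoundary S x := by
      rw [nextBoundary]
      split_ifs with hne
      · have := Finset.min'_mem _ hne
        rw [Finset.mem_filter] at this
        omega
      · omega
    have h1 : (x : ℝ) ≤ nextBoundary S x := by exact_mod_cast hnext
    have h2 : ((prevBoundary S x : ℕ) : ℝ) ≤ x := by exact_mod_cast (prevBoundary_lt hx0).le
    refine add_nonneg (Finset.sum_nonneg fun j hj => ?_) (Finset.sum_nonneg fun j hj => ?_)
    · rw [Finset.mem_Icc] at hj
      have : (j : ℝ) ≤ nextBoundary S x := by exact_mod_cast hj.2
      exact mul_nonneg (Nat.cast_nonneg _) (div_nonneg (by linarith) (by linarith))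
    · rw [Finset.mem_Ico] at hj
      have : ((prevBoundary S x : ℕ) : ℝ) ≤ j := by exact_mod_cast hj.1
      exact mul_nonneg (Nat.cast_nonneg _) (div_nonneg (by linarith) (by linarith))

theorem boundary_mem (S : Finset ℕ) (i : Fin S.card) : boundary S i ∈ S :=
  Finset.orderEmbOfFin_mem S rfl i

theorem boundary_strictMono (S : Finset ℕ) : StrictMono (boundary S) :=
  (S.orderEmbOfFin rfl).strictMono

theorem exists_boundary_eq {S : Finset ℕ} {s : ℕ} (hs : s ∈ S) : ∃ i, boundary S i = s := by
  have : s ∈ Set.range (S.orderEmbOfFin rfl) := by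
    rw [Finset.range_orderEmbOfFin]
    exact hs
  exact this

theorem predVal_boundary (S : Finset ℕ) (i : Fin S.card) :
    predVal (boundary S) i = prevBoundary S (boundary S i) := by
  rw [predVal]
  split_ifs with h
  · apply le_antisymm
    · refine le_prevBoundary (boundary_mem S _) (boundary_strictMono S ?_)
      rw [Fin.lt_def]
      simp only
      omega
    · refine Finset.sup_le fun x hx => ?_
      rw [Finset.mem_filter] at hx
      obtain ⟨j, rfl⟩ := exists_boundary_eq hx.1
      have hj := (boundary_strictMono S).lt_iff_lt.1 hx.2
      refine (boundary_strictMono S).monotone ?_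
      rw [Fin.lt_def] at hj
      rw [Fin.le_def]
      simp only
      omega
  · symm
    rw [prevBoundary]
    refine Nat.le_zero.1 (Finset.sup_le fun x hx => ?_)
    rw [Finset.mem_filter] at hx
    obtain ⟨j, rfl⟩ := exists_boundary_eq hx.1
    have hj := (boundary_strictMono S).lt_iff_lt.1 hx.2
    rw [Fin.lt_def] at hj
    omega

theorem boundary_pos {S : Finset ℕ} (h0 : 0 ∉ S) (i : Fin S.card) : 0 < boundary S i :=
  Nat.pos_of_ne_zero fun h => h0 (h ▸ boundary_mem S i)

theorem boundaryGap_pos {S : Finset ℕ} (h0 : 0 ∉ S) (i : Fin S.card) : 0 < boundaryGap S i := by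
  rw [boundaryGap, sub_pos]
  exact_mod_cast prevBoundary_lt (boundary_pos h0 i)

/-- Differences along a sequence that starts from `0` telescope, to the last value `x`. -/
theorem sum_sub_predVal {m : ℕ} (s : Fin m → ℕ) :
    ∃ x, (∀ f : ℕ → ℝ, ∑ i, (f (s i) - f (predVal s i)) = f x - f 0) ∧
      (Monotone s → ∀ i, s i ≤ x) := by
  set S : ℕ → ℕ := fun n => if h : 0 < n ∧ n ≤ m then s ⟨n - 1, by omega⟩ else 0 with hS
  refine ⟨S m, fun f => ?_, fun hs i => ?_⟩
  swap
  · have hi := i.2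
    simp only [hS]
    rw [dif_pos (by omega)]
    refine hs ?_
    rw [Fin.le_def]
    simp only
    omega
  have h2 : ∑ i, (f (s i) - f (predVal s i)) =
      ∑ n ∈ Finset.range m, (f (S (n + 1)) - f (S n)) := by
    rw [← Fin.sum_univ_eq_sum_range (fun n => f (S (n + 1)) - f (S n))]
    refine Finset.sum_congr rfl fun i _ => ?_
    have hi := i.2
    simp only [hS, Nat.succ_pos, Nat.succ_le_of_lt hi, dif_pos,
      Nat.add_sub_cancel, predVal, hi.le, and_true]
  rw [h2, Finset.sum_range_sub (fun n => f (S n))]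
  simp [hS]

/-- Weighted by the gaps, moving one element changes the smoothed cumulative prevalences by at
most the distance of the move: the differences have one sign and telescope. -/
theorem sum_gap_mul_abs_ramp_sub_le {S : Finset ℕ} (h0 : 0 ∉ S) (a b : ℕ) :
    ∑ i, boundaryGap S i * |ramp S (boundary S i) b - ramp S (boundary S i) a| ≤
      |(b : ℝ) - a| := by
  wlog hab : a ≤ b generalizing a b
  · rw [abs_sub_comm]
    simp only [abs_sub_comm (ramp S _ b)]
    exact this b a (by omega)
  have hterm : ∀ i, boundaryGap S i * |ramp S (boundary S i) b - ramp S (boundary S i) a| =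
      ((min b (boundary S i) : ℕ) - (min a (boundary S i) : ℕ) : ℝ) -
        ((min b (predVal (boundary S) i) : ℕ) - (min a (predVal (boundary S) i) : ℕ) : ℝ) := by
    intro i
    have hg := boundaryGap_pos h0 i
    rw [predVal_boundary]
    have hp := prevBoundary_lt (S := S) (boundary_pos h0 i)
    set s := boundary S i with hs
    set p := prevBoundary S s with hp'
    have hnn : 0 ≤ ramp S s b - ramp S s a := by
      rw [ramp, ramp, ← sub_div]
      refine div_nonneg ?_ hg.le
      have : min a s + min b p ≤ min b s + min a p := by omega
      have : ((min a s : ℕ) : ℝ) + (min b p : ℕ) ≤ (min b s : ℕ) + (min a p : ℕ) := by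
        exact_mod_cast this
      linarith
    have hg' : (s : ℝ) - prevBoundary S s ≠ 0 := hg.ne'
    rw [abs_of_nonneg hnn, ramp, ramp, ← sub_div,
      show boundaryGap S i = (s : ℝ) - prevBoundary S s from rfl, mul_div_cancel₀ _ hg']
    ring
  rw [Finset.sum_congr rfl fun i _ => hterm i]
  obtain ⟨x, hx, -⟩ := sum_sub_predVal (boundary S)
  rw [hx fun y => ((min b y : ℕ) - (min a y : ℕ) : ℝ)]
  have hc : (a : ℝ) ≤ b := by exact_mod_cast hab
  rw [abs_of_nonneg (by linarith)]
  have : min b x + a ≤ b + min a x := by omega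
  have : ((min b x : ℕ) : ℝ) + a ≤ b + (min a x : ℕ) := by exact_mod_cast this
  simp only [Nat.min_zero, Nat.cast_zero, sub_zero]
  linarith

/-- A point at a boundary is counted in full up to there. -/
theorem ramp_of_mem {S : Finset ℕ} {s t : ℕ} (h0 : 0 ∉ S) (hs : s ∈ S) (ht : t ∈ S ∨ t = 0) :
    ramp S s t = if s ≤ t then 1 else 0 := by
  have hs0 : 0 < s := Nat.pos_of_ne_zero fun h => h0 (h ▸ hs)
  have hp := prevBoundary_lt (S := S) hs0
  rw [ramp]
  split_ifs with h
  · rw [min_eq_right h, min_eq_right (by omega), div_self]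
    exact sub_ne_zero.2 (by exact_mod_cast hp.ne')
  · have : t ≤ prevBoundary S s := by
      rcases ht with ht | rfl
      · exact le_prevBoundary ht (by omega)
      · omega
    rw [min_eq_left (by omega), min_eq_left this]
    simp

/-! ### The mechanism in stages -/

instance : DiscreteMeasurableSpace AnonHist := ⟨fun _ => trivial⟩

instance : Countable AnonHist :=
  Function.Injective.countable (f := AnonHist.counts) fun _ _ h => AnonHist.ext h

/-- The law of the output, given the noisy split histogram. -/
noncomputable def outputLaw (ε : ℝ) (h : AnonHist) (T M N : ℕ) (cs : Fin T → ℤ) (cl : Multiset ℤ) :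
    Measure (AnonHist × ℕ) :=
  if 1 < ε then Measure.dirac (lowPrivacy T M cs cl, N)
  else (highPrivacy h cl T N (ε / 3)).map fun H => (H, N)

/-- The law of the output, given the split histogram before noise is added to its parts. -/
noncomputable def splitLaw (ε : ℝ) (h : AnonHist) (T M N : ℕ) (cs : Fin T → ℤ) (l : List ℕ) :
    Measure (AnonHist × ℕ) :=
  (Measure.pi fun _ : Fin T => twoSidedGeometric (Real.exp (-(ε / 3)))).bind fun zs =>
    (Measure.pi fun _ : Fin l.length => twoSidedGeometric (Real.exp (-(ε / 3)))).bind fun zl =>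
      outputLaw ε h T M N (fun i => cs i + zs i) (List.ofFn fun i => (l.get i : ℤ) + zl i : List ℤ)

/-- The law of the output, given the noisy number `N` of items. -/
noncomputable def givenLaw (ε : ℝ) (h : AnonHist) (N : ℕ) : Measure (AnonHist × ℕ) :=
  if N = 0 then Measure.dirac (AnonHist.ofCounts 0, 0) else
  (twoSidedGeometric (Real.exp (-(ε / 3)))).bind fun zb =>
    splitLaw ε h (threshold ε N) (fakeCount ε N) N
      (fun i => smallCumPrev h (threshold ε N) (fakeCount ε N) zb ((i : ℕ) + 1))
      (largeList h (threshold ε N) (fakeCount ε N) zb)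

theorem lintegral_bind_of_discrete {α β : Type*} [MeasurableSpace α] [DiscreteMeasurableSpace α]
    [MeasurableSpace β] [DiscreteMeasurableSpace β] (μ : Measure α) (κ : α → Measure β)
    (F : β → ℝ≥0∞) : ∫⁻ b, F b ∂(μ.bind κ) = ∫⁻ a, ∫⁻ b, F b ∂(κ a) ∂μ :=
  Measure.lintegral_bind (Measurable.of_discrete).aemeasurable (Measurable.of_discrete).aemeasurable

theorem lintegral_privHist (ε : ℝ) (h : AnonHist) (F : AnonHist × ℕ → ℝ≥0∞) :
    ∫⁻ o, F o ∂(privHist ε h) = ∫⁻ za, ∫⁻ o, F o ∂(givenLaw ε h (max ((h.total : ℤ) + za) 0).toNat)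
      ∂(twoSidedGeometric (Real.exp (-(ε / 3)))) :=
  lintegral_bind_of_discrete _ _ _

/-- Integration against the law of the noisy large part. -/
noncomputable def noisyIntegral (a : ℝ) (l : List ℕ) (K : Multiset ℤ → ℝ≥0∞) : ℝ≥0∞ :=
  ∫⁻ zl, K (List.ofFn fun i => (l.get i : ℤ) + zl i : List ℤ)
    ∂(Measure.pi fun _ : Fin l.length => twoSidedGeometric a)

theorem noisyIntegral_ofFn (a : ℝ) {n : ℕ} (v : Fin n → ℕ) (K : Multiset ℤ → ℝ≥0∞) :
    noisyIntegral a (List.ofFn v) K = ∫⁻ zl, K (List.ofFn fun i => (v i : ℤ) + zl i : List ℤ)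
      ∂(Measure.pi fun _ : Fin n => twoSidedGeometric a) := by
  have key : ∀ (l : List ℕ) (n : ℕ) (hl : l.length = n), noisyIntegral a l K =
      ∫⁻ zl, K (List.ofFn fun i => (l.get (Fin.cast hl.symm i) : ℤ) + zl i : List ℤ)
      ∂(Measure.pi fun _ : Fin n => twoSidedGeometric a) := by
    rintro l _ rfl
    rfl
  rw [key _ n (by simp)]
  simp

theorem lintegral_splitLaw (ε : ℝ) (h : AnonHist) (T M N : ℕ) (cs : Fin T → ℤ) (l : List ℕ)
    (F : AnonHist × ℕ → ℝ≥0∞) :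
    ∫⁻ o, F o ∂(splitLaw ε h T M N cs l) =
      ∫⁻ zs, noisyIntegral (Real.exp (-(ε / 3))) l
        (fun cl => ∫⁻ o, F o ∂(outputLaw ε h T M N (cs + zs) cl))
        ∂(Measure.pi fun _ : Fin T => twoSidedGeometric (Real.exp (-(ε / 3)))) := by
  rw [splitLaw, lintegral_bind_of_discrete]
  congr 1 with zs
  rw [lintegral_bind_of_discrete]
  rfl

theorem lintegral_givenLaw (ε : ℝ) (h : AnonHist) {N : ℕ} (hN : N ≠ 0)
    (F : AnonHist × ℕ → ℝ≥0∞) :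
    ∫⁻ o, F o ∂(givenLaw ε h N) = ∫⁻ zb, ∫⁻ o, F o ∂(splitLaw ε h (threshold ε N) (fakeCount ε N) N
      (fun i => smallCumPrev h (threshold ε N) (fakeCount ε N) zb ((i : ℕ) + 1))
      (largeList h (threshold ε N) (fakeCount ε N) zb))
      ∂(twoSidedGeometric (Real.exp (-(ε / 3)))) := by
  rw [givenLaw, if_neg hN, lintegral_bind_of_discrete]

/-! ### Privacy -/

theorem threshold_pos {ε : ℝ} (hε : 0 < ε) {N : ℕ} (hN : N ≠ 0) : 0 < threshold ε N := by
  rw [threshold, Nat.ceil_pos]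
  have : (0 : ℝ) < N := by exact_mod_cast Nat.pos_of_ne_zero hN
  have : 0 < min ε 1 := lt_min hε one_pos
  positivity

theorem zero_notMem_boundaries {ε₃ : ℝ} (hε : 0 < ε₃) {T N : ℕ} (hT : 0 < T) (hN : N ≠ 0)
    (cl : Multiset ℤ) : 0 ∉ boundaries cl T N ε₃ := by
  simp only [boundaries, Finset.mem_union, Finset.mem_Icc, Finset.mem_image, Finset.mem_range,
    Multiset.mem_toFinset, Multiset.mem_map, Multiset.mem_filter, Finset.mem_singleton, not_or]
  refine ⟨⟨⟨by omega, ?_⟩, ?_⟩, by omega⟩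
  · rintro ⟨i, -, hi⟩
    rw [Nat.floor_eq_zero] at hi
    have h1 : (1 : ℝ) ≤ T := by exact_mod_cast hT
    have h2 : (1 : ℝ) ≤ (1 + gridRatio N ε₃) ^ i :=
      one_le_pow₀ (by have : 0 ≤ gridRatio N ε₃ := Real.sqrt_nonneg _
                      linarith)
    nlinarith
  · rintro ⟨x, ⟨-, hx⟩, hx0⟩
    have : 0 < gridEnd N ε₃ := by
      rw [gridEnd, Nat.ceil_pos]
      have : (0 : ℝ) < N := by exact_mod_cast Nat.pos_of_ne_zero hN
      positivity
    omega

theorem two_mul_mem_boundaries (cl : Multiset ℤ) (T N : ℕ) (ε₃ : ℝ) :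
    2 * N ∈ boundaries cl T N ε₃ := by
  simp [boundaries]

theorem ramp_zero (S : Finset ℕ) (s : ℕ) : ramp S s 0 = 0 := by simp [ramp]

/-- The sensitivity of the smoothed cumulative prevalences is the reciprocal of the gap, up to a
total of `1`. Clipping at `2 N` only helps. -/
theorem Step.sum_gap_le {h h' : AnonHist} (hs : Step h h') {S : Finset ℕ} (h0 : 0 ∉ S) {N : ℕ}
    (hN : 2 * N ∈ S) :
    ∑ i, boundaryGap S i * |smoothedCumPrev S (clippedPrev h N) (boundary S i) -
      smoothedCumPrev S (clippedPrev h' N) (boundary S i)| ≤ 1 := by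
  obtain ⟨t, r, hp⟩ := hs.exists_phi
  have h1 : ∀ i, smoothedCumPrev S (clippedPrev h N) (boundary S i) -
      smoothedCumPrev S (clippedPrev h' N) (boundary S i) =
      ramp S (boundary S i) (min r (2 * N)) - ramp S (boundary S i) (min (r + 1) (2 * N)) := by
    intro i
    rw [smoothedCumPrev_clippedPrev h0 h hN (boundary_mem S i),
      smoothedCumPrev_clippedPrev h0 h' hN (boundary_mem S i)]
    obtain ⟨e1, e2⟩ := hp (fun y => ramp S (boundary S i) (min y (2 * N))) (by simp [ramp_zero])
    rw [e1, e2]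
    ring
  simp only [h1]
  refine (sum_gap_mul_abs_ramp_sub_le h0 _ _).trans ?_
  have a1 : min r (2 * N) ≤ min (r + 1) (2 * N) := by omega
  have a2 : min (r + 1) (2 * N) ≤ min r (2 * N) + 1 := by omega
  have a1' : ((min r (2 * N) : ℕ) : ℝ) ≤ (min (r + 1) (2 * N) : ℕ) := by exact_mod_cast a1
  have a2' : ((min (r + 1) (2 * N) : ℕ) : ℝ) ≤ (min r (2 * N) : ℕ) + 1 := by exact_mod_cast a2
  rw [abs_le]
  constructor <;> linarith

/-- For given boundaries, the high privacy release is private; regression and rounding are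
post-processing. -/
theorem highPrivacy_le {h h' : AnonHist} (hs : Step h h' ∨ Step h' h) {ε₃ : ℝ} (hε : 0 < ε₃)
    {T N : ℕ} (hT : 0 < T) (hN : N ≠ 0) (cl : Multiset ℤ) :
    highPrivacy h cl T N ε₃ ≤ ENNReal.ofReal (Real.exp ε₃) • highPrivacy h' cl T N ε₃ := by
  set S := boundaries cl T N ε₃ with hS
  have h0 : 0 ∉ S := zero_notMem_boundaries hε hT hN cl
  have h2 : 2 * N ∈ S := two_mul_mem_boundaries cl T N ε₃
  have hgap := fun i => boundaryGap_pos h0 i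
  have hb : ∀ i, 0 < 1 / (ε₃ * boundaryGap S i) := fun i => by
    have := hgap i
    positivity
  have hw : ∀ i, 0 < boundaryGap S i ^ 2 := fun i => by
    have := hgap i
    positivity
  have hm := measurable_of_roundedFit hw (boundary S) AnonHist.ofCounts
  have hmap : ∀ h : AnonHist, highPrivacy h cl T N ε₃ =
      ((Measure.pi fun i : Fin S.card => laplace (1 / (ε₃ * boundaryGap S i))).map
        fun z i => smoothedCumPrev S (clippedPrev h N) (boundary S i) + z i).map
        fun y => AnonHist.ofCounts (roundedFit (boundary S) (fun i => boundaryGap S i ^ 2) y) := by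
    intro h
    rw [Measure.map_map hm (by fun_prop)]
    rfl
  rw [hmap, hmap, ← Measure.map_smul]
  refine Measure.map_mono ((pi_laplace_map_add_le hb _
    fun i => smoothedCumPrev S (clippedPrev h' N) (boundary S i)).trans ?_) hm
  gcongr
  have hsum : ∑ i, boundaryGap S i * |smoothedCumPrev S (clippedPrev h N) (boundary S i) -
      smoothedCumPrev S (clippedPrev h' N) (boundary S i)| ≤ 1 := by
    rcases hs with hs | hs
    · exact hs.sum_gap_le h0 h2
    · have := hs.sum_gap_le h0 h2
      simpa only [abs_sub_comm] using this
  calc _ = ε₃ * ∑ i, boundaryGap S i * |smoothedCumPrev S (clippedPrev h N) (boundary S i) -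
      smoothedCumPrev S (clippedPrev h' N) (boundary S i)| := by
        rw [Finset.mul_sum]
        refine Finset.sum_congr rfl fun i _ => ?_
        rw [div_div_eq_mul_div, div_one]
        ring
    _ ≤ ε₃ * 1 := by gcongr
    _ = ε₃ := mul_one _

/-- For `ε > 1` the output is a function of the perturbed parts; for `ε ≤ 1` the histogram is used
once more. -/
theorem lintegral_outputLaw_le {h h' : AnonHist} (hs : Step h h' ∨ Step h' h) {ε : ℝ} (hε : 0 < ε)
    {T N : ℕ} (hT : 0 < T) (hN : N ≠ 0) (M : ℕ) (cs : Fin T → ℤ) (cl : Multiset ℤ)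
    (F : AnonHist × ℕ → ℝ≥0∞) :
    ∫⁻ o, F o ∂(outputLaw ε h T M N cs cl) ≤
      ENNReal.ofReal (Real.exp (ε / 3)) * ∫⁻ o, F o ∂(outputLaw ε h' T M N cs cl) := by
  rw [← smul_eq_mul, ← lintegral_smul_measure]
  refine lintegral_mono' ?_ le_rfl
  unfold outputLaw
  split_ifs
  · refine Measure.le_iff.2 fun S _ => ?_
    rw [Measure.smul_apply, smul_eq_mul]
    refine le_mul_of_one_le_left zero_le ?_
    rw [ENNReal.one_le_ofReal]
    exact Real.one_le_exp (by positivity)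
  · rw [← Measure.map_smul]
    exact Measure.map_mono (highPrivacy_le hs (by positivity) hT hN cl) .of_discrete

/-- The price of perturbing the two parts, in terms of their `ℓ₁` distances. -/
theorem lintegral_splitLaw_le {h h' : AnonHist} (hs : Step h h' ∨ Step h' h) {ε : ℝ} (hε : 0 < ε)
    {T N : ℕ} (hT : 0 < T) (hN : N ≠ 0) (M : ℕ) (cs cs' : Fin T → ℤ) {n : ℕ} (v v' : Fin n → ℕ)
    (F : AnonHist × ℕ → ℝ≥0∞) :
    ∫⁻ o, F o ∂(splitLaw ε h T M N cs (List.ofFn v)) ≤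
      ENNReal.ofReal (Real.exp (ε / 3) * Real.exp (ε / 3) ^
        (∑ i, (cs i - cs' i).natAbs + ∑ i, ((v i : ℤ) - v' i).natAbs)) *
        ∫⁻ o, F o ∂(splitLaw ε h' T M N cs' (List.ofFn v')) := by
  have ha0 : 0 < Real.exp (-(ε / 3)) := Real.exp_pos _
  have ha1 : Real.exp (-(ε / 3)) < 1 := by rw [Real.exp_lt_one_iff]; linarith
  have hinv : (Real.exp (-(ε / 3)))⁻¹ = Real.exp (ε / 3) := by rw [Real.exp_neg, inv_inv]
  rw [lintegral_splitLaw, lintegral_splitLaw]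
  refine (lintegral_pi_geometric_add_le ha0 ha1 cs cs' fun y =>
    noisyIntegral (Real.exp (-(ε / 3))) (List.ofFn v)
      fun cl => ∫⁻ o, F o ∂(outputLaw ε h T M N y cl)).trans ?_
  rw [hinv, pow_add, mul_left_comm, ENNReal.ofReal_mul (by positivity), mul_assoc]
  gcongr
  rw [← lintegral_const_mul' _ _ ENNReal.ofReal_ne_top]
  refine lintegral_mono fun zs => ?_
  rw [noisyIntegral_ofFn, noisyIntegral_ofFn]
  have h1 := lintegral_pi_geometric_add_le ha0 ha1 (fun i => (v i : ℤ)) (fun i => (v' i : ℤ))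
    fun y => ∫⁻ o, F o ∂(outputLaw ε h T M N (cs' + zs) (List.ofFn y : List ℤ))
  refine (h1.trans ?_)
  rw [hinv, mul_comm (Real.exp (ε / 3)), ENNReal.ofReal_mul (by positivity), mul_assoc]
  gcongr
  rw [← lintegral_const_mul' _ _ ENNReal.ofReal_ne_top]
  exact lintegral_mono fun zl => lintegral_outputLaw_le hs hε hT hN M _ _ F

/-- Of the three shares of `ε`, the shift, the small part and the large part together use one, as
their changes add up to at most `1`, and the high privacy release uses another. -/
theorem lintegral_givenLaw_le {h h' : AnonHist} (hs : Step h h' ∨ Step h' h) {ε : ℝ} (hε : 0 < ε)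
    (N : ℕ) (F : AnonHist × ℕ → ℝ≥0∞) :
    ∫⁻ o, F o ∂(givenLaw ε h N) ≤
      ENNReal.ofReal (Real.exp (ε / 3) ^ 2) * ∫⁻ o, F o ∂(givenLaw ε h' N) := by
  have hexp : 1 ≤ Real.exp (ε / 3) := Real.one_le_exp (by positivity)
  by_cases hN : N = 0
  · rw [givenLaw, givenLaw, if_pos hN, if_pos hN]
    refine le_mul_of_one_le_left zero_le ?_
    rw [ENNReal.one_le_ofReal]
    exact one_le_pow₀ hexp
  have ha0 : 0 < Real.exp (-(ε / 3)) := Real.exp_pos _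
  have ha1 : Real.exp (-(ε / 3)) < 1 := by rw [Real.exp_lt_one_iff]; linarith
  have hinv : (Real.exp (-(ε / 3)))⁻¹ = Real.exp (ε / 3) := by rw [Real.exp_neg, inv_inv]
  set T := threshold ε N with hT
  set M := fakeCount ε N with hM
  have hT0 : 0 < T := threshold_pos hε hN
  obtain ⟨δ, hδ⟩ : Coupled h h' T M := by
    rcases hs with hs | hs
    · exact hs.coupled T M
    · exact (hs.coupled T M).symm
  have hδ1 : δ.natAbs ≤ 1 := by
    obtain ⟨n, v, v', -, -, h3⟩ := hδ 0
    omega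
  rw [lintegral_givenLaw ε h hN, lintegral_givenLaw ε h' hN, ← hT, ← hM]
  set K : ℤ → ℝ≥0∞ := fun zb => ∫⁻ o, F o ∂(splitLaw ε h' T M N
      (fun i => smallCumPrev h' T M zb ((i : ℕ) + 1)) (largeList h' T M zb)) with hK
  have hpt : ∀ zb, ∫⁻ o, F o ∂(splitLaw ε h T M N
      (fun i => smallCumPrev h T M zb ((i : ℕ) + 1)) (largeList h T M zb)) ≤
      ENNReal.ofReal (Real.exp (ε / 3) * Real.exp (ε / 3) ^ (1 - δ.natAbs)) * K (δ + zb) := by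
    intro zb
    obtain ⟨n, v, v', h1, h2, h3⟩ := hδ zb
    simp only [hK]
    rw [h1, h2]
    refine (lintegral_splitLaw_le hs hε hT0 hN M _
      (fun i => smallCumPrev h' T M (δ + zb) ((i : ℕ) + 1)) v v' F).trans ?_
    gcongr
    omega
  refine (lintegral_mono hpt).trans ?_
  rw [lintegral_const_mul' _ _ ENNReal.ofReal_ne_top]
  have hshift := lintegral_add_twoSidedGeometric_le ha0 ha1 δ K
  rw [hinv] at hshift
  calc _ ≤ ENNReal.ofReal (Real.exp (ε / 3) * Real.exp (ε / 3) ^ (1 - δ.natAbs)) *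
        (ENNReal.ofReal (Real.exp (ε / 3) ^ δ.natAbs) *
          ∫⁻ z, K z ∂twoSidedGeometric (Real.exp (-(ε / 3)))) := by gcongr
    _ = _ := by
      rw [← mul_assoc, ← ENNReal.ofReal_mul (by positivity), mul_assoc, ← pow_add,
        Nat.sub_add_cancel hδ1, pow_one, sq]

/-- The remaining share of `ε` pays for the noisy number of items; the estimate is
post-processing. -/
theorem isDP_privateEstimator {ε : ℝ} (hε : 0 < ε) (a : ℕ → ℕ → ℝ) :
    IsDP ε (privateEstimator ε a) := by
  intro h h' hn
  have hs := step_of_neighbor hn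
  have ha0 : 0 < Real.exp (-(ε / 3)) := Real.exp_pos _
  have ha1 : Real.exp (-(ε / 3)) < 1 := by rw [Real.exp_lt_one_iff]; linarith
  have hinv : (Real.exp (-(ε / 3)))⁻¹ = Real.exp (ε / 3) := by rw [Real.exp_neg, inv_inv]
  have hF : ∀ F : AnonHist × ℕ → ℝ≥0∞, ∫⁻ o, F o ∂(privHist ε h) ≤
      ENNReal.ofReal (Real.exp ε) * ∫⁻ o, F o ∂(privHist ε h') := by
    intro F
    set K : ℤ → ℝ≥0∞ := fun n => ∫⁻ o, F o ∂(givenLaw ε h' (max n 0).toNat) with hK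
    rw [lintegral_privHist, lintegral_privHist]
    refine (lintegral_mono fun za => lintegral_givenLaw_le hs hε _ F).trans ?_
    rw [lintegral_const_mul' _ _ ENNReal.ofReal_ne_top]
    -- the numbers of items differ by one, which the noise on them hides
    have hshift := lintegral_add_twoSidedGeometric_le ha0 ha1 ((h.total : ℤ) - h'.total)
      fun z => K (h'.total + z)
    have habs : ((h.total : ℤ) - h'.total).natAbs = 1 := by
      rcases hs with hs | hs <;> have := hs.total <;> omega
    rw [hinv, habs, pow_one] at hshift
    have e : ∀ z : ℤ, (h'.total : ℤ) + ((h.total : ℤ) - h'.total + z) = h.total + z := fun z => by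
      ring
    simp only [e] at hshift
    calc _ ≤ ENNReal.ofReal (Real.exp (ε / 3) ^ 2) * (ENNReal.ofReal (Real.exp (ε / 3)) *
          ∫⁻ z, K (h'.total + z) ∂twoSidedGeometric (Real.exp (-(ε / 3)))) := by gcongr
      _ = _ := by
        rw [← mul_assoc, ← ENNReal.ofReal_mul (by positivity), ← pow_succ, ← Real.exp_nat_mul]
        congr 3
        push_cast
        ring
  have hle : privHist ε h ≤ ENNReal.ofReal (Real.exp ε) • privHist ε h' := by
    refine Measure.le_iff.2 fun S _ => ?_
    have := hF (S.indicator 1)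
    rwa [lintegral_indicator_one .of_discrete, lintegral_indicator_one .of_discrete] at this
  intro S
  have := Measure.map_mono hle (f := fun o : AnonHist × ℕ => linearEstimate a o.2 o.1) .of_discrete
  rw [Measure.map_smul] at this
  exact this S

/-! ### Accuracy in the low privacy regime: a bound for fixed noise -/

theorem predVal_succ {T : ℕ} (i : Fin T) : predVal (fun i : Fin T => (i : ℕ) + 1) i = i := by
  rw [predVal]
  split_ifs with h
  · simp only
    omega
  · omega

theorem sum_telescope (g : ℕ → ℝ) (T : ℕ) : ∑ i : Fin T, (g (i + 1) - g i) = g T - g 0 := by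
  rw [Fin.sum_univ_eq_sum_range (fun i => g (i + 1) - g i), Finset.sum_range_sub]

/-- The part of a histogram up to `T`, from its cumulative counts. -/
theorem sum_midCard_mul {g : ℕ → ℝ} (hg : g 0 = 0) (h : AnonHist) (T : ℕ) :
    ∑ i : Fin T, (midCard h T (i + 1) : ℝ) * (g (i + 1) - g i) =
      phi g (h.counts.filter fun x => x ≤ T) := by
  unfold midCard
  induction h.counts using Multiset.induction_on with
  | empty => simp
  | cons a s ih =>
    have h1 : ∀ i : Fin T, (((a ::ₘ s).filter fun x => (i : ℕ) + 1 ≤ x ∧ x ≤ T).card : ℝ) =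
        (if (i : ℕ) + 1 ≤ a ∧ a ≤ T then 1 else 0) +
          ((s.filter fun x => (i : ℕ) + 1 ≤ x ∧ x ≤ T).card : ℝ) := by
      intro i
      rw [Multiset.filter_cons, Multiset.card_add, Nat.cast_add]
      congr 1
      split_ifs <;> simp
    simp only [h1, add_mul, Finset.sum_add_distrib, ih]
    rw [Multiset.filter_cons, phi_add]
    congr 1
    by_cases ha : a ≤ T
    · rw [if_pos ha]
      simp only [ha, and_true, ite_mul, one_mul, zero_mul]
      rw [Fin.sum_univ_eq_sum_range (fun i => if i + 1 ≤ a then g (i + 1) - g i else 0),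
        ← Finset.sum_filter]
      have : (Finset.range T).filter (fun i => i + 1 ≤ a) = Finset.range a := by
        ext; simp; omega
      rw [this, Finset.sum_range_sub, hg]
      simp [phi]
    · simp [ha]

/-- The cumulative prevalences of the small part. -/
def smallNat (h : AnonHist) (T M : ℕ) (z : ℤ) (i : Fin T) : ℕ :=
  (midCard h T (i + 1) + M - z).toNat

theorem smallCumPrev_eq_smallNat (h : AnonHist) (T M : ℕ) (z : ℤ) (i : Fin T) :
    smallCumPrev h T M z (i + 1) = (smallNat h T M z i : ℤ) := by
  rw [smallCumPrev_eq h z (by omega) (by omega : (i : ℕ) + 1 ≤ T), smallNat]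
  omega

theorem smallNat_antitone (h : AnonHist) (T M : ℕ) (z : ℤ) : Antitone (smallNat h T M z) := by
  intro i j hij
  have : midCard h T (j + 1) ≤ midCard h T (i + 1) :=
    Multiset.card_le_card (Multiset.monotone_filter_right _ fun x hx => ⟨by
      have : (i : ℕ) ≤ j := hij
      omega, hx.2⟩)
  unfold smallNat
  omega

/-- The small part of the split histogram. -/
noncomputable def smallCounts (h : AnonHist) (T M : ℕ) (z : ℤ) : Multiset ℕ :=
  countsOfCumulative (fun i : Fin T => (i : ℕ) + 1) (smallNat h T M z)

/-- `phi_countsOfCumulative` for the sequence `1, …, T`. -/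
theorem phi_cumulative_succ {g : ℕ → ℝ} (hg : g 0 = 0) {T : ℕ} {c : Fin T → ℕ} (hc : Antitone c) :
    phi g (countsOfCumulative (fun i : Fin T => (i : ℕ) + 1) c) =
      ∑ i, (c i : ℝ) * (g (i + 1) - g i) := by
  rw [phi_countsOfCumulative hg _ _ hc]
  simp only [predVal_succ]

theorem filter_le_add_filter_lt (s : Multiset ℕ) (T : ℕ) :
    s.filter (fun x => x ≤ T) + s.filter (fun x => T < x) = s := by
  have := Multiset.filter_add_not (fun x => x ≤ T) s
  simpa only [not_le] using this

theorem sum_filter_add (s : Multiset ℕ) (T : ℕ) :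
    (s.filter fun x => x ≤ T).sum + (s.filter fun x => T < x).sum = s.sum := by
  rw [← Multiset.sum_add, filter_le_add_filter_lt]

/-- The split histogram is close to the histogram with the fake elements. -/
theorem lipClose_split (h : AnonHist) (T M : ℕ) (z : ℤ) :
    LipClose (smallCounts h T M z + largeCounts h T M z)
      (h.counts + Multiset.replicate M T + Multiset.replicate M (T + 1))
      ((z.natAbs + if M < z.natAbs then 2 * h.total + 4 * z.natAbs * (2 * T + 1) else 0 : ℕ) : ℝ) := by
  by_cases hz : M < z.natAbs
  · rw [if_pos hz]
    refine lipClose_of_sum_le ?_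
    have h1 : (smallCounts h T M z).sum ≤
        (h.counts.filter fun x => x ≤ T).sum + T * (2 * z.natAbs) := by
      have e := phi_cumulative_succ (g := fun n => (n : ℝ)) (by simp) (smallNat_antitone h T M z)
      have e2 := sum_midCard_mul (g := fun n => (n : ℝ)) (by simp) h T
      rw [phi_cast] at e e2
      have : ((smallCounts h T M z).sum : ℝ) ≤
          (h.counts.filter fun x => x ≤ T).sum + T * (2 * z.natAbs) := by
        rw [smallCounts, e, ← e2]
        have : (T : ℝ) * (2 * z.natAbs) = ∑ i : Fin T, (2 * z.natAbs : ℝ) := by simp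
        rw [this, ← Finset.sum_add_distrib]
        refine Finset.sum_le_sum fun i _ => ?_
        push_cast
        rw [add_sub_cancel_left, mul_one, mul_one]
        have : smallNat h T M z i ≤ midCard h T (i + 1) + 2 * z.natAbs := by
          unfold smallNat
          omega
        exact_mod_cast this
      exact_mod_cast this
    have h2 : (largeCounts h T M z).sum ≤
        (h.counts.filter fun x => T < x).sum + 2 * z.natAbs * (T + 1) := by
      obtain ⟨u, hu⟩ := Multiset.le_iff_exists_add.1 (largeCounts_le h T M z)
      have e := congrArg Multiset.sum hu
      rw [Multiset.sum_add, Multiset.sum_add, Multiset.sum_replicate, smul_eq_mul] at e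
      have : (M + z).toNat * (T + 1) ≤ 2 * z.natAbs * (T + 1) := by
        gcongr
        omega
      omega
    have h3 := sum_filter_add h.counts T
    have h4 : M * T + M * (T + 1) ≤ z.natAbs * (2 * T + 1) := by
      have := Nat.mul_le_mul_right (2 * T + 1) hz.le
      linarith
    rw [Multiset.sum_add, Multiset.sum_add, Multiset.sum_add, Multiset.sum_replicate,
      Multiset.sum_replicate]
    simp only [AnonHist.total, smul_eq_mul]
    norm_cast
    nlinarith
  · rw [if_neg hz, add_zero]
    intro g hg
    have e1 : phi g (smallCounts h T M z) =
        phi g (h.counts.filter fun x => x ≤ T) + (M - z) * g T := by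
      rw [smallCounts, phi_cumulative_succ hg.1 (smallNat_antitone h T M z),
        ← sum_midCard_mul hg.1, ← sub_zero (g T), ← hg.1, ← sum_telescope, Finset.mul_sum,
        ← Finset.sum_add_distrib]
      refine Finset.sum_congr rfl fun i _ => ?_
      have : (smallNat h T M z i : ℤ) = midCard h T (i + 1) + M - z := by
        unfold smallNat
        omega
      have : (smallNat h T M z i : ℝ) = midCard h T (i + 1) + M - z := by exact_mod_cast this
      rw [this]
      ring
    have e2 : phi g (largeCounts h T M z) =
        phi g (h.counts.filter fun x => T < x) + (M + z) * g (T + 1) := by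
      rw [largeCounts_eq h T M (by omega), phi_add, phi_replicate]
      have : ((M + z).toNat : ℤ) = M + z := by omega
      have : ((M + z).toNat : ℝ) = M + z := by exact_mod_cast this
      rw [this]
    have e3 := congrArg (phi g) (filter_le_add_filter_lt h.counts T)
    rw [phi_add] at e3
    have e : phi g (smallCounts h T M z + largeCounts h T M z) -
        phi g (h.counts + Multiset.replicate M T + Multiset.replicate M (T + 1)) =
        z * (g (T + 1) - g T) := by
      rw [phi_add, phi_add, phi_add, phi_replicate, phi_replicate, e1, e2, ← e3]
      ring
    rw [e, abs_mul, Nat.cast_natAbs, Int.cast_abs]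
    exact mul_le_of_le_one_right (abs_nonneg _) (hg.2 T)

theorem antitone_toNat_round {m : ℕ} {x : Fin m → ℝ} (hx : Antitone x) :
    Antitone fun i => (round (max (x i) 0)).toNat := fun i j hij => by
  simp only [round_eq]
  exact Int.toNat_le_toNat (Int.floor_mono (add_le_add_left (max_le_max_right 0 (hx hij)) _))

/-- Isotonic regression recovers the small part up to the square of the noise. -/
theorem lipClose_roundedFit (h : AnonHist) (T M : ℕ) (z : ℤ) (zs : Fin T → ℤ) :
    LipClose (roundedFit (fun i : Fin T => (i : ℕ) + 1) (fun _ => 1)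
        fun i => ((smallCumPrev h T M z (i + 1) + zs i : ℤ) : ℝ))
      (smallCounts h T M z) ((∑ i, 4 * (zs i).natAbs ^ 2 : ℕ) : ℝ) := by
  intro g hg
  set y : Fin T → ℝ := fun i => ((smallCumPrev h T M z (i + 1) + zs i : ℤ) : ℝ) with hy
  have hfit := isIsotonicFit_isotonicFit (w := fun _ : Fin T => (1 : ℝ)) (fun _ => one_pos) y
  set x := isotonicFit (fun _ : Fin T => (1 : ℝ)) y with hx
  have hd := antitone_toNat_round hfit.1
  have hb := smallNat_antitone h T M z
  rw [roundedFit, smallCounts, phi_cumulative_succ hg.1 hd, phi_cumulative_succ hg.1 hb,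
    ← Finset.sum_sub_distrib]
  have hdist := hfit.dist_le (fun _ => one_pos) (b := fun i => (smallNat h T M z i : ℝ))
    fun i j hij => Nat.cast_le.2 (hb hij)
  simp only [one_mul] at hdist
  calc _ ≤ ∑ i, |(((round (max (x i) 0)).toNat : ℕ) : ℝ) * (g (i + 1) - g i) -
        (smallNat h T M z i : ℝ) * (g (i + 1) - g i)| := Finset.abs_sum_le_sum_abs _ _
    _ ≤ ∑ i, 4 * (x i - smallNat h T M z i) ^ 2 := by
        refine Finset.sum_le_sum fun i _ => ?_
        rw [← sub_mul, abs_mul]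
        exact (mul_le_of_le_one_right (abs_nonneg _) (hg.2 i)).trans
          (abs_round_sub_le_four_mul_sq _ _)
    _ ≤ ∑ i, 4 * (y i - smallNat h T M z i) ^ 2 := by
        rw [← Finset.mul_sum, ← Finset.mul_sum]
        gcongr
    _ = _ := by
        push_cast
        refine Finset.sum_congr rfl fun i _ => ?_
        simp only [hy]
        rw [smallCumPrev_eq_smallNat, Nat.cast_natAbs, Int.cast_abs, sq_abs]
        push_cast
        ring

theorem lt_of_mem_largeList {h : AnonHist} {T M : ℕ} {z : ℤ} {x : ℕ}
    (hx : x ∈ largeList h T M z) : T < x := by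
  rw [largeList, Multiset.mem_sort] at hx
  have := Multiset.mem_of_le (largeCounts_le h T M z) hx
  rw [Multiset.mem_add, Multiset.mem_filter, Multiset.mem_replicate] at this
  omega

theorem coe_largeList (h : AnonHist) (T M : ℕ) (z : ℤ) :
    (largeList h T M z : Multiset ℕ) = largeCounts h T M z := Multiset.sort_eq _ _

theorem phi_coe (g : ℕ → ℝ) (l : List ℕ) : phi g (l : Multiset ℕ) = ∑ i, g (l.get i) := by
  conv_lhs => rw [← List.ofFn_get l]
  rw [phi, Multiset.map_coe, Multiset.sum_coe, List.map_ofFn, List.sum_ofFn]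
  rfl

theorem phi_map_ofFn (g : ℕ → ℝ) {n : ℕ} (v : Fin n → ℤ) (f : ℤ → ℕ) :
    phi g (Multiset.map f (List.ofFn v : List ℤ)) = ∑ i, g (f (v i)) := by
  rw [phi, Multiset.map_map, Multiset.map_coe, Multiset.sum_coe, List.map_ofFn, List.sum_ofFn]
  rfl

/-- Replacing values below `T` by `T` does not increase the error, as the large part lies above
`T`. -/
theorem lipClose_noisyLarge (h : AnonHist) (T M : ℕ) (z : ℤ)
    (zl : Fin (largeList h T M z).length → ℤ) :
    LipClose (Multiset.map (fun x => (max x (T : ℤ)).toNat)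
        (List.ofFn fun i => ((largeList h T M z).get i : ℤ) + zl i : List ℤ))
      (largeCounts h T M z) ((∑ i, (zl i).natAbs : ℕ) : ℝ) := by
  intro g hg
  rw [← coe_largeList, phi_coe, phi_map_ofFn, ← Finset.sum_sub_distrib]
  refine (Finset.abs_sum_le_sum_abs _ _).trans ?_
  rw [Nat.cast_sum]
  refine Finset.sum_le_sum fun i _ => (hg.abs_sub_le _ _).trans ?_
  have hT := lt_of_mem_largeList (List.get_mem (largeList h T M z) i)
  generalize (largeList h T M z).get i = x at *
  have h1 : (((max ((x : ℤ) + zl i) T).toNat : ℤ) - x).natAbs ≤ (zl i).natAbs := by omega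
  refine le_trans (le_of_eq ?_) (Nat.cast_le (α := ℝ).2 h1)
  rw [Nat.cast_natAbs, Int.cast_abs]
  push_cast
  rfl

theorem phi_indicator (s : Multiset ℕ) (p : ℕ → Prop) [DecidablePred p] :
    phi (fun x => if p x then 1 else 0) s = (s.filter p).card := by
  induction s using Multiset.induction_on with
  | empty => simp
  | cons a s ih =>
    rw [phi_cons, ih, Multiset.filter_cons, Multiset.card_add, Nat.cast_add]
    congr 1
    split_ifs <;> simp

/-- Unless some noise is large, there are enough elements near the threshold to remove. -/
theorem two_mul_le_card_filter (h : AnonHist) {T : ℕ} (hT : 0 < T) (M : ℕ) {z : ℤ}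
    (hz : z.natAbs ≤ M) (zs : Fin T → ℤ) (hzs : 2 * |∑ i, (zs i : ℝ)| < T)
    (zl : Fin (largeList h T M z).length → ℤ) (hzl : ∀ i, (zl i).natAbs < T) :
    2 * M ≤ ((roundedFit (fun i : Fin T => (i : ℕ) + 1) (fun _ => 1)
        (fun i => ((smallCumPrev h T M z (i + 1) + zs i : ℤ) : ℝ)) +
      Multiset.map (fun x => (max x (T : ℤ)).toNat)
        (List.ofFn fun i => ((largeList h T M z).get i : ℤ) + zl i : List ℤ)).filter
          fun x => x ≤ 2 * T).card := by
  rw [Multiset.filter_add, Multiset.card_add]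
  have hsmall : (M - z).toNat ≤ ((roundedFit (fun i : Fin T => (i : ℕ) + 1) (fun _ => 1)
        (fun i => ((smallCumPrev h T M z (i + 1) + zs i : ℤ) : ℝ))).filter
          fun x => x ≤ 2 * T).card := by
    set y : Fin T → ℝ := fun i => ((smallCumPrev h T M z (i + 1) + zs i : ℤ) : ℝ) with hy
    have hfit := isIsotonicFit_isotonicFit (w := fun _ : Fin T => (1 : ℝ)) (fun _ => one_pos) y
    set x := isotonicFit (fun _ : Fin T => (1 : ℝ)) y with hx
    have hd := antitone_toNat_round hfit.1
    have hsum := hfit.sum_eq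
    simp only [one_mul] at hsum
    -- the first entry of the fit is at least the mean
    have hx0 : ((M - z).toNat : ℝ) - 1 / 2 ≤ x ⟨0, hT⟩ := by
      have h1 : ∑ i, x i ≤ T * x ⟨0, hT⟩ := by
        have : (T : ℝ) * x ⟨0, hT⟩ = ∑ i : Fin T, x ⟨0, hT⟩ := by simp
        rw [this]
        exact Finset.sum_le_sum fun i _ => hfit.1 (Fin.mk_le_of_le_val (Nat.zero_le _))
      have h2 : (T : ℝ) * (M - z).toNat ≤ ∑ i : Fin T, (smallCumPrev h T M z (i + 1) : ℝ) := by
        have : (T : ℝ) * (M - z).toNat = ∑ i : Fin T, ((M - z).toNat : ℝ) := by simp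
        rw [this]
        refine Finset.sum_le_sum fun i _ => ?_
        rw [smallCumPrev_eq_smallNat]
        have : (M - z).toNat ≤ smallNat h T M z i := by
          unfold smallNat
          omega
        exact_mod_cast this
      have h3 : ∑ i, y i = ∑ i : Fin T, (smallCumPrev h T M z (i + 1) : ℝ) +
          ∑ i, (zs i : ℝ) := by
        rw [← Finset.sum_add_distrib]
        simp [hy]
      have h4 := neg_abs_le (∑ i, (zs i : ℝ))
      have hT' : (0 : ℝ) < T := by exact_mod_cast hT
      by_contra! hlt
      nlinarith
    have h0 := le_round_of_sub_half_le hx0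
    refine h0.trans ?_
    have e := phi_cumulative_succ (g := fun x => if x ≠ 0 ∧ x ≤ 2 * T then 1 else 0) (by simp) hd
    rw [phi_indicator, Finset.sum_eq_single ⟨0, hT⟩] at e
    · simp only [zero_add, ne_eq, one_ne_zero, not_false_eq_true, true_and, not_true_eq_false,
        false_and, if_false, sub_zero] at e
      rw [if_pos (by omega), mul_one] at e
      have e' : _ = _ := Nat.cast_injective e
      rw [← e']
      exact Multiset.card_le_card (Multiset.monotone_filter_right _ fun x hx => hx.2)
    · intro i _ hi
      have : (i : ℕ) ≠ 0 := fun h => hi (Fin.ext h)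
      have := i.2
      rw [if_pos (by omega), if_pos (by omega)]
      simp
    · simp
  have hlarge : (M + z).toNat ≤ ((Multiset.map (fun x => (max x (T : ℤ)).toNat)
        (List.ofFn fun i => ((largeList h T M z).get i : ℤ) + zl i : List ℤ)).filter
          fun x => x ≤ 2 * T).card := by
    have h1 : (M + z).toNat ≤ ((largeCounts h T M z).filter fun x => x = T + 1).card := by
      rw [largeCounts_eq h T M (by omega), Multiset.filter_add, Multiset.card_add]
      have : (Multiset.replicate (M + z).toNat (T + 1)).filter (fun x => x = T + 1) =
          Multiset.replicate (M + z).toNat (T + 1) :=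
        Multiset.filter_eq_self.2 fun x hx => Multiset.eq_of_mem_replicate hx
      rw [this, Multiset.card_replicate]
      omega
    refine h1.trans ?_
    have h2 := phi_indicator (largeCounts h T M z) fun x => x = T + 1
    have h3 := phi_indicator (Multiset.map (fun x => (max x (T : ℤ)).toNat)
        (List.ofFn fun i => ((largeList h T M z).get i : ℤ) + zl i : List ℤ)) fun x => x ≤ 2 * T
    rw [← coe_largeList, phi_coe] at h2
    rw [phi_map_ofFn] at h3
    rw [← coe_largeList, ← Nat.cast_le (α := ℝ), ← h2, ← h3]
    refine Finset.sum_le_sum fun i _ => ?_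
    have := hzl i
    generalize (largeList h T M z).get i = x
    split_ifs with h4 h5 <;> first | (exfalso; omega) | norm_num
  omega

/-- The error of the low privacy mechanism for fixed noise. -/
theorem lipClose_lowPrivacy (h : AnonHist) {T : ℕ} (hT : 0 < T) (M : ℕ) (z : ℤ) (zs : Fin T → ℤ)
    (zl : Fin (largeList h T M z).length → ℤ) :
    LipClose (lowPrivacy T M (fun i => smallCumPrev h T M z (i + 1) + zs i)
        (List.ofFn fun i => ((largeList h T M z).get i : ℤ) + zl i : List ℤ)).counts h.counts
      (((4 * z.natAbs + if M < z.natAbs then 8 * h.total + 16 * z.natAbs * (2 * T + 1) +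
          (2 * h.total + M * (2 * T + 1)) else 0) +
        (∑ i, 16 * (zs i).natAbs ^ 2 +
          if (T : ℝ) ≤ 2 * |∑ i, (zs i : ℝ)| then 2 * h.total + M * (2 * T + 1) else 0) +
        ∑ i, (4 * (zl i).natAbs +
          if T ≤ (zl i).natAbs then 2 * h.total + M * (2 * T + 1) else 0) : ℕ) : ℝ) := by
  set ds := roundedFit (fun i : Fin T => (i : ℕ) + 1) (fun _ => 1)
        (fun i => ((smallCumPrev h T M z (i + 1) + zs i : ℤ) : ℝ)) with hds
  set dl := Multiset.map (fun x => (max x (T : ℤ)).toNat)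
        (List.ofFn fun i => ((largeList h T M z).get i : ℤ) + zl i : List ℤ) with hdl
  set Q := 2 * h.total + M * (2 * T + 1) with hQ
  set D₀ := z.natAbs + if M < z.natAbs then 2 * h.total + 4 * z.natAbs * (2 * T + 1) else 0
    with hD₀
  set D := D₀ + (∑ i, 4 * (zs i).natAbs ^ 2 + ∑ i, (zl i).natAbs) with hD
  have hclose : LipClose (ds + dl)
      (h.counts + Multiset.replicate M T + Multiset.replicate M (T + 1)) (D : ℝ) := by
    have := ((lipClose_roundedFit h T M z zs).add (lipClose_noisyLarge h T M z zl)).trans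
      (lipClose_split h T M z)
    intro g hg
    refine (this g hg).trans (le_of_eq ?_)
    rw [hD, Nat.cast_add D₀, Nat.cast_add (∑ i, 4 * (zs i).natAbs ^ 2)]
    ring
  have hcounts : ∀ g : ℕ → ℝ, g 0 = 0 → phi g (lowPrivacy T M
      (fun i => smallCumPrev h T M z (i + 1) + zs i)
      (List.ofFn fun i => ((largeList h T M z).get i : ℤ) + zl i : List ℤ)).counts =
      phi g (removeClosest M T (removeClosest M (T + 1) (ds + dl))) := by
    intro g hg
    rw [← phi_filter_pos hg (removeClosest _ _ _)]
    rfl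
  intro g hg
  rw [hcounts g hg.1]
  have hsum1 : ∑ i, 16 * (zs i).natAbs ^ 2 = 4 * ∑ i, 4 * (zs i).natAbs ^ 2 := by
    rw [Finset.mul_sum]
    refine Finset.sum_congr rfl fun i _ => ?_
    ring
  have hsum2 : ∑ i, (4 * (zl i).natAbs + if T ≤ (zl i).natAbs then Q else 0) =
      4 * ∑ i, (zl i).natAbs + ∑ i, if T ≤ (zl i).natAbs then Q else 0 := by
    rw [Finset.sum_add_distrib, Finset.mul_sum]
  have hD4 : 4 * D = (4 * z.natAbs +
      if M < z.natAbs then 8 * h.total + 16 * z.natAbs * (2 * T + 1) else 0) +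
      ∑ i, 16 * (zs i).natAbs ^ 2 + 4 * ∑ i, (zl i).natAbs := by
    rw [hsum1, hD, hD₀]
    split_ifs <;> ring
  by_cases hgood : 2 * M ≤ ((ds + dl).filter fun x => x ≤ 2 * T).card
  · -- each of the two removals doubles the distance
    have c1 : M ≤ ((ds + dl).filter fun x => x ≤ 2 * (T + 1)).card :=
      (by omega : M ≤ ((ds + dl).filter fun x => x ≤ 2 * T).card).trans
        (Multiset.card_le_card (Multiset.monotone_filter_right _ fun x hx => by omega))
    have c2 := card_filter_removeClosest M (T + 1) (ds + dl) fun x => x ≤ 2 * T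
    have := (hclose.removeClosest c1).removeClosest (by omega) g hg
    refine this.trans ?_
    have h4 : (2 * (2 * (D : ℝ))) = ((4 * D : ℕ) : ℝ) := by push_cast; ring
    rw [h4, Nat.cast_le, hD4, hsum2]
    split_ifs <;> omega
  · -- some noise is large, and a crude bound suffices
    have hs1 := sum_removeClosest_le M T (removeClosest M (T + 1) (ds + dl))
    have hs2 := sum_removeClosest_le M (T + 1) (ds + dl)
    have hs3 := hclose.sum_le
    have hs4 : (ds + dl).sum ≤ h.total + M * (2 * T + 1) + D := by
      rw [Multiset.sum_add, Multiset.sum_add, Multiset.sum_add, Multiset.sum_replicate,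
        Multiset.sum_replicate, smul_eq_mul, smul_eq_mul, ← Multiset.sum_add] at hs3
      have : (ds + dl).sum ≤ h.counts.sum + M * T + M * (T + 1) + D := by exact_mod_cast hs3
      rw [AnonHist.total]
      linarith
    have hcrude : LipClose (removeClosest M T (removeClosest M (T + 1) (ds + dl))) h.counts
        ((Q + D : ℕ) : ℝ) := by
      refine lipClose_of_sum_le ?_
      norm_cast
      rw [AnonHist.total] at *
      omega
    refine (hcrude g hg).trans ?_
    rw [Nat.cast_le, hsum2]
    have hD4' : D ≤ 4 * D := by omega
    rw [hD4] at hD4'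
    by_cases b1 : M < z.natAbs
    · rw [if_pos b1] at hD4' ⊢
      omega
    by_cases b2 : (T : ℝ) ≤ 2 * |∑ i, (zs i : ℝ)|
    · rw [if_pos b2]
      rw [if_neg b1] at hD4' ⊢
      omega
    · have b3 : ∃ i, T ≤ (zl i).natAbs := by
        by_contra! hcon
        exact hgood (two_mul_le_card_filter h hT M (not_lt.1 b1) zs (not_le.1 b2) zl hcon)
      obtain ⟨i, hi⟩ := b3
      have : Q ≤ ∑ i, if T ≤ (zl i).natAbs then Q else 0 := by
        refine le_trans (le_of_eq ?_) (Finset.single_le_sum (f := fun i =>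
          if T ≤ (zl i).natAbs then Q else 0) (fun j _ => Nat.zero_le _) (Finset.mem_univ i))
        rw [if_pos hi]
      rw [if_neg b1] at hD4' ⊢
      omega

/-! ### Expected noise -/

/-- A bound for the second moment of the two-sided geometric law. -/
noncomputable def noiseVar (a : ℝ) : ℝ := 4 * a / (1 - a) ^ 2

theorem noiseVar_nonneg {a : ℝ} (h0 : 0 ≤ a) : 0 ≤ noiseVar a := by
  unfold noiseVar
  positivity

theorem lintegral_natAbs_le {a : ℝ} (h0 : 0 ≤ a) (h1 : a < 1) :
    ∫⁻ z, (z.natAbs : ℝ≥0∞) ∂twoSidedGeometric a ≤ ENNReal.ofReal (noiseVar a) := by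
  refine le_trans (lintegral_mono fun z => ?_) (sq_twoSidedGeometric_le h0 h1)
  exact Nat.cast_le.2 (Nat.le_self_pow two_ne_zero _)

/-- Markov's inequality for the square of the noise. -/
theorem lintegral_le_natAbs_le {a : ℝ} (h0 : 0 ≤ a) (h1 : a < 1) {T : ℝ} (hT : 0 < T) :
    ∫⁻ z, (if T ≤ z.natAbs then 1 else 0) ∂twoSidedGeometric a ≤
      ENNReal.ofReal (noiseVar a / T ^ 2) := by
  have h2 := sq_twoSidedGeometric_le h0 h1
  have hT2 : (0 : ℝ) < T ^ 2 := by positivity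
  rw [div_eq_inv_mul, ENNReal.ofReal_mul (by positivity)]
  refine le_trans ?_ (mul_le_mul_right h2 _)
  rw [← lintegral_const_mul' _ _ ENNReal.ofReal_ne_top]
  refine lintegral_mono fun z => ?_
  simp only
  split_ifs with h
  · rw [← ENNReal.ofReal_natCast, ← ENNReal.ofReal_mul (by positivity), ENNReal.one_le_ofReal,
      ← div_eq_inv_mul, one_le_div hT2]
    push_cast
    gcongr
  · exact zero_le

theorem lintegral_pi_const_add_sum {a : ℝ} (h0 : 0 ≤ a) (h1 : a < 1) (n : ℕ) (c : ℝ≥0∞)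
    (f : ℤ → ℝ≥0∞) :
    ∫⁻ z, (c + ∑ i, f (z i)) ∂(Measure.pi fun _ : Fin n => twoSidedGeometric a) =
      c + n * ∫⁻ z, f z ∂twoSidedGeometric a := by
  have := isProbabilityMeasure_twoSidedGeometric h0 h1
  rw [lintegral_add_left .of_discrete, lintegral_const, measure_univ, mul_one,
    lintegral_finsetSum _ fun i _ => .of_discrete]
  congr 1
  simp only [lintegral_pi_eval (fun _ : Fin n => twoSidedGeometric a) _ f .of_discrete]
  simp

theorem lintegral_const_geometric {a : ℝ} (h0 : 0 ≤ a) (h1 : a < 1) (c : ℝ≥0∞) :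
    ∫⁻ _, c ∂twoSidedGeometric a = c := by
  have := isProbabilityMeasure_twoSidedGeometric h0 h1
  rw [lintegral_const, measure_univ, mul_one]

theorem lintegral_outputLaw_mono {ε : ℝ} {h : AnonHist} {T M N : ℕ} {cs : Fin T → ℤ}
    {cl : Multiset ℤ} {F F' : AnonHist × ℕ → ℝ≥0∞} (hF : ∀ H, F (H, N) ≤ F' (H, N)) :
    ∫⁻ o, F o ∂(outputLaw ε h T M N cs cl) ≤ ∫⁻ o, F' o ∂(outputLaw ε h T M N cs cl) := by
  unfold outputLaw
  split_ifs
  · rw [lintegral_dirac, lintegral_dirac]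
    exact hF _
  · rw [lintegral_map .of_discrete .of_discrete, lintegral_map .of_discrete .of_discrete]
    exact lintegral_mono fun H => hF H

/-- The second component of the output is `N`. -/
theorem lintegral_givenLaw_mono {ε : ℝ} {h : AnonHist} {N : ℕ} (hN : N ≠ 0)
    {F F' : AnonHist × ℕ → ℝ≥0∞} (hF : ∀ H, F (H, N) ≤ F' (H, N)) :
    ∫⁻ o, F o ∂(givenLaw ε h N) ≤ ∫⁻ o, F' o ∂(givenLaw ε h N) := by
  rw [lintegral_givenLaw ε h hN, lintegral_givenLaw ε h hN]
  refine lintegral_mono fun zb => ?_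
  simp only
  rw [lintegral_splitLaw, lintegral_splitLaw]
  exact lintegral_mono fun zs => lintegral_mono fun zl => lintegral_outputLaw_mono hF

/-- The number of elements above `T`. -/
def largeCard (h : AnonHist) (T : ℕ) : ℕ := (h.counts.filter fun x => T < x).card

theorem card_filter_mul_le (s : Multiset ℕ) (p : ℕ → Prop) [DecidablePred p] (c : ℕ)
    (hp : ∀ x, p x → c ≤ x) : (s.filter p).card * c ≤ s.sum := by
  induction s using Multiset.induction_on with
  | empty => simp
  | cons a s ih =>
    rw [Multiset.filter_cons, Multiset.card_add, add_mul, Multiset.sum_cons]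
    refine add_le_add ?_ ih
    split_ifs with h
    · simpa using hp a h
    · simp

theorem length_largeList_le (h : AnonHist) (T M : ℕ) (z : ℤ) :
    (largeList h T M z).length ≤ largeCard h T + M + z.natAbs := by
  have h1 := Multiset.card_le_card (largeCounts_le h T M z)
  rw [Multiset.card_add, Multiset.card_replicate] at h1
  rw [← Multiset.coe_card, coe_largeList, largeCard]
  omega

/-! ### Accuracy in the low privacy regime: the expected error -/

/-- The expected error of the low privacy mechanism, given the noisy number of items. -/
theorem lintegral_cost_low {ε : ℝ} (hε : 1 < ε) (h : AnonHist) {N : ℕ} (hN : N ≠ 0) {g : ℕ → ℝ}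
    (hg : UnitLip g) {T M Q : ℕ} (hT : T = threshold ε N) (hM : M = fakeCount ε N)
    (hQ : Q = 2 * h.total + M * (2 * T + 1)) {a v : ℝ} (ha : a = Real.exp (-(ε / 3)))
    (hv : v = noiseVar a) :
    ∫⁻ o, ENNReal.ofReal |phi g o.1.counts - phi g h.counts| ∂(givenLaw ε h N) ≤
      ENNReal.ofReal ((4 * v + ((8 * h.total + Q) * (2 * a ^ M) + 16 * (2 * T + 1) * v)) +
        (16 * T * v + Q * (T * v / (T / 2) ^ 2)) +
        (largeCard h T + M + v) * (4 * v + Q * (v / T ^ 2))) := by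
  have ha0 : 0 ≤ a := ha ▸ (Real.exp_pos _).le
  have ha1 : a < 1 := by rw [ha, Real.exp_lt_one_iff]; linarith
  have hv0 : 0 ≤ v := hv ▸ noiseVar_nonneg ha0
  have hT0 : 0 < T := hT ▸ threshold_pos (by linarith) hN
  have hT0' : (0 : ℝ) < T := by exact_mod_cast hT0
  have hprob := isProbabilityMeasure_twoSidedGeometric ha0 ha1
  set G := twoSidedGeometric a with hG
  set A : ℤ → ℝ≥0∞ := fun z => 4 * (z.natAbs : ℝ≥0∞) +
    ((8 * h.total + Q) * (if M ≤ z.natAbs then 1 else 0) + 16 * (2 * T + 1) * (z.natAbs : ℝ≥0∞))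
    with hA
  set B : (Fin T → ℤ) → ℝ≥0∞ := fun zs => ∑ i, (16 : ℝ≥0∞) * (((zs i).natAbs ^ 2 : ℕ) : ℝ≥0∞) +
    Q * ({zs | (T : ℝ) / 2 ≤ |∑ i, (zs i : ℝ)|}.indicator 1 zs) with hB
  set f : ℤ → ℝ≥0∞ := fun z => 4 * (z.natAbs : ℝ≥0∞) +
    Q * (if (T : ℝ) ≤ z.natAbs then 1 else 0) with hf
  have hpt : ∀ (z : ℤ) (zs : Fin T → ℤ) (zl : Fin (largeList h T M z).length → ℤ),
      ENNReal.ofReal |phi g (lowPrivacy T M (fun i => smallCumPrev h T M z (i + 1) + zs i)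
        (List.ofFn fun i => ((largeList h T M z).get i : ℤ) + zl i : List ℤ)).counts -
          phi g h.counts| ≤ (A z + B zs) + ∑ i, f (zl i) := by
    intro z zs zl
    refine (ENNReal.ofReal_le_ofReal (lipClose_lowPrivacy h hT0 M z zs zl g hg)).trans ?_
    rw [ENNReal.ofReal_natCast, ← hQ]
    push_cast
    refine add_le_add (add_le_add ?_ ?_) ?_
    · simp only [hA]
      split_ifs with h1 h2 h2
      · refine le_of_eq ?_
        ring
      · omega
      · simp
      · simp
    · simp only [hB, Set.indicator]
      refine add_le_add (le_of_eq (by push_cast; rfl)) ?_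
      split_ifs with h1 h2 h2
      · simp
      · exact absurd (show (T : ℝ) / 2 ≤ |∑ i, (zs i : ℝ)| by linarith) h2
      · exact zero_le
      · exact zero_le
    · refine Finset.sum_le_sum fun i _ => ?_
      simp only [hf]
      gcongr
      split_ifs with h1 h2 h2
      · simp
      · exact absurd (by exact_mod_cast h1) h2
      · exact zero_le
      · exact zero_le
  have hIabs := lintegral_natAbs_le ha0 ha1
  rw [← hG, ← hv] at hIabs
  have hIf : ∫⁻ z, f z ∂G ≤ ENNReal.ofReal (4 * v + Q * (v / T ^ 2)) := by
    simp only [hf]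
    rw [lintegral_add_left .of_discrete, lintegral_const_mul _ .of_discrete,
      lintegral_const_mul _ .of_discrete]
    refine (add_le_add (mul_le_mul_right hIabs 4)
      (mul_le_mul_right (lintegral_le_natAbs_le ha0 ha1 hT0') _)).trans (le_of_eq ?_)
    rw [← hv, ENNReal.ofReal_add (by positivity) (by positivity), ENNReal.ofReal_mul (by positivity),
      ENNReal.ofReal_mul (by positivity), ENNReal.ofReal_natCast]
    norm_num
  have hIB : ∫⁻ zs, B zs ∂(Measure.pi fun _ : Fin T => G) ≤
      ENNReal.ofReal (16 * T * v + Q * (T * v / (T / 2) ^ 2)) := by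
    simp only [hB]
    rw [lintegral_add_left .of_discrete, lintegral_const_mul _ .of_discrete,
      lintegral_indicator_one .of_discrete]
    have h1 := lintegral_pi_const_add_sum ha0 ha1 T 0 fun z => 16 * ((z.natAbs ^ 2 : ℕ) : ℝ≥0∞)
    simp only [zero_add] at h1
    rw [h1, lintegral_const_mul _ .of_discrete]
    refine (add_le_add (mul_le_mul_right (mul_le_mul_right (sq_twoSidedGeometric_le ha0 ha1) 16) _)
      (mul_le_mul_right (chebyshev_sum_geometric ha0 ha1 T (half_pos hT0')) _)).trans
        (le_of_eq ?_)
    change (T : ℝ≥0∞) * (16 * ENNReal.ofReal (noiseVar a)) +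
      Q * ENNReal.ofReal (T * noiseVar a / (T / 2) ^ 2) = _
    rw [← hv, ENNReal.ofReal_add (by positivity) (by positivity), ENNReal.ofReal_mul (by positivity),
      ENNReal.ofReal_mul (by positivity), ENNReal.ofReal_mul (by positivity),
      ENNReal.ofReal_natCast, ENNReal.ofReal_natCast]
    norm_num
    ring
  have hIA : ∫⁻ z, A z ∂G ≤
      ENNReal.ofReal (4 * v + ((8 * h.total + Q) * (2 * a ^ M) + 16 * (2 * T + 1) * v)) := by
    simp only [hA]
    rw [lintegral_add_left .of_discrete, lintegral_add_left .of_discrete,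
      lintegral_const_mul _ .of_discrete, lintegral_const_mul _ .of_discrete,
      lintegral_const_mul _ .of_discrete]
    refine (add_le_add (mul_le_mul_right hIabs 4) (add_le_add (mul_le_mul_right
      (tail_twoSidedGeometric_le ha0 ha1 M) _) (mul_le_mul_right hIabs _))).trans (le_of_eq ?_)
    have e1 : ((8 : ℝ≥0∞) * h.total + Q) = ENNReal.ofReal (8 * h.total + Q) := by
      rw [ENNReal.ofReal_add (by positivity) (by positivity), ENNReal.ofReal_mul (by positivity),
        ENNReal.ofReal_natCast, ENNReal.ofReal_natCast]
      norm_num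
    have e2 : ((16 : ℝ≥0∞) * (2 * T + 1)) = ENNReal.ofReal (16 * (2 * T + 1)) := by
      rw [ENNReal.ofReal_mul (by positivity), ENNReal.ofReal_add (by positivity) (by positivity),
        ENNReal.ofReal_mul (by positivity), ENNReal.ofReal_natCast]
      norm_num
    have e3 : (4 : ℝ≥0∞) = ENNReal.ofReal 4 := by norm_num
    rw [e1, e2, e3, ← ENNReal.ofReal_mul (by positivity), ← ENNReal.ofReal_mul (by positivity),
      ← ENNReal.ofReal_mul (by positivity), ← ENNReal.ofReal_add (by positivity) (by positivity),
      ← ENNReal.ofReal_add (by positivity) (by positivity)]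
  clear_value A B f
  set c₁ := ENNReal.ofReal (4 * v + Q * (v / T ^ 2)) with hc₁
  clear_value c₁
  have hz : ∀ z : ℤ, ∫⁻ o, ENNReal.ofReal |phi g o.1.counts - phi g h.counts|
      ∂(splitLaw ε h T M N (fun i => smallCumPrev h T M z ((i : ℕ) + 1)) (largeList h T M z)) ≤
      A z + ENNReal.ofReal (16 * T * v + Q * (T * v / (T / 2) ^ 2)) +
        (largeCard h T + M + z.natAbs) * c₁ := by
    intro z
    rw [lintegral_splitLaw, ← ha, ← hG]
    have h1 : ∀ zs : Fin T → ℤ, noisyIntegral a (largeList h T M z)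
        (fun cl => ∫⁻ o, ENNReal.ofReal |phi g o.1.counts - phi g h.counts|
          ∂(outputLaw ε h T M N ((fun i : Fin T => smallCumPrev h T M z ((i : ℕ) + 1)) + zs) cl)) ≤
        A z + (largeCard h T + M + z.natAbs) * c₁ + B zs := by
      intro zs
      have h2 : ∫⁻ zl, (A z + B zs + ∑ i, f (zl i))
          ∂(Measure.pi fun _ : Fin (largeList h T M z).length => G) ≤
          A z + (largeCard h T + M + z.natAbs) * c₁ + B zs := by
        rw [lintegral_pi_const_add_sum ha0 ha1, add_right_comm]
        gcongr
        exact_mod_cast length_largeList_le h T M z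
      refine le_trans (lintegral_mono fun zl => ?_) h2
      simp only [outputLaw, if_pos hε]
      rw [lintegral_dirac]
      exact hpt z zs zl
    refine (lintegral_mono h1).trans ?_
    rw [lintegral_add_left .of_discrete, lintegral_const, measure_univ, mul_one, add_right_comm]
    gcongr
  rw [lintegral_givenLaw ε h hN, ← hT, ← hM, ← ha, ← hG]
  refine (lintegral_mono hz).trans ?_
  rw [lintegral_add_left .of_discrete, lintegral_add_left .of_discrete, lintegral_const,
    measure_univ, mul_one, lintegral_mul_const _ .of_discrete, lintegral_add_left .of_discrete,
    lintegral_const, measure_univ, mul_one]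
  refine (add_le_add (add_le_add_left hIA _) (mul_le_mul_left (add_le_add_right hIabs _) c₁)).trans
    (le_of_eq ?_)
  have e1 : ((largeCard h T : ℝ≥0∞) + M) = ENNReal.ofReal (largeCard h T + M) := by
    rw [ENNReal.ofReal_add (by positivity) (by positivity), ENNReal.ofReal_natCast,
      ENNReal.ofReal_natCast]
  rw [e1, hc₁, ← ENNReal.ofReal_add (by positivity) (by positivity),
    ← ENNReal.ofReal_add (by positivity) (by positivity),
    ← ENNReal.ofReal_mul (by positivity), ← ENNReal.ofReal_add (by positivity) (by positivity)]

/-- The rate at which the cost grows with the number `n` of items and the noisy number `N`. -/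
noncomputable def rate (n N : ℕ) : ℝ := √(N : ℝ) + (n : ℝ) ^ 2 / √(N : ℝ) ^ 3

theorem rate_nonneg (n N : ℕ) : 0 ≤ rate n N := by
  unfold rate
  positivity

theorem sqrt_le_rate (n N : ℕ) : √(N : ℝ) ≤ rate n N := le_add_of_nonneg_right (by positivity)

theorem one_le_sqrt_natCast {N : ℕ} (hN : N ≠ 0) : 1 ≤ √(N : ℝ) := by
  rw [Real.one_le_sqrt]
  exact_mod_cast Nat.one_le_iff_ne_zero.2 hN

theorem div_sqrt_le_rate (n : ℕ) {N : ℕ} (hN : N ≠ 0) : n / √(N : ℝ) ≤ rate n N := by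
  have hs := one_le_sqrt_natCast hN
  unfold rate
  have h1 : (n : ℝ) ^ 2 / √(N : ℝ) ^ 3 = (n / √(N : ℝ)) ^ 2 / √(N : ℝ) := by field_simp
  rw [h1]
  have h2 : (n / √(N : ℝ)) ^ 2 / √(N : ℝ) + √(N : ℝ) - 2 * (n / √(N : ℝ)) =
      (n / √(N : ℝ) - √(N : ℝ)) ^ 2 / √(N : ℝ) := by
    field_simp
    ring
  have h3 : 0 ≤ (n / √(N : ℝ) - √(N : ℝ)) ^ 2 / √(N : ℝ) := by positivity
  have h4 : 0 ≤ n / √(N : ℝ) := by positivity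
  linarith

theorem noiseVar_le {a : ℝ} (h0 : 0 ≤ a) (h1 : a ≤ 3 / 4) : noiseVar a ≤ 64 * a := by
  unfold noiseVar
  rw [div_le_iff₀ (by nlinarith)]
  nlinarith [mul_nonneg h0 (show 0 ≤ (1 - a) ^ 2 - 1 / 16 by nlinarith)]

theorem exp_neg_third_le {ε : ℝ} (hε : 1 < ε) : Real.exp (-(ε / 3)) ≤ 3 / 4 := by
  have h1 := Real.add_one_le_exp (ε / 3)
  rw [Real.exp_neg, inv_le_comm₀ (Real.exp_pos _) (by norm_num)]
  linarith

theorem le_fakeCount (ε : ℝ) (N : ℕ) :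
    max (2 * Real.log ((N : ℝ) * Real.exp (ε / 3))) 1 / (ε / 3) ≤ fakeCount ε N :=
  Nat.le_ceil _

/-- The noise exceeds the number of fake elements only with polynomially small probability. -/
theorem exp_pow_fakeCount_le {ε : ℝ} (hε : 0 < ε) {N : ℕ} (hN : N ≠ 0) :
    Real.exp (-(ε / 3)) ^ fakeCount ε N ≤ Real.exp (-(2 * ε / 3)) / (N : ℝ) ^ 2 := by
  have hN' : (0 : ℝ) < N := by exact_mod_cast Nat.pos_of_ne_zero hN
  have h1 := (div_le_iff₀ (by positivity)).1 (le_fakeCount ε N)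
  have h2 := (le_max_left _ _).trans h1
  rw [Real.log_mul hN'.ne' (Real.exp_pos _).ne', Real.log_exp] at h2
  rw [← Real.exp_nat_mul, ← Real.exp_log hN', ← Real.exp_nat_mul, ← Real.exp_sub]
  refine Real.exp_le_exp.2 ?_
  push_cast
  nlinarith

theorem fakeCount_le {ε : ℝ} (hε : 0 < ε) {N : ℕ} (hN : N ≠ 0) :
    (fakeCount ε N : ℝ) ≤ 12 * (√(N : ℝ) - 1) / ε + 3 / ε + 3 := by
  have hN' : (0 : ℝ) < N := by exact_mod_cast Nat.pos_of_ne_zero hN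
  have hs := one_le_sqrt_natCast hN
  have hlog : Real.log N ≤ 2 * (√(N : ℝ) - 1) := by
    have := Real.log_le_sub_one_of_pos (show 0 < √(N : ℝ) by linarith)
    rw [Real.log_sqrt hN'.le] at this
    linarith
  have h0 : 0 ≤ max (2 * Real.log ((N : ℝ) * Real.exp (ε / 3))) 1 / (ε / 3) := by positivity
  refine (Nat.ceil_lt_add_one h0).le.trans ?_
  have h1 : max (2 * Real.log ((N : ℝ) * Real.exp (ε / 3))) 1 ≤
      4 * (√(N : ℝ) - 1) + 2 * ε / 3 + 1 := by
    rw [Real.log_mul hN'.ne' (Real.exp_pos _).ne', Real.log_exp]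
    refine max_le ?_ ?_ <;> linarith
  have h2 : max (2 * Real.log ((N : ℝ) * Real.exp (ε / 3))) 1 / (ε / 3) ≤
      (4 * (√(N : ℝ) - 1) + 2 * ε / 3 + 1) / (ε / 3) := by gcongr
  refine (add_le_add_left h2 1).trans (le_of_eq ?_)
  field_simp
  ring

theorem largeCard_mul_le (h : AnonHist) (T : ℕ) : largeCard h T * T ≤ h.total :=
  card_filter_mul_le _ _ _ fun _ hx => hx.le

theorem sqrt_le_threshold {ε : ℝ} (hε : 1 < ε) (N : ℕ) : √(N : ℝ) ≤ threshold ε N := by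
  refine le_trans (le_of_eq ?_) (Nat.le_ceil _)
  rw [min_eq_right hε.le, mul_one]

theorem threshold_le {ε : ℝ} {N : ℕ} (hN : N ≠ 0) : (threshold ε N : ℝ) ≤ 2 * √(N : ℝ) := by
  have hs := one_le_sqrt_natCast hN
  refine (Nat.ceil_lt_add_one (Real.sqrt_nonneg _)).le.trans ?_
  have : √((N : ℝ) * min ε 1) ≤ √(N : ℝ) :=
    Real.sqrt_le_sqrt (mul_le_of_le_one_right (by positivity) (min_le_right _ _))
  linarith

/-- The bound of `lintegral_cost_low` in terms of `s = √N` and `X = rate n N`. Every term carries a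
factor `a = e^{-ε/3}`, from a moment or a tail of the noise. -/
theorem low_cost_arith {a v n Q L M T s A X : ℝ} (ha0 : 0 ≤ a) (ha1 : a ≤ 3 / 4)
    (hv0 : 0 ≤ v) (hv : v ≤ 64 * a) (hn : 0 ≤ n) (hL0 : 0 ≤ L) (hM0 : 0 ≤ M)
    (hs : 1 ≤ s) (hT1 : s ≤ T) (hT2 : T ≤ 2 * s) (hM : M ≤ 12 * s) (hL : L * T ≤ n)
    (hQ : Q = 2 * n + M * (2 * T + 1)) (hA : A ≤ a / s ^ 4)
    (h1 : s ≤ X) (h2 : n / s ≤ X) (h3 : n ^ 2 / s ^ 3 ≤ X) :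
    (4 * v + ((8 * n + Q) * (2 * A) + 16 * (2 * T + 1) * v)) +
      (16 * T * v + Q * (T * v / (T / 2) ^ 2)) + (L + M + v) * (4 * v + Q * (v / T ^ 2)) ≤
      10 ^ 6 * a * X := by
  have hs0 : 0 < s := by linarith
  have hT0 : 0 < T := by linarith
  have hX0 : 0 ≤ X := by linarith
  have hQ1 : Q ≤ 2 * n + 60 * s ^ 2 := by
    have : M * (2 * T + 1) ≤ (12 * s) * (5 * s) := by gcongr; linarith
    nlinarith
  have hQ0 : 0 ≤ Q := by rw [hQ]; positivity
  have t1 : (8 * n + Q) * (2 * A) ≤ 140 * (a * X) := by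
    have e : (10 * n + 60 * s ^ 2) * (2 * (a / s ^ 4)) ≤ (10 * n + 60 * s ^ 2) * (2 * (a / s)) := by
      gcongr
      calc s = s ^ 1 := (pow_one s).symm
        _ ≤ s ^ 4 := pow_le_pow_right₀ hs (by norm_num)
    calc (8 * n + Q) * (2 * A) ≤ (10 * n + 60 * s ^ 2) * (2 * (a / s ^ 4)) := by
          refine (mul_le_mul_of_nonneg_left (by linarith : 2 * A ≤ 2 * (a / s ^ 4))
            (by positivity)).trans (mul_le_mul_of_nonneg_right (by linarith) (by positivity))
      _ ≤ _ := e
      _ = 20 * (a * (n / s)) + 120 * (a * s) := by field_simp; ring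
      _ ≤ 20 * (a * X) + 120 * (a * X) := by gcongr
      _ = _ := by ring
  have t2 : v ≤ 64 * (a * X) := by
    refine hv.trans ?_
    have : a * 1 ≤ a * X := by gcongr; linarith
    linarith
  have t3 : T * v ≤ 128 * (a * X) := by
    calc T * v ≤ (2 * s) * (64 * a) := by gcongr
      _ = 128 * (a * s) := by ring
      _ ≤ _ := by gcongr
  have t4 : Q * (T * v / (T / 2) ^ 2) ≤ 15872 * (a * X) := by
    calc Q * (T * v / (T / 2) ^ 2) = 4 * (Q * v / T) := by field_simp; ring
      _ ≤ 4 * ((2 * n + 60 * s ^ 2) * (64 * a) / s) := by gcongr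
      _ = 512 * (a * (n / s)) + 15360 * (a * s) := by field_simp; ring
      _ ≤ 512 * (a * X) + 15360 * (a * X) := by gcongr
      _ = _ := by ring
  have t5 : (L + M + v) * (4 * v + Q * (v / T ^ 2)) ≤ 257664 * (a * X) := by
    have hL' : L ≤ n / s := by
      rw [le_div_iff₀ hs0]
      exact (mul_le_mul_of_nonneg_left hT1 hL0).trans hL
    calc (L + M + v) * (4 * v + Q * (v / T ^ 2))
        ≤ (n / s + 12 * s + 48 * s) *
          (4 * (64 * a) + (2 * n + 60 * s ^ 2) * ((64 * a) / s ^ 2)) := by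
          have : v ≤ 48 * s := by nlinarith
          gcongr
      _ = 11776 * (a * (n / s)) + 128 * (a * (n ^ 2 / s ^ 3)) + 245760 * (a * s) := by
          field_simp
          ring
      _ ≤ 11776 * (a * X) + 128 * (a * X) + 245760 * (a * X) := by gcongr
      _ = _ := by ring
  have : 0 ≤ a * X := by positivity
  nlinarith

/-- In the low privacy regime the expected error is at most a constant times
`e^{-ε/3} (√N + n² / N^{3/2})`. -/
theorem lintegral_cost_low_le {ε : ℝ} (hε : 1 < ε) (h : AnonHist) {N : ℕ} (hN : N ≠ 0)
    {g : ℕ → ℝ} (hg : UnitLip g) :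
    ∫⁻ o, ENNReal.ofReal |phi g o.1.counts - phi g h.counts| ∂(givenLaw ε h N) ≤
      ENNReal.ofReal (10 ^ 6 * Real.exp (-(ε / 3)) * rate h.total N) := by
  refine (lintegral_cost_low hε h hN hg rfl rfl rfl rfl rfl).trans (ENNReal.ofReal_le_ofReal ?_)
  have ha0 := (Real.exp_pos (-(ε / 3))).le
  have ha1 := exp_neg_third_le hε
  have hs := one_le_sqrt_natCast hN
  have hs2 : √(N : ℝ) ^ 2 = N := Real.sq_sqrt (by positivity)
  refine low_cost_arith (s := √(N : ℝ)) ha0 ha1 (noiseVar_nonneg ha0) (noiseVar_le ha0 ha1)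
    (by positivity) (by positivity) (by positivity) hs (sqrt_le_threshold hε N) (threshold_le hN)
    ?_ (by exact_mod_cast largeCard_mul_le h _) (by push_cast; rfl) ?_ (sqrt_le_rate _ _)
    (div_sqrt_le_rate _ hN) (le_add_of_nonneg_left (by positivity))
  · refine (fakeCount_le (by linarith) hN).trans ?_
    have h1 : 12 * (√(N : ℝ) - 1) / ε ≤ 12 * (√(N : ℝ) - 1) :=
      div_le_self (by linarith) hε.le
    have h2 : 3 / ε ≤ 3 := div_le_self (by norm_num) hε.le
    linarith
  · refine (exp_pow_fakeCount_le (by linarith) hN).trans ?_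
    rw [show √(N : ℝ) ^ 4 = (√(N : ℝ) ^ 2) ^ 2 by ring, hs2]
    gcongr
    linarith

/-! ### Accuracy in the high privacy regime: the pointwise bound -/

theorem phi_sub (f g : ℕ → ℝ) (s : Multiset ℕ) : phi (fun y => f y - g y) s = phi f s - phi g s := by
  simp [phi, Multiset.sum_map_sub]

theorem phi_finset_sum {ι : Type*} (I : Finset ι) (F : ι → ℕ → ℝ) (s : Multiset ℕ) :
    phi (fun y => ∑ i ∈ I, F i y) s = ∑ i ∈ I, phi (F i) s := by
  induction s using Multiset.induction_on with
  | empty => simp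
  | cons a s ih => simp only [phi_cons, ih, Finset.sum_add_distrib]

theorem phi_const_mul (c : ℝ) (f : ℕ → ℝ) (s : Multiset ℕ) :
    phi (fun y => c * f y) s = c * phi f s := by
  simp [phi, Multiset.sum_map_mul_left]

theorem phi_mono {f g : ℕ → ℝ} {s : Multiset ℕ} (h : ∀ y ∈ s, f y ≤ g y) : phi f s ≤ phi g s :=
  Multiset.sum_map_le_sum_map _ _ h

theorem abs_phi_le_phi_abs (f : ℕ → ℝ) (s : Multiset ℕ) : |phi f s| ≤ phi (fun y => |f y|) s := by
  induction s using Multiset.induction_on with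
  | empty => simp
  | cons a s ih =>
    rw [phi_cons, phi_cons]
    exact (abs_add_le _ _).trans (by linarith)

/-- The distance of `y` from the nearest boundary, where `0` counts as a boundary. -/
def boundaryDist (S : Finset ℕ) (y : ℕ) : ℕ :=
  (insert 0 S).inf' (Finset.insert_nonempty _ _) (Nat.dist y)

theorem exists_boundaryDist (S : Finset ℕ) (y : ℕ) :
    ∃ t, (t ∈ S ∨ t = 0) ∧ Nat.dist y t = boundaryDist S y := by
  obtain ⟨t, ht, h⟩ := Finset.exists_mem_eq_inf' (Finset.insert_nonempty 0 S) (Nat.dist y)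
  exact ⟨t, (Finset.mem_insert.1 ht).symm, h.symm⟩

theorem boundaryDist_le {S : Finset ℕ} {t : ℕ} (ht : t ∈ S ∨ t = 0) (y : ℕ) :
    boundaryDist S y ≤ Nat.dist y t :=
  Finset.inf'_le _ (Finset.mem_insert.2 ht.symm)

theorem cast_natDist (a b : ℕ) : ((Nat.dist a b : ℕ) : ℝ) = |(a : ℝ) - b| := by
  rcases le_total a b with h | h
  · have : (a : ℝ) ≤ b := by exact_mod_cast h
    rw [Nat.dist_eq_sub_of_le h, Nat.cast_sub h, abs_of_nonpos (by linarith)]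
    ring
  · have : (b : ℝ) ≤ a := by exact_mod_cast h
    rw [Nat.dist_eq_sub_of_le_right h, Nat.cast_sub h, abs_of_nonneg (by linarith)]

/-- At a boundary, a function that vanishes at `0` is the sum of its increments along the
boundaries. -/
theorem eq_sum_of_mem_boundary {S : Finset ℕ} {g : ℕ → ℝ} (hg : g 0 = 0) {u : ℕ}
    (hu : u ∈ S ∨ u = 0) : g u = ∑ i, (if boundary S i ≤ u then 1 else 0) *
      (g (boundary S i) - g (predVal (boundary S) i)) := by
  obtain ⟨x, hx, hx2⟩ := sum_sub_predVal (boundary S)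
  have hux : min u x = u := by
    rcases hu with hu | rfl
    · obtain ⟨i, rfl⟩ := exists_boundary_eq hu
      exact min_eq_left (hx2 (boundary_strictMono S).monotone i)
    · simp
  have h1 := hx fun v => g (min u v)
  simp only [hux, Nat.min_zero, hg, sub_zero] at h1
  rw [← h1]
  refine Finset.sum_congr rfl fun i _ => ?_
  rw [predVal_boundary]
  split_ifs with hi
  · have : prevBoundary S (boundary S i) ≤ boundary S i := by
      refine Finset.sup_le fun y hy => ?_
      exact (Finset.mem_filter.1 hy).2.le
    rw [min_eq_right hi, min_eq_right (this.trans hi), one_mul]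
  · have : u ≤ prevBoundary S (boundary S i) := by
      rcases hu with hu | rfl
      · exact le_prevBoundary hu (by omega)
      · omega
    rw [min_eq_left (by omega), min_eq_left this, sub_self, zero_mul]

/-- The error of a histogram on the boundaries whose cumulative prevalences are rounded from `x`:
clipping at `2 N`, moving each element to the nearest boundary, and the difference of `x` from
the smoothed prevalences. -/
theorem abs_phi_countsOfCumulative_sub_le {S : Finset ℕ} (h0 : 0 ∉ S) (h : AnonHist) {N : ℕ}
    (hN : 2 * N ∈ S) {x : Fin S.card → ℝ} (hx : Antitone x) {g : ℕ → ℝ} (hg : UnitLip g) :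
    |phi g (countsOfCumulative (boundary S) fun i => (round (max (x i) 0)).toNat) -
        phi g h.counts| ≤
      phi (fun y => (y : ℝ) - (min y (2 * N) : ℕ)) h.counts +
      3 * phi (fun y => (boundaryDist S (min y (2 * N)) : ℝ)) h.counts +
      2 * ∑ i, boundaryGap S i *
        |x i - smoothedCumPrev S (clippedPrev h N) (boundary S i)| := by
  -- `τ y` is the boundary nearest to the clipped count, and `c` are the cumulative prevalences of
  -- the moved elements
  choose t ht hd using exists_boundaryDist S
  set τ : ℕ → ℕ := fun y => t (min y (2 * N)) with hτ
  set c : Fin S.card → ℕ := fun i => (h.counts.filter fun y => boundary S i ≤ τ y).card with hc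
  set Δ : Fin S.card → ℝ := fun i => g (boundary S i) - g (predVal (boundary S) i) with hΔ
  have hgap := fun i => boundaryGap_pos h0 i
  have hΔ1 : ∀ i, |Δ i| ≤ boundaryGap S i := by
    intro i
    refine (hg.abs_sub_le _ _).trans (le_of_eq ?_)
    rw [predVal_boundary, ← boundaryGap, abs_of_pos (hgap i)]
  have hcphi : ∀ i, phi (fun y => if boundary S i ≤ τ y then (1 : ℝ) else 0) h.counts = c i :=
    fun i => phi_indicator _ _
  have hmid : phi (fun y => g (τ y)) h.counts = ∑ i, (c i : ℝ) * Δ i := by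
    have : (fun y => g (τ y)) = fun y => ∑ i, Δ i * (if boundary S i ≤ τ y then 1 else 0) := by
      funext y
      rw [eq_sum_of_mem_boundary hg.1 (ht (min y (2 * N)))]
      refine Finset.sum_congr rfl fun i _ => mul_comm _ _
    rw [this, phi_finset_sum]
    refine Finset.sum_congr rfl fun i _ => ?_
    rw [phi_const_mul, hcphi, mul_comm]
  have hdist : ∀ y, |((min y (2 * N) : ℕ) : ℝ) - τ y| = boundaryDist S (min y (2 * N)) := by
    intro y
    rw [← cast_natDist, hd]
  have hv : ∀ i, |smoothedCumPrev S (clippedPrev h N) (boundary S i) - c i| ≤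
      phi (fun y => |ramp S (boundary S i) (min y (2 * N)) - ramp S (boundary S i) (τ y)|)
        h.counts := by
    intro i
    rw [smoothedCumPrev_clippedPrev h0 h hN (boundary_mem S i), ← hcphi]
    have : (fun y => if boundary S i ≤ τ y then (1 : ℝ) else 0) =
        fun y => ramp S (boundary S i) (τ y) := by
      funext y
      rw [ramp_of_mem h0 (boundary_mem S i) (ht _)]
    rw [this, ← phi_sub]
    exact abs_phi_le_phi_abs _ _
  have hsumv : ∑ i, boundaryGap S i *
      |smoothedCumPrev S (clippedPrev h N) (boundary S i) - c i| ≤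
      phi (fun y => (boundaryDist S (min y (2 * N)) : ℝ)) h.counts := by
    calc _ ≤ ∑ i, boundaryGap S i * phi (fun y => |ramp S (boundary S i) (min y (2 * N)) -
          ramp S (boundary S i) (τ y)|) h.counts := by
          refine Finset.sum_le_sum fun i _ => ?_
          have := (hgap i).le
          exact mul_le_mul_of_nonneg_left (hv i) this
      _ = phi (fun y => ∑ i, boundaryGap S i * |ramp S (boundary S i) (min y (2 * N)) -
          ramp S (boundary S i) (τ y)|) h.counts := by
          rw [phi_finset_sum]
          simp only [phi_const_mul]
      _ ≤ _ := by
          refine phi_mono fun y _ => ?_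
          rw [← hdist]
          exact sum_gap_mul_abs_ramp_sub_le h0 (τ y) (min y (2 * N))
  have e1 : |phi g (countsOfCumulative (boundary S) fun i => (round (max (x i) 0)).toNat) -
      phi (fun y => g (τ y)) h.counts| ≤
      2 * ∑ i, boundaryGap S i * |x i - smoothedCumPrev S (clippedPrev h N) (boundary S i)| +
      2 * phi (fun y => (boundaryDist S (min y (2 * N)) : ℝ)) h.counts := by
    rw [phi_countsOfCumulative hg.1 _ _ (antitone_toNat_round hx), hmid, ← Finset.sum_sub_distrib]
    refine (Finset.abs_sum_le_sum_abs _ _).trans ?_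
    calc _ ≤ ∑ i, (2 * (boundaryGap S i *
            |x i - smoothedCumPrev S (clippedPrev h N) (boundary S i)|) +
          2 * (boundaryGap S i *
            |smoothedCumPrev S (clippedPrev h N) (boundary S i) - c i|)) := by
          refine Finset.sum_le_sum fun i _ => ?_
          rw [← sub_mul, abs_mul]
          have h1 := abs_round_sub_le_two_mul (x i) (c i)
          have h2 := abs_sub_le (x i) (smoothedCumPrev S (clippedPrev h N) (boundary S i)) (c i)
          calc _ ≤ (2 * |x i - c i|) * boundaryGap S i := by
                refine mul_le_mul h1 (hΔ1 i) (abs_nonneg _) (by positivity)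
            _ ≤ (2 * (|x i - smoothedCumPrev S (clippedPrev h N) (boundary S i)| +
                |smoothedCumPrev S (clippedPrev h N) (boundary S i) - c i|)) *
                  boundaryGap S i := by
                have := (hgap i).le
                gcongr
            _ = _ := by ring
      _ ≤ _ := by
          rw [Finset.sum_add_distrib, ← Finset.mul_sum, ← Finset.mul_sum]
          linarith
  have e2 : |phi (fun y => g (τ y)) h.counts - phi g h.counts| ≤
      phi (fun y => (y : ℝ) - (min y (2 * N) : ℕ)) h.counts +
      phi (fun y => (boundaryDist S (min y (2 * N)) : ℝ)) h.counts := by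
    rw [← phi_sub]
    refine (abs_phi_le_phi_abs _ _).trans ?_
    have : phi (fun y => ((y : ℝ) - (min y (2 * N) : ℕ)) +
        (boundaryDist S (min y (2 * N)) : ℝ)) h.counts =
        phi (fun y => (y : ℝ) - (min y (2 * N) : ℕ)) h.counts +
        phi (fun y => (boundaryDist S (min y (2 * N)) : ℝ)) h.counts := by
      simp only [phi, Multiset.sum_map_add]
    rw [← this]
    refine phi_mono fun y _ => (hg.abs_sub_le _ _).trans ?_
    have h1 := hdist y
    have h2 := abs_sub_le (y : ℝ) (min y (2 * N) : ℕ) (τ y)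
    rw [abs_sub_comm]
    have h3 : ((min y (2 * N) : ℕ) : ℝ) ≤ y := by exact_mod_cast min_le_left _ _
    rw [abs_of_nonneg (by linarith : (0 : ℝ) ≤ (y : ℝ) - (min y (2 * N) : ℕ))] at h2
    linarith
  have := abs_sub_le (phi g (countsOfCumulative (boundary S)
    fun i => (round (max (x i) 0)).toNat)) (phi (fun y => g (τ y)) h.counts) (phi g h.counts)
  linarith

/-- Given the boundaries, the expected error of the high privacy mechanism. The Laplace noise
contributes in proportion to the number of boundaries, by Cauchy-Schwarz and since isotonic
regression is a contraction. -/
theorem lintegral_highPrivacy_sub_le {ε₃ : ℝ} (hε : 0 < ε₃) {T N : ℕ} (hT : 0 < T) (hN : N ≠ 0)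
    (h : AnonHist) (cl : Multiset ℤ) {g : ℕ → ℝ} (hg : UnitLip g) {S : Finset ℕ}
    (hS : S = boundaries cl T N ε₃) :
    ∫⁻ H, ENNReal.ofReal |phi g H.counts - phi g h.counts| ∂(highPrivacy h cl T N ε₃) ≤
      ENNReal.ofReal (phi (fun y => (y : ℝ) - (min y (2 * N) : ℕ)) h.counts +
        3 * phi (fun y => (boundaryDist S (min y (2 * N)) : ℝ)) h.counts + 3 / ε₃ * S.card) := by
  have h0 : 0 ∉ S := hS ▸ zero_notMem_boundaries hε hT hN cl
  have h2 : 2 * N ∈ S := hS ▸ two_mul_mem_boundaries cl T N ε₃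
  have hgap := fun i => boundaryGap_pos h0 i
  have hb : ∀ i, 0 < 1 / (ε₃ * boundaryGap S i) := fun i => by
    have := hgap i
    positivity
  have hw : ∀ i, 0 < boundaryGap S i ^ 2 := fun i => by
    have := hgap i
    positivity
  have hprob : ∀ i, IsProbabilityMeasure (laplace (1 / (ε₃ * boundaryGap S i))) :=
    fun i => isProbabilityMeasure_laplace (hb i)
  rw [highPrivacy, ← hS]
  refine (lintegral_map_le _ _).trans ?_
  set E := phi (fun y => (y : ℝ) - (min y (2 * N) : ℕ)) h.counts +
        3 * phi (fun y => (boundaryDist S (min y (2 * N)) : ℝ)) h.counts with hE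
  have hphi0 : ∀ f : ℕ → ℝ, (∀ y, 0 ≤ f y) → 0 ≤ phi f h.counts := fun f hf => by
    have := phi_mono (f := fun _ => 0) (g := f) (s := h.counts) fun y _ => hf y
    simpa [phi] using this
  have hE0 : 0 ≤ E := by
    refine add_nonneg (hphi0 _ fun y => ?_) (mul_nonneg (by norm_num) (hphi0 _ fun y => by positivity))
    have : ((min y (2 * N) : ℕ) : ℝ) ≤ y := by exact_mod_cast min_le_left _ _
    linarith
  have hpt : ∀ z : Fin S.card → ℝ, ENNReal.ofReal |phi g (AnonHist.ofCounts
      (roundedFit (boundary S) (fun i => boundaryGap S i ^ 2)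
        fun i => smoothedCumPrev S (clippedPrev h N) (boundary S i) + z i)).counts -
        phi g h.counts| ≤ ENNReal.ofReal (E + S.card / ε₃) +
          ∑ i, ENNReal.ofReal (ε₃ * boundaryGap S i ^ 2) * ENNReal.ofReal (z i ^ 2) := by
    intro z
    have hnn : ∀ i ∈ Finset.univ, 0 ≤ (ε₃ * boundaryGap S i ^ 2) * z i ^ 2 := fun i _ => by
      have := hgap i
      positivity
    have e1 : ∑ i, ENNReal.ofReal (ε₃ * boundaryGap S i ^ 2) * ENNReal.ofReal (z i ^ 2) =
        ENNReal.ofReal (∑ i, (ε₃ * boundaryGap S i ^ 2) * z i ^ 2) := by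
      rw [ENNReal.ofReal_sum_of_nonneg hnn]
      refine Finset.sum_congr rfl fun i _ => ?_
      have := hgap i
      exact (ENNReal.ofReal_mul (by positivity)).symm
    rw [e1, ← ENNReal.ofReal_add (by positivity) (Finset.sum_nonneg hnn)]
    refine ENNReal.ofReal_le_ofReal ?_
    set v : Fin S.card → ℝ := fun i => smoothedCumPrev S (clippedPrev h N) (boundary S i) with hv
    have hfit := isIsotonicFit_isotonicFit hw fun i => v i + z i
    have hvanti : Antitone v := fun i j hij =>
      smoothedCumPrev_antitone S _ h0 ((boundary_strictMono S).monotone hij)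
    have hd := hfit.dist_le hw hvanti
    simp only [add_sub_cancel_left] at hd
    rw [AnonHist.ofCounts, phi_filter_pos hg.1, roundedFit]
    refine (abs_phi_countsOfCumulative_sub_le h0 h h2 hfit.1 hg).trans ?_
    set x := isotonicFit (fun i => boundaryGap S i ^ 2) fun i => v i + z i with hx
    -- `2 u ≤ 1 / ε₃ + ε₃ u ^ 2` for each boundary
    have hcs : 2 * ∑ i, boundaryGap S i * |x i - v i| ≤
        S.card / ε₃ + ε₃ * ∑ i, boundaryGap S i ^ 2 * (x i - v i) ^ 2 := by
      have : (S.card : ℝ) / ε₃ = ∑ _i : Fin S.card, 1 / ε₃ := by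
        rw [Finset.sum_const, Finset.card_univ, Fintype.card_fin, nsmul_eq_mul, mul_one_div]
      rw [this, Finset.mul_sum, Finset.mul_sum, ← Finset.sum_add_distrib]
      refine Finset.sum_le_sum fun i _ => ?_
      have e : 1 / ε₃ + ε₃ * (boundaryGap S i ^ 2 * (x i - v i) ^ 2) -
          2 * (boundaryGap S i * |x i - v i|) =
          (1 - ε₃ * (boundaryGap S i * |x i - v i|)) ^ 2 / ε₃ := by
        rw [← sq_abs (x i - v i)]
        field_simp
        ring
      have : 0 ≤ (1 - ε₃ * (boundaryGap S i * |x i - v i|)) ^ 2 / ε₃ := by positivity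
      linarith
    have hd' : ε₃ * ∑ i, boundaryGap S i ^ 2 * (x i - v i) ^ 2 ≤
        ∑ i, (ε₃ * boundaryGap S i ^ 2) * z i ^ 2 := by
      simp only [mul_assoc]
      rw [← Finset.mul_sum]
      gcongr
    linarith
  refine (lintegral_mono hpt).trans ?_
  rw [lintegral_add_left measurable_const, lintegral_const, measure_univ, mul_one,
    lintegral_finsetSum _ fun i _ => by fun_prop]
  have hi : ∀ i : Fin S.card, ∫⁻ z : Fin S.card → ℝ,
      ENNReal.ofReal (ε₃ * boundaryGap S i ^ 2) * ENNReal.ofReal (z i ^ 2)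
        ∂(Measure.pi fun i => laplace (1 / (ε₃ * boundaryGap S i))) = ENNReal.ofReal (2 / ε₃) := by
    intro i
    have := hgap i
    rw [lintegral_pi_eval (fun i => laplace (1 / (ε₃ * boundaryGap S i))) i
      (fun y => ENNReal.ofReal (ε₃ * boundaryGap S i ^ 2) * ENNReal.ofReal (y ^ 2)) (by fun_prop),
      lintegral_const_mul _ (by fun_prop), sq_laplace (hb i), ← ENNReal.ofReal_mul (by positivity)]
    congr 1
    field_simp
  simp only [hi]
  rw [Finset.sum_const, Finset.card_univ, Fintype.card_fin, nsmul_eq_mul,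
    ← ENNReal.ofReal_natCast, ← ENNReal.ofReal_mul (by positivity),
    ← ENNReal.ofReal_add (by positivity) (by positivity)]
  refine ENNReal.ofReal_le_ofReal (le_of_eq ?_)
  ring

/-! ### Accuracy in the high privacy regime: the boundaries -/

theorem phi_filter (f : ℕ → ℝ) (s : Multiset ℕ) (p : ℕ → Prop) [DecidablePred p] :
    phi f (s.filter p) = phi (fun y => if p y then f y else 0) s := by
  induction s using Multiset.induction_on with
  | empty => simp
  | cons a s ih =>
    rw [Multiset.filter_cons, phi_add, ih, phi_cons]
    congr 1
    split_ifs <;> simp [phi]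

theorem gridRatio_pos {ε₃ : ℝ} (h0 : 0 < ε₃) (h1 : ε₃ < 1) {N : ℕ} (hN : N ≠ 0) :
    0 < gridRatio N ε₃ := by
  have hN' : (0 : ℝ) < N := by exact_mod_cast Nat.pos_of_ne_zero hN
  have : 0 < Real.log (1 / ε₃) := Real.log_pos (by rw [lt_div_iff₀ h0]; linarith)
  rw [gridRatio]
  positivity

theorem le_gridEnd {ε₃ : ℝ} (h0 : 0 < ε₃) (N : ℕ) :
    10 * √(N : ℝ) / (ε₃ * √ε₃) ≤ gridEnd N ε₃ := by
  refine le_trans (le_of_eq ?_) (Nat.le_ceil _)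
  have : √(ε₃ ^ 3) = ε₃ * √ε₃ := by
    rw [show ε₃ ^ 3 = ε₃ ^ 2 * ε₃ by ring, Real.sqrt_mul (by positivity), Real.sqrt_sq h0.le]
  rw [Real.sqrt_div (by positivity), this, mul_div_assoc]

theorem two_mul_threshold_lt_gridEnd {ε : ℝ} (h0 : 0 < ε) (h1 : ε ≤ 1) {N : ℕ} (hN : N ≠ 0) :
    2 * (threshold ε N + 1) < gridEnd N (ε / 3) := by
  have hs := one_le_sqrt_natCast hN
  have h2 := threshold_le (ε := ε) hN
  have h3 := le_gridEnd (ε₃ := ε / 3) (by positivity) N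
  have h4 : 10 * √(N : ℝ) ≤ 10 * √(N : ℝ) / (ε / 3 * √(ε / 3)) := by
    refine le_div_self (by positivity) (by positivity) ?_
    have : √(ε / 3) ≤ 1 := Real.sqrt_le_one.2 (by linarith)
    exact mul_le_one₀ (by linarith) (by positivity) this
  have : (2 * (threshold ε N + 1) : ℝ) < gridEnd N (ε / 3) := by linarith
  exact_mod_cast this

/-- The logarithmic grid has a point slightly below each number between `T` and `T'`. -/
theorem exists_boundary_near {ε₃ : ℝ} {N : ℕ} (hq : 0 < gridRatio N ε₃) {T y : ℕ} (hT : 0 < T)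
    (hTy : T ≤ y) (hy : y ≤ gridEnd N ε₃) (cl : Multiset ℤ) :
    ∃ t ∈ boundaries cl T N ε₃, t ≤ y ∧ (y : ℝ) ≤ t + gridRatio N ε₃ * y + 1 := by
  set q := gridRatio N ε₃ with hqd
  have hT' : (0 : ℝ) < T := by exact_mod_cast hT
  have hTy' : (T : ℝ) ≤ y := by exact_mod_cast hTy
  have hy' : (y : ℝ) ≤ gridEnd N ε₃ := by exact_mod_cast hy
  have hb : 1 < 1 + q := by linarith
  have hyT : 0 < (y : ℝ) / T := div_pos (hT'.trans_le hTy') hT'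
  set i := ⌊Real.logb (1 + q) (y / T)⌋₊ with hi
  have hlog0 : 0 ≤ Real.logb (1 + q) (y / T) :=
    Real.logb_nonneg hb (by rw [le_div_iff₀ hT']; linarith)
  have hle : (1 + q) ^ i ≤ y / T := by
    have := (Real.le_logb_iff_rpow_le hb hyT).1 (Nat.floor_le hlog0)
    rwa [Real.rpow_natCast] at this
  have hlt : (y : ℝ) / T < (1 + q) ^ (i + 1) := by
    have := (Real.logb_lt_iff_lt_rpow hb hyT).1 (Nat.lt_floor_add_one _)
    rwa [← Nat.cast_succ, Real.rpow_natCast] at this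
  have hik : i < ⌊Real.logb (1 + q) ((gridEnd N ε₃ : ℝ) / T)⌋₊ + 1 := by
    refine Nat.lt_succ_of_le (Nat.floor_mono ?_)
    exact Real.logb_le_logb_of_le hb hyT (by gcongr)
  refine ⟨⌊(T : ℝ) * (1 + q) ^ i⌋₊, ?_, ?_, ?_⟩
  · simp only [boundaries, Finset.mem_union]
    exact Or.inl (Or.inl (Or.inr (Finset.mem_image.2 ⟨i, Finset.mem_range.2 hik, rfl⟩)))
  · refine Nat.floor_le_of_le ?_
    rw [mul_comm]
    exact (le_div_iff₀ hT').1 hle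
  · have h1 := Nat.lt_floor_add_one ((T : ℝ) * (1 + q) ^ i)
    rw [div_lt_iff₀ hT', pow_succ] at hlt
    have h2 : (1 + q) ^ i * T ≤ y := (le_div_iff₀ hT').1 hle
    nlinarith

theorem boundaryDist_of_mem {S : Finset ℕ} {y : ℕ} (hy : y ∈ S ∨ y = 0) : boundaryDist S y = 0 :=
  Nat.le_zero.1 ((boundaryDist_le hy y).trans (le_of_eq (Nat.dist_self y)))

/-- Below the grid end, counts up to `T` are boundaries, and the others are near a point of the
logarithmic grid. -/
theorem boundaryDist_small_le {ε₃ : ℝ} {N : ℕ} (hq : 0 < gridRatio N ε₃) {T y : ℕ} (hT : 0 < T)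
    (hy : y < gridEnd N ε₃) (cl : Multiset ℤ) :
    (boundaryDist (boundaries cl T N ε₃) (min y (2 * N)) : ℝ) ≤
      if T < y then gridRatio N ε₃ * y + 1 else 0 := by
  by_cases h1 : min y (2 * N) ≤ T
  · have : boundaryDist (boundaries cl T N ε₃) (min y (2 * N)) = 0 := by
      refine boundaryDist_of_mem ?_
      rcases Nat.eq_zero_or_pos (min y (2 * N)) with h | h
      · exact Or.inr h
      · refine Or.inl ?_
        simp only [boundaries, Finset.mem_union, Finset.mem_Icc]
        exact Or.inl (Or.inl (Or.inl ⟨h, h1⟩))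
    rw [this]
    split_ifs <;> simp
    positivity
  · rw [if_pos (by omega)]
    obtain ⟨t, ht, hty, h2⟩ := exists_boundary_near hq hT (y := min y (2 * N)) (by omega) (by omega) cl
    refine (Nat.cast_le.2 (boundaryDist_le (Or.inl ht) _)).trans ?_
    rw [cast_natDist, abs_of_nonneg (sub_nonneg.2 (by exact_mod_cast hty))]
    have h3 : ((min y (2 * N) : ℕ) : ℝ) ≤ y := by exact_mod_cast min_le_left _ _
    have := mul_le_mul_of_nonneg_left h3 hq.le
    linarith

/-- From the grid end on, a count `y` of the large part has its noisy version `y + z` as a boundary,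
unless that falls below the grid end; then `|z|` exceeds the distance of `y` to the grid end, which
is near a point of the grid. -/
theorem boundaryDist_large_le {ε₃ : ℝ} {N : ℕ} (hq : 0 < gridRatio N ε₃) {T y : ℕ} {z : ℤ}
    (hT : 0 < T) (hT2 : T ≤ gridEnd N ε₃) (hy : gridEnd N ε₃ ≤ y) {cl : Multiset ℤ}
    (hz : (y : ℤ) + z ∈ cl) :
    (boundaryDist (boundaries cl T N ε₃) (min y (2 * N)) : ℝ) ≤
      z.natAbs + (gridRatio N ε₃ * y + 1) := by
  rcases le_or_gt (2 * N) y with h1 | h1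
  · rw [min_eq_right h1, boundaryDist_of_mem (Or.inl (two_mul_mem_boundaries _ _ _ _))]
    simp only [Nat.cast_zero]
    positivity
  rw [min_eq_left h1.le]
  by_cases h2 : (gridEnd N ε₃ : ℤ) ≤ y + z
  · have hmem : ((y : ℤ) + z).toNat ∈ boundaries cl T N ε₃ := by
      simp only [boundaries, Finset.mem_union, Multiset.mem_toFinset, Multiset.mem_map,
        Multiset.mem_filter]
      exact Or.inl (Or.inr ⟨_, ⟨hz, h2⟩, rfl⟩)
    have h3 : boundaryDist (boundaries cl T N ε₃) y ≤ z.natAbs := by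
      refine (boundaryDist_le (Or.inl hmem) _).trans ?_
      rw [Nat.dist]
      omega
    have h4 : (boundaryDist (boundaries cl T N ε₃) y : ℝ) ≤ z.natAbs := by exact_mod_cast h3
    have : 0 ≤ gridRatio N ε₃ * y := by positivity
    linarith
  · obtain ⟨t, ht, hty, h3⟩ := exists_boundary_near hq hT hT2 le_rfl cl
    refine (Nat.cast_le.2 (boundaryDist_le (Or.inl ht) _)).trans ?_
    rw [cast_natDist, abs_of_nonneg (sub_nonneg.2 (by exact_mod_cast hty.trans hy))]
    have h4 : y ≤ z.natAbs + gridEnd N ε₃ := by omega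
    have h4' : (y : ℝ) ≤ z.natAbs + gridEnd N ε₃ := by exact_mod_cast h4
    have h5 : (gridEnd N ε₃ : ℝ) ≤ y := by exact_mod_cast hy
    have := mul_le_mul_of_nonneg_left h5 hq.le
    linarith

/-- The total distance of the elements from the boundaries. -/
theorem phi_boundaryDist_le {ε₃ : ℝ} {N : ℕ} (hq : 0 < gridRatio N ε₃) {T : ℕ} (hT : 0 < T)
    (hT2 : 2 * (T + 1) < gridEnd N ε₃) (h : AnonHist) (M : ℕ) (z : ℤ)
    (zl : Fin (largeList h T M z).length → ℤ) {cl : Multiset ℤ}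
    (hcl : cl = (List.ofFn fun i => ((largeList h T M z).get i : ℤ) + zl i : List ℤ)) :
    phi (fun y => (boundaryDist (boundaries cl T N ε₃) (min y (2 * N)) : ℝ)) h.counts ≤
      (if M ≤ z.natAbs then (h.total : ℝ) else 0) + (gridRatio N ε₃ * h.total + largeCard h T) +
      ∑ i, (if gridEnd N ε₃ ≤ 2 * (largeList h T M z).get i then ((zl i).natAbs : ℝ) else 0) := by
  set q := gridRatio N ε₃ with hqd
  set T' := gridEnd N ε₃ with hT'
  set F : ℕ → ℝ := fun y => (boundaryDist (boundaries cl T N ε₃) (min y (2 * N)) : ℝ) with hF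
  have hF0 : ∀ y, 0 ≤ F y := fun y => Nat.cast_nonneg _
  have hsum0 : 0 ≤ ∑ i, (if T' ≤ 2 * (largeList h T M z).get i then ((zl i).natAbs : ℝ) else 0) :=
    Finset.sum_nonneg fun i _ => by split_ifs <;> positivity
  split_ifs with hz
  · have h1 : phi F h.counts ≤ h.total := by
      rw [AnonHist.total, ← phi_cast]
      refine phi_mono fun y _ => ?_
      have := boundaryDist_le (S := boundaries cl T N ε₃) (Or.inr rfl) (min y (2 * N))
      rw [Nat.dist] at this
      exact Nat.cast_le.2 (by omega)
    have : 0 ≤ q * h.total + largeCard h T := by positivity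
    linarith
  · have hsplit : phi F h.counts = phi (fun y => if y < T' then F y else 0) h.counts +
        phi (fun y => if T' ≤ y then F y else 0) h.counts := by
      rw [← sub_eq_iff_eq_add, ← phi_sub]
      congr 1
      funext y
      split_ifs <;> first | omega | simp
    -- without a large shift, the large part has all elements from the grid end on
    have hlarge : ∀ f : ℕ → ℝ, phi (fun y => if T' ≤ y then f y else 0) h.counts =
        ∑ i, (if T' ≤ (largeList h T M z).get i then f ((largeList h T M z).get i) else 0) := by
      intro f
      rw [← phi_coe (fun y => if T' ≤ y then f y else 0), coe_largeList,
        largeCounts_eq h T M (by omega), phi_add, phi_replicate, if_neg (by omega), mul_zero,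
        add_zero, phi_filter]
      congr 1
      funext y
      split_ifs <;> first | omega | rfl
    have h2 : phi (fun y => if T' ≤ y then F y else 0) h.counts ≤
        ∑ i, (if T' ≤ 2 * (largeList h T M z).get i then ((zl i).natAbs : ℝ) else 0) +
        phi (fun y => if T' ≤ y then q * y + 1 else 0) h.counts := by
      rw [hlarge, hlarge, ← Finset.sum_add_distrib]
      refine Finset.sum_le_sum fun i _ => ?_
      by_cases hi : T' ≤ (largeList h T M z).get i
      · rw [if_pos hi, if_pos hi, if_pos (by omega)]
        refine boundaryDist_large_le hq hT (by omega) hi ?_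
        rw [hcl, Multiset.mem_coe, List.mem_ofFn]
        exact ⟨i, rfl⟩
      · rw [if_neg hi, if_neg hi, add_zero]
        split_ifs <;> positivity
    have h3 : phi (fun y => if y < T' then F y else 0) h.counts +
        phi (fun y => if T' ≤ y then q * y + 1 else 0) h.counts ≤
        phi (fun y => q * y + (if T < y then 1 else 0)) h.counts := by
      have e : phi (fun y => (if y < T' then F y else 0) + (if T' ≤ y then q * y + 1 else 0))
          h.counts = phi (fun y => if y < T' then F y else 0) h.counts +
          phi (fun y => if T' ≤ y then q * y + 1 else 0) h.counts := by
        simp only [phi, Multiset.sum_map_add]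
      rw [← e]
      refine phi_mono fun y _ => ?_
      have hqy : 0 ≤ q * (y : ℝ) := by positivity
      rcases lt_or_ge y T' with hy | hy
      · have := boundaryDist_small_le (y := y) hq hT hy cl
        rw [if_pos hy, if_neg (by omega), add_zero]
        refine this.trans ?_
        split_ifs
        · exact le_rfl
        · simpa using hqy
      · rw [if_neg (by omega), if_pos hy, if_pos (by omega), zero_add]
    have h4 : phi (fun y => q * y + (if T < y then 1 else 0)) h.counts =
        q * h.total + largeCard h T := by
      have : phi (fun y => q * y + (if T < y then 1 else 0)) h.counts =
          phi (fun y => q * (y : ℝ)) h.counts + phi (fun y => if T < y then 1 else 0) h.counts := by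
        simp only [phi, Multiset.sum_map_add]
      rw [this, phi_const_mul, phi_cast, phi_indicator]
      rfl
    rw [hsplit]
    linarith

theorem card_filter_ofFn {n : ℕ} (v : Fin n → ℤ) (p : ℤ → Prop) [DecidablePred p] :
    (((List.ofFn v : List ℤ) : Multiset ℤ).filter p).card = ∑ i, if p (v i) then 1 else 0 := by
  rw [← Multiset.countP_eq_card_filter, Multiset.coe_countP, List.countP_eq_length_filter]
  induction n with
  | zero => simp
  | succ n ih =>
    rw [List.ofFn_succ, List.filter_cons, Fin.sum_univ_succ, ← ih]
    split_ifs with h1 h2 h2 <;> simp_all [add_comm]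

/-- A noisy element of the large part reaches the grid end only if the element itself or its noise
is at least half of it. -/
theorem card_boundaries_le (N T : ℕ) (ε₃ : ℝ) {n : ℕ} (l : Fin n → ℕ) (zl : Fin n → ℤ)
    {cl : Multiset ℤ} (hcl : cl = (List.ofFn fun i => (l i : ℤ) + zl i : List ℤ)) :
    (boundaries cl T N ε₃).card ≤
      T + ⌊Real.logb (1 + gridRatio N ε₃) ((gridEnd N ε₃ : ℝ) / (T : ℝ))⌋₊ + 2 +
      ∑ i, ((if gridEnd N ε₃ ≤ 2 * l i then 1 else 0) +
        (if gridEnd N ε₃ ≤ 2 * (zl i).natAbs then 1 else 0)) := by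
  have h1 : ((cl.filter fun x => (gridEnd N ε₃ : ℤ) ≤ x).map Int.toNat).toFinset.card ≤
      ∑ i, ((if gridEnd N ε₃ ≤ 2 * l i then 1 else 0) +
        (if gridEnd N ε₃ ≤ 2 * (zl i).natAbs then 1 else 0)) := by
    refine (Multiset.toFinset_card_le _).trans ?_
    rw [Multiset.card_map, hcl, card_filter_ofFn]
    refine Finset.sum_le_sum fun i _ => ?_
    split_ifs <;> omega
  unfold boundaries
  refine (Finset.card_union_le _ _).trans ?_
  refine (add_le_add_left ((Finset.card_union_le _ _).trans
    (add_le_add_left (Finset.card_union_le _ _) _)) _).trans ?_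
  have h2 := Finset.card_image_le (s := Finset.range
    (⌊Real.logb (1 + gridRatio N ε₃) ((gridEnd N ε₃ : ℝ) / (T : ℝ))⌋₊ + 1))
    (f := fun i => ⌊(T : ℝ) * (1 + gridRatio N ε₃) ^ i⌋₊)
  rw [Finset.card_range] at h2
  rw [Finset.card_singleton, Nat.card_Icc]
  omega

/-- The fake elements at `T + 1` are below half the grid end, so they do not count here. -/
theorem sum_large_mul_le (h : AnonHist) {T T' : ℕ} (hT : 2 * (T + 1) < T') (M : ℕ) (z : ℤ) :
    (∑ i, if T' ≤ 2 * (largeList h T M z).get i then 1 else 0) * T' ≤ 2 * h.total := by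
  have h1 : ((∑ i, if T' ≤ 2 * (largeList h T M z).get i then 1 else 0 : ℕ) : ℝ) =
      ((largeCounts h T M z).filter fun x => T' ≤ 2 * x).card := by
    rw [← phi_indicator, ← coe_largeList, phi_coe]
    push_cast
    rfl
  have h2 := Multiset.card_le_card (Multiset.filter_le_filter (fun x => T' ≤ 2 * x)
    (largeCounts_le h T M z))
  rw [Multiset.filter_add, Multiset.card_add, Multiset.filter_filter,
    (Multiset.filter_eq_nil (s := Multiset.replicate _ _)).2 fun a ha => by
      rw [Multiset.eq_of_mem_replicate ha]
      omega, Multiset.card_zero, add_zero] at h2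
  have h3 := card_filter_mul_le h.counts (fun x => T' ≤ 2 * x ∧ T < x) ((T' + 1) / 2)
    fun x hx => by omega
  rw [Nat.cast_inj.1 h1]
  calc _ ≤ (h.counts.filter fun x => T' ≤ 2 * x ∧ T < x).card * (2 * ((T' + 1) / 2)) :=
        Nat.mul_le_mul h2 (by omega)
    _ = 2 * ((h.counts.filter fun x => T' ≤ 2 * x ∧ T < x).card * ((T' + 1) / 2)) := by ring
    _ ≤ _ := by
        rw [AnonHist.total]
        omega

/-! ### Accuracy in the high privacy regime: the expected error -/

theorem lintegral_pi_const_add_sum_mul {a : ℝ} (h0 : 0 ≤ a) (h1 : a < 1) {n : ℕ} (c : ℝ≥0∞)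
    (k : Fin n → ℝ≥0∞) (u w : ℤ → ℝ≥0∞) :
    ∫⁻ z, (c + ∑ i, (k i * u (z i) + w (z i)))
        ∂(Measure.pi fun _ : Fin n => twoSidedGeometric a) =
      c + ((∑ i, k i) * ∫⁻ z, u z ∂twoSidedGeometric a + n * ∫⁻ z, w z ∂twoSidedGeometric a) := by
  have := isProbabilityMeasure_twoSidedGeometric h0 h1
  rw [lintegral_add_left .of_discrete, lintegral_const, measure_univ, mul_one,
    lintegral_finsetSum _ fun i _ => .of_discrete]
  congr 1
  have hi : ∀ i : Fin n, ∫⁻ z : Fin n → ℤ, (k i * u (z i) + w (z i))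
      ∂(Measure.pi fun _ : Fin n => twoSidedGeometric a) =
      k i * ∫⁻ z, u z ∂twoSidedGeometric a + ∫⁻ z, w z ∂twoSidedGeometric a := by
    intro i
    rw [lintegral_pi_eval (fun _ : Fin n => twoSidedGeometric a) i (fun y => k i * u y + w y)
      .of_discrete, lintegral_add_left .of_discrete, lintegral_const_mul _ .of_discrete]
  simp only [hi, Finset.sum_add_distrib, ← Finset.sum_mul]
  simp

/-- The expected error of the high privacy mechanism, given the noisy number of items, in terms of
the first absolute moment and a tail probability of the noise. -/
theorem lintegral_cost_high {ε : ℝ} (hε : 0 < ε) (hε1 : ε ≤ 1) (h : AnonHist) {N : ℕ} (hN : N ≠ 0)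
    {g : ℕ → ℝ} (hg : UnitLip g) {T T' M ℓ : ℕ} (hT : T = threshold ε N)
    (hM : M = fakeCount ε N) {e q a V P : ℝ} (he : e = ε / 3) (hT' : T' = gridEnd N e)
    (hq : q = gridRatio N e) (hℓ : ℓ = ⌊Real.logb (1 + q) ((T' : ℝ) / T)⌋₊)
    (ha : a = Real.exp (-(ε / 3))) (hV0 : 0 ≤ V) (hP0 : 0 ≤ P)
    (hV : ∫⁻ z, (z.natAbs : ℝ≥0∞) ∂twoSidedGeometric a ≤ ENNReal.ofReal V)
    (hP : ∫⁻ z, (if T' ≤ 2 * z.natAbs then 1 else 0) ∂twoSidedGeometric a ≤ ENNReal.ofReal P) :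
    ∫⁻ o, ENNReal.ofReal |phi g o.1.counts - phi g h.counts| ∂(givenLaw ε h N) ≤
      ENNReal.ofReal (phi (fun y => (y : ℝ) - (min y (2 * N) : ℕ)) h.counts +
        3 * (q * h.total + largeCard h T) + 3 / e * (T + ℓ + 2) + 3 * h.total * (2 * a ^ M) +
        2 * h.total / T' * (3 * V + 3 / e) + (largeCard h T + M + V) * (3 / e * P)) := by
  have he0 : 0 < e := by rw [he]; positivity
  have ha0 : 0 ≤ a := ha ▸ (Real.exp_pos _).le
  have ha1 : a < 1 := by rw [ha, Real.exp_lt_one_iff]; linarith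
  have hT0 : 0 < T := hT ▸ threshold_pos hε hN
  have hTT' : 2 * (T + 1) < T' := by
    rw [hT, hT', he]
    exact two_mul_threshold_lt_gridEnd hε hε1 hN
  have hT'0 : (0 : ℝ) < T' := by exact_mod_cast (show 0 < T' by omega)
  have hq0 : 0 < q := by
    rw [hq]
    exact gridRatio_pos he0 (by linarith) hN
  have hprob := isProbabilityMeasure_twoSidedGeometric ha0 ha1
  set G := twoSidedGeometric a with hG
  set X := phi (fun y => (y : ℝ) - (min y (2 * N) : ℕ)) h.counts with hX
  have hX0 : 0 ≤ X := by
    have := phi_mono (f := fun _ => 0) (g := fun y => (y : ℝ) - (min y (2 * N) : ℕ)) (s := h.counts)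
      fun y _ => sub_nonneg.2 (Nat.cast_le.2 (min_le_left _ _))
    rwa [show phi (fun _ => 0) h.counts = 0 by simp [phi]] at this
  set R := X + 3 * (q * h.total + largeCard h T) + 3 / e * (T + ℓ + 2) with hR
  have hR0 : 0 ≤ R := by positivity
  set u : ℤ → ℝ≥0∞ := fun z => 3 * (z.natAbs : ℝ≥0∞) + ENNReal.ofReal (3 / e) with hu
  set w : ℤ → ℝ≥0∞ := fun z => ENNReal.ofReal (3 / e) * (if T' ≤ 2 * z.natAbs then 1 else 0) with hw
  have hpt : ∀ (z : ℤ) (zs : Fin T → ℤ) (zl : Fin (largeList h T M z).length → ℤ),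
      ∫⁻ o, ENNReal.ofReal |phi g o.1.counts - phi g h.counts|
        ∂(outputLaw ε h T M N ((fun i : Fin T => smallCumPrev h T M z ((i : ℕ) + 1)) + zs)
          (List.ofFn fun i => ((largeList h T M z).get i : ℤ) + zl i : List ℤ)) ≤
      ENNReal.ofReal R + 3 * h.total * (if M ≤ z.natAbs then 1 else 0) +
        ∑ i, (((if T' ≤ 2 * (largeList h T M z).get i then 1 else 0 : ℕ) : ℝ≥0∞) * u (zl i) +
          w (zl i)) := by
    intro z zs zl
    rw [outputLaw, if_neg (by linarith), lintegral_map .of_discrete .of_discrete, ← he]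
    refine (lintegral_highPrivacy_sub_le he0 hT0 hN h _ hg rfl).trans ?_
    have h1 := phi_boundaryDist_le (hq ▸ hq0) hT0 (hT' ▸ hTT') h M z zl rfl
    have h2 := card_boundaries_le N T e (fun i => (largeList h T M z).get i) zl rfl
    rw [← hq, ← hT'] at h1 h2
    rw [← hℓ] at h2
    have h2' := (Nat.cast_le (α := ℝ)).2 h2
    push_cast at h2'
    have h3 : X + 3 * phi (fun y => (boundaryDist (boundaries
        (List.ofFn fun i => ((largeList h T M z).get i : ℤ) + zl i : List ℤ) T N e)
          (min y (2 * N)) : ℝ)) h.counts + 3 / e * (boundaries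
        (List.ofFn fun i => ((largeList h T M z).get i : ℤ) + zl i : List ℤ) T N e).card ≤
        R + 3 * h.total * (if M ≤ z.natAbs then 1 else 0) +
        ∑ i, ((if T' ≤ 2 * (largeList h T M z).get i then 1 else 0 : ℝ) *
          (3 * (zl i).natAbs + 3 / e) + 3 / e * (if T' ≤ 2 * (zl i).natAbs then 1 else 0)) := by
      have e1 : ∑ i, ((if T' ≤ 2 * (largeList h T M z).get i then 1 else 0 : ℝ) *
          (3 * (zl i).natAbs + 3 / e) + 3 / e * (if T' ≤ 2 * (zl i).natAbs then 1 else 0)) =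
          3 * ∑ i, (if T' ≤ 2 * (largeList h T M z).get i then ((zl i).natAbs : ℝ) else 0) +
          3 / e * ∑ i, ((if T' ≤ 2 * (largeList h T M z).get i then 1 else 0 : ℝ) +
            (if T' ≤ 2 * (zl i).natAbs then 1 else 0)) := by
        rw [Finset.mul_sum, Finset.mul_sum, ← Finset.sum_add_distrib]
        refine Finset.sum_congr rfl fun i _ => ?_
        split_ifs <;> ring
      have e2 : 3 * (h.total : ℝ) * (if M ≤ z.natAbs then 1 else 0) =
          3 * (if M ≤ z.natAbs then (h.total : ℝ) else 0) := by split_ifs <;> ring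
      rw [e1, e2, hR]
      have h4 := mul_le_mul_of_nonneg_left h2' (show 0 ≤ 3 / e by positivity)
      rw [mul_add] at h4
      linarith
    refine (ENNReal.ofReal_le_ofReal h3).trans ?_
    have hnn : ∀ i ∈ Finset.univ, 0 ≤ (if T' ≤ 2 * (largeList h T M z).get i then 1 else 0 : ℝ) *
          (3 * (zl i).natAbs + 3 / e) + 3 / e * (if T' ≤ 2 * (zl i).natAbs then 1 else 0) := by
      intro i _
      positivity
    refine ENNReal.ofReal_add_le.trans (add_le_add (ENNReal.ofReal_add_le.trans
      (add_le_add le_rfl ?_)) ?_)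
    · split_ifs
      · rw [mul_one, mul_one, ENNReal.ofReal_mul (by norm_num), ENNReal.ofReal_natCast]
        norm_num
      · simp
    · rw [ENNReal.ofReal_sum_of_nonneg hnn]
      refine Finset.sum_le_sum fun i _ => ENNReal.ofReal_add_le.trans (add_le_add ?_ ?_)
      · simp only [hu]
        split_ifs
        · simp only [one_mul, Nat.cast_one]
          refine ENNReal.ofReal_add_le.trans (add_le_add ?_ le_rfl)
          rw [ENNReal.ofReal_mul (by norm_num), ENNReal.ofReal_natCast]
          norm_num
        · simp
      · simp only [hw]
        split_ifs <;> simp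
  have hIu : ∫⁻ z, u z ∂G ≤ ENNReal.ofReal (3 * V + 3 / e) := by
    simp only [hu]
    rw [lintegral_add_left .of_discrete, lintegral_const_mul _ .of_discrete, lintegral_const,
      measure_univ, mul_one, ENNReal.ofReal_add (by positivity) (by positivity),
      ENNReal.ofReal_mul (by norm_num)]
    gcongr
    norm_num
  have hIw : ∫⁻ z, w z ∂G ≤ ENNReal.ofReal (3 / e * P) := by
    simp only [hw]
    rw [lintegral_const_mul _ .of_discrete, ENNReal.ofReal_mul (by positivity)]
    gcongr
  have hk : ∀ z : ℤ, ∑ i, (((if T' ≤ 2 * (largeList h T M z).get i then 1 else 0 : ℕ) : ℝ≥0∞)) ≤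
      ENNReal.ofReal (2 * h.total / T') := by
    intro z
    rw [← Nat.cast_sum, ← ENNReal.ofReal_natCast]
    refine ENNReal.ofReal_le_ofReal ?_
    rw [le_div_iff₀ hT'0]
    exact_mod_cast sum_large_mul_le h hTT' M z
  clear_value u w
  set c₁ := ENNReal.ofReal (2 * h.total / T' * (3 * V + 3 / e)) with hc₁
  set c₂ := ENNReal.ofReal (3 / e * P) with hc₂
  clear_value c₁ c₂
  have hz : ∀ z : ℤ, ∫⁻ o, ENNReal.ofReal |phi g o.1.counts - phi g h.counts|
      ∂(splitLaw ε h T M N (fun i => smallCumPrev h T M z ((i : ℕ) + 1)) (largeList h T M z)) ≤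
      ENNReal.ofReal R + 3 * h.total * (if M ≤ z.natAbs then 1 else 0) +
        (c₁ + (largeCard h T + M + z.natAbs) * c₂) := by
    intro z
    rw [lintegral_splitLaw, ← ha, ← hG]
    have h1 : ∀ zs : Fin T → ℤ, noisyIntegral a (largeList h T M z)
        (fun cl => ∫⁻ o, ENNReal.ofReal |phi g o.1.counts - phi g h.counts|
          ∂(outputLaw ε h T M N ((fun i : Fin T => smallCumPrev h T M z ((i : ℕ) + 1)) + zs) cl)) ≤
        ENNReal.ofReal R + 3 * h.total * (if M ≤ z.natAbs then 1 else 0) +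
          (c₁ + (largeCard h T + M + z.natAbs) * c₂) := by
      intro zs
      refine (lintegral_mono fun zl => hpt z zs zl).trans ?_
      rw [lintegral_pi_const_add_sum_mul ha0 ha1]
      refine add_le_add le_rfl (add_le_add ?_ ?_)
      · rw [hc₁, ENNReal.ofReal_mul (by positivity)]
        exact mul_le_mul' (hk z) hIu
      · refine mul_le_mul' ?_ hIw
        exact_mod_cast length_largeList_le h T M z
    refine (lintegral_mono h1).trans ?_
    rw [lintegral_const, measure_univ, mul_one]
  rw [lintegral_givenLaw ε h hN, ← hT, ← hM, ← ha, ← hG]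
  refine (lintegral_mono hz).trans ?_
  rw [lintegral_add_left .of_discrete, lintegral_add_left .of_discrete, lintegral_const,
    measure_univ, mul_one, lintegral_const_mul _ .of_discrete, lintegral_add_left .of_discrete,
    lintegral_const, measure_univ, mul_one, lintegral_mul_const _ .of_discrete,
    lintegral_add_left .of_discrete, lintegral_const, measure_univ, mul_one]
  refine (add_le_add (add_le_add_right (mul_le_mul_right (tail_twoSidedGeometric_le ha0 ha1 M) _) _)
    (add_le_add_right (mul_le_mul_left (add_le_add_right hV _) c₂) c₁)).trans (le_of_eq ?_)
  have e1 : ((largeCard h T : ℝ≥0∞) + M) = ENNReal.ofReal (largeCard h T + M) := by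
    rw [ENNReal.ofReal_add (by positivity) (by positivity), ENNReal.ofReal_natCast,
      ENNReal.ofReal_natCast]
  have e2 : (3 * h.total : ℝ≥0∞) = ENNReal.ofReal (3 * h.total) := by
    rw [ENNReal.ofReal_mul (by norm_num), ENNReal.ofReal_natCast]
    norm_num
  rw [e1, e2, hc₁, hc₂, ← ENNReal.ofReal_add (by positivity) (by positivity),
    ← ENNReal.ofReal_mul (by positivity), ← ENNReal.ofReal_mul (by positivity),
    ← ENNReal.ofReal_add (by positivity) (by positivity),
    ← ENNReal.ofReal_add (by positivity) (by positivity),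
    ← ENNReal.ofReal_add (by positivity) (by positivity)]
  congr 1
  ring

/-! ### Accuracy in the high privacy regime: the rate -/

theorem exp_neg_le {e : ℝ} (h0 : 0 < e) (h1 : e ≤ 1 / 3) : 3 / 4 * e ≤ 1 - Real.exp (-e) := by
  have h2 := Real.add_one_le_exp e
  have h3 : Real.exp (-e) ≤ 1 / (1 + e) := by
    rw [Real.exp_neg, ← one_div]
    exact one_div_le_one_div_of_le (by linarith) (by linarith)
  have h4 : 1 / (1 + e) ≤ 1 - 3 / 4 * e := by
    rw [div_le_iff₀ (by linarith)]
    nlinarith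
  linarith

theorem noiseVar_exp_le {e : ℝ} (h0 : 0 < e) (h1 : e ≤ 1 / 3) :
    noiseVar (Real.exp (-e)) ≤ 8 / e ^ 2 := by
  have h2 := exp_neg_le h0 h1
  have h3 : Real.exp (-e) ≤ 1 := Real.exp_le_one_iff.2 (by linarith)
  rw [noiseVar, div_le_div_iff₀ (by nlinarith) (by positivity)]
  have h4 : (3 / 4 * e) ^ 2 ≤ (1 - Real.exp (-e)) ^ 2 := by gcongr
  nlinarith [sq_nonneg e, mul_le_mul_of_nonneg_right h3 (sq_nonneg e)]

/-- The first absolute moment of the noise, from the second one. -/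
theorem lintegral_natAbs_exp_le {e : ℝ} (h0 : 0 < e) (h1 : e ≤ 1 / 3) :
    ∫⁻ z, (z.natAbs : ℝ≥0∞) ∂twoSidedGeometric (Real.exp (-e)) ≤ ENNReal.ofReal (5 / e) := by
  have ha0 := (Real.exp_pos (-e)).le
  have ha1 : Real.exp (-e) < 1 := Real.exp_lt_one_iff.2 (by linarith)
  have hpt : ∀ z : ℤ, (z.natAbs : ℝ≥0∞) ≤ ENNReal.ofReal (1 / (2 * e)) +
      ENNReal.ofReal (e / 2) * ((z.natAbs ^ 2 : ℕ) : ℝ≥0∞) := by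
    intro z
    rw [← ENNReal.ofReal_natCast, ← ENNReal.ofReal_natCast, ← ENNReal.ofReal_mul (by positivity),
      ← ENNReal.ofReal_add (by positivity) (by positivity)]
    refine ENNReal.ofReal_le_ofReal ?_
    have e1 : 1 / (2 * e) + e / 2 * ((z.natAbs ^ 2 : ℕ) : ℝ) - z.natAbs =
        (1 - e * z.natAbs) ^ 2 / (2 * e) := by
      push_cast
      field_simp
      ring
    have : 0 ≤ (1 - e * z.natAbs) ^ 2 / (2 * e) := by positivity
    linarith
  refine (lintegral_mono hpt).trans ?_
  rw [lintegral_add_left .of_discrete, lintegral_const_geometric ha0 ha1,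
    lintegral_const_mul _ .of_discrete]
  have h2 : ∫⁻ z, ((z.natAbs ^ 2 : ℕ) : ℝ≥0∞) ∂twoSidedGeometric (Real.exp (-e)) ≤
      ENNReal.ofReal (8 / e ^ 2) :=
    (sq_twoSidedGeometric_le ha0 ha1).trans (ENNReal.ofReal_le_ofReal (noiseVar_exp_le h0 h1))
  refine (add_le_add_right (mul_le_mul_right h2 _) _).trans ?_
  rw [← ENNReal.ofReal_mul (by positivity), ← ENNReal.ofReal_add (by positivity) (by positivity)]
  refine ENNReal.ofReal_le_ofReal (le_of_eq_of_le ?_ (by gcongr; norm_num : (9 / 2) / e ≤ 5 / e))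
  field_simp
  ring

theorem sqrt_total_le_rate (n : ℕ) {N : ℕ} (hN : N ≠ 0) : √(n : ℝ) ≤ rate n N := by
  rcases le_total n N with h | h
  · exact (Real.sqrt_le_sqrt (by exact_mod_cast h)).trans (sqrt_le_rate n N)
  · have hs := one_le_sqrt_natCast hN
    have h1 : √(N : ℝ) ≤ √(n : ℝ) := Real.sqrt_le_sqrt (by exact_mod_cast h)
    refine le_trans ?_ (le_add_of_nonneg_left (Real.sqrt_nonneg _) : _ ≤ rate n N)
    rw [le_div_iff₀ (by positivity)]
    calc √(n : ℝ) * √(N : ℝ) ^ 3 ≤ √(n : ℝ) * √(n : ℝ) ^ 3 := by gcongr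
      _ = (√(n : ℝ) ^ 2) ^ 2 := by ring
      _ = _ := by rw [Real.sq_sqrt (by positivity)]

set_option maxHeartbeats 800000 in
/-- The bound of `lintegral_cost_high` in terms of `s = √N`, `y = √e`, `r = highFactor ε` and
`X = rate n N`, where `e = ε / 3`. -/
theorem high_cost_arith {s n T T' ℓ L M A e y r q Λ X : ℝ} (hs : 1 ≤ s) (hn : 0 ≤ n) (hy : 0 < y)
    (hye : y ^ 2 = e) (he : e ≤ 1 / 3) (hr : 0 < r) (hΛ : r ^ 2 * e = Λ) (hΛ1 : 1 ≤ Λ)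
    (hq : q = r / s) (hL0 : 0 ≤ L) (hL : L * T ≤ n) (hT1 : s * y ≤ T) (hT2 : T ≤ 2 * s * y + 1)
    (hT' : 10 * s / (e * y) ≤ T') (hℓ : ℓ ≤ 5 * Λ * (1 + s / r)) (hM : M ≤ 4 * s / e + 3)
    (hA : A ≤ 1 / s ^ 4) (hX1 : s ≤ X) (hX2 : n / s ≤ X) (hX3 : r ≤ X) :
    3 * (q * n + L) + 3 / e * (T + ℓ + 2) + 3 * n * (2 * A) +
      2 * n / T' * (3 * (5 / e) + 3 / e) + (L + M + 5 / e) * (3 / e * (e / s ^ 2)) ≤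
      100 * r * X := by
  have hs0 : 0 < s := by linarith
  have he0 : 0 < e := hye ▸ by positivity
  have hX0 : 0 ≤ X := by linarith
  have hry : 1 ≤ r * y := by
    have : 1 ≤ (r * y) ^ 2 := by rw [mul_pow, hye, hΛ]; exact hΛ1
    nlinarith [mul_pos hr hy]
  have hy1 : 1 / y ≤ r := by rw [div_le_iff₀ hy]; exact hry
  have her : 1 / e ≤ r ^ 2 := by rw [div_le_iff₀ he0]; linarith
  have hrX : r ^ 2 ≤ r * X := by nlinarith
  have hr1 : 1 ≤ r := by
    have : y ≤ 1 := by nlinarith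
    nlinarith
  have hylt : y ≤ 1 := by nlinarith
  have hns : 0 ≤ n / s := by positivity
  have t1 : 3 * (q * n) ≤ 3 * (r * X) := by
    rw [hq, show 3 * (r / s * n) = 3 * (r * (n / s)) by field_simp]
    gcongr
  have hL' : L ≤ r * X := by
    have h1 : L ≤ n / (s * y) := by
      rw [le_div_iff₀ (by positivity)]
      exact (mul_le_mul_of_nonneg_left hT1 hL0).trans hL
    refine h1.trans ?_
    rw [show n / (s * y) = 1 / y * (n / s) by field_simp]
    gcongr
  have t2 : 3 / e * T ≤ 6 * (r * X) + 3 * (r * X) := by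
    calc 3 / e * T ≤ 3 / e * (2 * s * y + 1) := by gcongr
      _ = 6 * (1 / y * s) + 3 * (1 / e) := by rw [← hye]; field_simp; ring
      _ ≤ 6 * (r * X) + 3 * (r * X) := by
          have : 1 / e ≤ r * X := her.trans hrX
          gcongr
  have t3 : 3 / e * ℓ ≤ 15 * (r * X) + 15 * (r * X) := by
    calc 3 / e * ℓ ≤ 3 / e * (5 * Λ * (1 + s / r)) := by gcongr
      _ = 15 * r ^ 2 + 15 * (r * s) := by rw [← hΛ]; field_simp; norm_num
      _ ≤ 15 * (r * X) + 15 * (r * X) := by gcongr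
  have t4 : 3 / e * 2 ≤ 6 * (r * X) := by
    have : 1 / e ≤ r * X := her.trans hrX
    rw [show 3 / e * 2 = 6 * (1 / e) by ring]
    gcongr
  have t5 : 3 * n * (2 * A) ≤ 6 * (r * X) := by
    calc 3 * n * (2 * A) ≤ 3 * n * (2 * (1 / s ^ 4)) := by gcongr
      _ ≤ 3 * n * (2 * (1 / s)) := by
          gcongr
          exact le_self_pow₀ hs (by norm_num)
      _ = 6 * (1 * (n / s)) := by ring
      _ ≤ 6 * (r * X) := by gcongr
  have t6 : 2 * n / T' * (3 * (5 / e) + 3 / e) ≤ 4 * (r * X) := by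
    have hT'0 : 0 < 10 * s / (e * y) := by positivity
    calc 2 * n / T' * (3 * (5 / e) + 3 / e) ≤
          2 * n / (10 * s / (e * y)) * (3 * (5 / e) + 3 / e) := by gcongr
      _ = 18 / 5 * (y * (n / s)) := by field_simp; ring
      _ ≤ 4 * (r * X) := by
          gcongr
          · norm_num
          · linarith
  have t7 : (L + M + 5 / e) * (3 / e * (e / s ^ 2)) ≤ 39 * (r * X) := by
    have hs2 : 1 / s ≤ 1 := by rw [div_le_one hs0]; exact hs
    have hs3 : 1 / s ^ 2 ≤ 1 := by
      rw [div_le_one (by positivity)]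
      exact one_le_pow₀ hs
    have h1 : 1 / e ≤ r * X := her.trans hrX
    have h2 : 1 ≤ r * X := by nlinarith
    calc (L + M + 5 / e) * (3 / e * (e / s ^ 2)) ≤
          (L + (4 * s / e + 3) + 5 / e) * (3 / e * (e / s ^ 2)) := by gcongr
      _ = 3 * (1 / s ^ 2 * L) + 12 * (1 / s * (1 / e)) + 9 * (1 / s ^ 2 * 1) +
          15 * (1 / s ^ 2 * (1 / e)) := by field_simp; ring
      _ ≤ 3 * (1 * (r * X)) + 12 * (1 * (r * X)) + 9 * (1 * (r * X)) + 15 * (1 * (r * X)) := by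
          gcongr
      _ = _ := by ring
  have e1 : 3 / e * (T + ℓ + 2) = 3 / e * T + 3 / e * ℓ + 3 / e * 2 := by ring
  rw [e1]
  linarith

/-- The factor by which the cost of the high privacy mechanism exceeds `rate`. -/
noncomputable def highFactor (ε : ℝ) : ℝ := √(Real.log (1 / (ε / 3)) / (ε / 3))

theorem one_le_log_three : 1 ≤ Real.log 3 := by
  rw [Real.le_log_iff_exp_le (by norm_num)]
  linarith [Real.exp_one_lt_d9]

/-- The size of the logarithmic grid: `T' / T` is polynomial in `1 / ε`, and
`log (1 + q) ≥ q / (1 + q)`. -/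
theorem floor_logb_le {ε : ℝ} (hε : 0 < ε) (hε1 : ε ≤ 1) {N : ℕ} (hN : N ≠ 0) :
    (⌊Real.logb (1 + gridRatio N (ε / 3)) ((gridEnd N (ε / 3) : ℝ) / threshold ε N)⌋₊ : ℝ) ≤
      5 * Real.log (1 / (ε / 3)) * (1 + 1 / gridRatio N (ε / 3)) := by
  set e := ε / 3 with he
  have he0 : 0 < e := by positivity
  have he1 : e ≤ 1 / 3 := by rw [he]; linarith
  have hq := gridRatio_pos he0 (by linarith) hN
  set q := gridRatio N e
  have hs := one_le_sqrt_natCast hN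
  have hT0 : (0 : ℝ) < threshold ε N := by exact_mod_cast threshold_pos hε hN
  have hTT' : (threshold ε N : ℝ) ≤ gridEnd N e := by
    have := two_mul_threshold_lt_gridEnd hε hε1 hN
    exact_mod_cast (show threshold ε N ≤ gridEnd N (ε / 3) by omega)
  have hone : 1 ≤ (gridEnd N e : ℝ) / threshold ε N := by rw [le_div_iff₀ hT0]; linarith
  have hy : 0 < √e := by positivity
  have hye : √e ^ 2 = e := Real.sq_sqrt he0.le
  have hy1 : √e ≤ 1 := Real.sqrt_le_one.2 (by linarith)
  have hupper : (gridEnd N e : ℝ) / threshold ε N ≤ 27 * (1 / e) ^ 2 := by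
    rw [div_le_iff₀ hT0]
    have h1 : √(N : ℝ) * √e ≤ threshold ε N := by
      rw [← Real.sqrt_mul (by positivity)]
      refine le_trans (Real.sqrt_le_sqrt ?_) (Nat.le_ceil _)
      rw [min_eq_left hε1, he]
      gcongr
      linarith
    have h2 : (gridEnd N e : ℝ) ≤ 10 * √(N : ℝ) / (e * √e) + 1 := by
      refine (Nat.ceil_lt_add_one (by positivity)).le.trans (le_of_eq ?_)
      have : √(e ^ 3) = e * √e := by
        rw [show e ^ 3 = e ^ 2 * e by ring, Real.sqrt_mul (by positivity), Real.sqrt_sq he0.le]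
      rw [Real.sqrt_div (by positivity), this, mul_div_assoc]
    have h3 : 1 ≤ √(N : ℝ) / (e * √e) := by
      rw [le_div_iff₀ (by positivity)]
      nlinarith
    calc (gridEnd N e : ℝ) ≤ 11 * (√(N : ℝ) / (e * √e)) := by
          rw [mul_div_assoc] at h2
          linarith
      _ = 11 * (1 / e) ^ 2 * (√(N : ℝ) * √e) := by
          have : e * √e = e ^ 2 / √e := by
            rw [eq_div_iff hy.ne']
            nlinarith
          rw [this]
          field_simp
      _ ≤ 27 * (1 / e) ^ 2 * threshold ε N := by
          gcongr
          norm_num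
  have hΛ : Real.log 3 ≤ Real.log (1 / e) := by
    refine Real.log_le_log (by norm_num) ?_
    rw [le_div_iff₀ he0]
    linarith
  have hlog : Real.log ((gridEnd N e : ℝ) / threshold ε N) ≤ 5 * Real.log (1 / e) := by
    refine (Real.log_le_log (by linarith) hupper).trans ?_
    rw [Real.log_mul (by norm_num) (by positivity), Real.log_pow,
      show (27 : ℝ) = 3 ^ 3 by norm_num, Real.log_pow]
    push_cast
    linarith
  have hlog0 : 0 ≤ Real.log ((gridEnd N e : ℝ) / threshold ε N) := Real.log_nonneg hone
  have hb := Real.one_sub_inv_le_log_of_pos (show 0 < 1 + q by linarith)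
  have hb' : q / (1 + q) ≤ Real.log (1 + q) := by
    refine le_trans (le_of_eq ?_) hb
    field_simp
    ring
  have hq1 : 0 < q / (1 + q) := by positivity
  have hΛ0 : 0 ≤ Real.log (1 / e) := by linarith [one_le_log_three]
  refine (Nat.floor_le (Real.logb_nonneg (by linarith) hone)).trans ?_
  rw [Real.logb]
  calc _ ≤ 5 * Real.log (1 / e) / (q / (1 + q)) := by gcongr
    _ = _ := by field_simp; ring

theorem phi_sub_min_le (h : AnonHist) (m : ℕ) :
    phi (fun y => (y : ℝ) - (min y m : ℕ)) h.counts ≤ if m < h.total then (h.total : ℝ) else 0 := by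
  split_ifs with hm
  · rw [AnonHist.total, ← phi_cast]
    exact phi_mono fun y _ => sub_le_self _ (Nat.cast_nonneg _)
  · have : phi (fun y => (y : ℝ) - (min y m : ℕ)) h.counts ≤ phi (fun _ => 0) h.counts := by
      refine phi_mono fun y hy => ?_
      have : y ≤ h.total := Multiset.single_le_sum (fun _ _ => Nat.zero_le _) _ hy
      rw [min_eq_left (by omega), sub_self]
    refine this.trans (le_of_eq ?_)
    simp [phi]

/-- In the high privacy regime the expected error is of order
`√(log (1/ε) / ε) (√N + n² / N^{3/2})`, unless the noisy number of items is too small. -/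
theorem lintegral_cost_high_le {ε : ℝ} (hε : 0 < ε) (hε1 : ε ≤ 1) (h : AnonHist) {N : ℕ}
    (hN : N ≠ 0) {g : ℕ → ℝ} (hg : UnitLip g) (hn : highFactor ε ^ 2 ≤ 16 * h.total) :
    ∫⁻ o, ENNReal.ofReal |phi g o.1.counts - phi g h.counts| ∂(givenLaw ε h N) ≤
      ENNReal.ofReal ((if 2 * N < h.total then (h.total : ℝ) else 0) +
        400 * highFactor ε * rate h.total N) := by
  set e := ε / 3 with he
  have he0 : 0 < e := by positivity
  have he1 : e ≤ 1 / 3 := by rw [he]; linarith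
  have hN' : (0 : ℝ) < N := by exact_mod_cast Nat.pos_of_ne_zero hN
  have hs := one_le_sqrt_natCast hN
  have hs2 : √(N : ℝ) ^ 2 = N := Real.sq_sqrt (by positivity)
  have hy : 0 < √e := by positivity
  have hye : √e ^ 2 = e := Real.sq_sqrt he0.le
  have hΛ : 1 ≤ Real.log (1 / e) := by
    refine one_le_log_three.trans (Real.log_le_log (by norm_num) ?_)
    rw [le_div_iff₀ he0]
    linarith
  have hr : 0 < highFactor ε := Real.sqrt_pos.2 (by positivity)
  have hr2 : highFactor ε ^ 2 * e = Real.log (1 / e) := by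
    rw [highFactor, ← he, Real.sq_sqrt (by positivity), div_mul_cancel₀ _ he0.ne']
  have hq : gridRatio N e = highFactor ε / √(N : ℝ) := by
    rw [gridRatio, highFactor, ← Real.sqrt_div (by positivity), div_div, mul_comm (N : ℝ)]
  have hT' := le_gridEnd he0 N
  have hT'0 : (0 : ℝ) < gridEnd N e := lt_of_lt_of_le (by positivity) hT'
  have ha0 := (Real.exp_pos (-e)).le
  have ha1 : Real.exp (-e) < 1 := Real.exp_lt_one_iff.2 (by linarith)
  have hP : ∫⁻ z, (if gridEnd N e ≤ 2 * z.natAbs then 1 else 0)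
      ∂twoSidedGeometric (Real.exp (-(ε / 3))) ≤ ENNReal.ofReal (e / √(N : ℝ) ^ 2) := by
    have h1 := lintegral_le_natAbs_le ha0 ha1 (half_pos hT'0)
    refine le_trans (le_of_eq ?_) (h1.trans (ENNReal.ofReal_le_ofReal ?_))
    · congr 1 with z
      refine if_congr ?_ rfl rfl
      rw [div_le_iff₀ two_pos, mul_comm]
      exact_mod_cast Iff.rfl
    · have h2 : (10 * √(N : ℝ) / (e * √e)) ^ 2 ≤ (gridEnd N e : ℝ) ^ 2 := by gcongr
      calc noiseVar (Real.exp (-e)) / ((gridEnd N e : ℝ) / 2) ^ 2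
          ≤ (8 / e ^ 2) / ((10 * √(N : ℝ) / (e * √e)) / 2) ^ 2 := by
            have := noiseVar_exp_le he0 he1
            gcongr
        _ = 8 / 25 * (√e ^ 2 / √(N : ℝ) ^ 2) := by field_simp; norm_num
        _ ≤ 1 * (e / √(N : ℝ) ^ 2) := by
            rw [hye]
            gcongr
            norm_num
        _ = _ := one_mul _
  refine (lintegral_cost_high hε hε1 h hN hg rfl rfl rfl rfl rfl rfl rfl
    (show 0 ≤ 5 / e by positivity) (show 0 ≤ e / √(N : ℝ) ^ 2 by positivity)
    (lintegral_natAbs_exp_le he0 he1) hP).trans (ENNReal.ofReal_le_ofReal ?_)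
  rw [add_assoc, add_assoc, add_assoc, add_assoc, ← he]
  refine add_le_add (phi_sub_min_le h _) ?_
  rw [← add_assoc, ← add_assoc, ← add_assoc]
  have hT1 : √(N : ℝ) * √e ≤ threshold ε N := by
    rw [← Real.sqrt_mul (by positivity)]
    refine le_trans (Real.sqrt_le_sqrt ?_) (Nat.le_ceil _)
    rw [min_eq_left hε1, he]
    gcongr
    linarith
  have hT2 : (threshold ε N : ℝ) ≤ 2 * √(N : ℝ) * √e + 1 := by
    refine (Nat.ceil_lt_add_one (Real.sqrt_nonneg _)).le.trans ?_
    gcongr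
    rw [min_eq_left hε1]
    refine Real.sqrt_le_iff.2 ⟨by positivity, ?_⟩
    rw [mul_pow, mul_pow, hs2, hye, he]
    nlinarith
  have hX : rate h.total N ≤ 4 * rate h.total N := by linarith [rate_nonneg h.total N]
  refine le_of_le_of_eq (high_cost_arith (X := 4 * rate h.total N) hs (by positivity) hy hye he1 hr
    hr2 hΛ hq (by positivity) (by exact_mod_cast largeCard_mul_le h _) hT1 hT2 hT' ?_ ?_ ?_
    ((sqrt_le_rate _ _).trans hX) ((div_sqrt_le_rate _ hN).trans hX) ?_) (by ring)
  · refine (floor_logb_le hε hε1 hN).trans (le_of_eq ?_)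
    rw [← he, hq, one_div_div (highFactor ε)]
  · refine (fakeCount_le hε hN).trans ?_
    have e1 : 12 * (√(N : ℝ) - 1) / ε + 3 / ε = 4 * √(N : ℝ) / e - 3 / e := by
      rw [show ε = 3 * e by rw [he]; ring]
      field_simp
      ring
    have : 0 < 3 / e := by positivity
    linarith
  · refine (exp_pow_fakeCount_le hε hN).trans ?_
    rw [show √(N : ℝ) ^ 4 = (√(N : ℝ) ^ 2) ^ 2 by ring, hs2]
    gcongr
    exact Real.exp_le_one_iff.2 (by linarith)
  · have h1 : highFactor ε ≤ √(16 * h.total) := (Real.le_sqrt' hr).2 hn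
    rw [Real.sqrt_mul (by norm_num), show (16 : ℝ) = 4 ^ 2 by norm_num,
      Real.sqrt_sq (by norm_num)] at h1
    linarith [sqrt_total_le_rate h.total hN]

/-! ### Linear estimators on samples -/

/-- The function of the counts whose sum over the histogram is the linear estimate. -/
def coeffFun (a : ℕ → ℕ → ℝ) (N r : ℕ) : ℝ := if r = 0 then 0 else a r N

theorem linearEstimate_eq_phi (a : ℕ → ℕ → ℝ) (N : ℕ) (h : AnonHist) :
    linearEstimate a N h = phi (coeffFun a N) h.counts := by
  rw [linearEstimate, phi, Finset.sum_multiset_map_count]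
  refine Finset.sum_congr rfl fun r hr => ?_
  have : r ≠ 0 := fun h0 => h.zero_notMem (h0 ▸ Multiset.mem_toFinset.1 hr)
  rw [coeffFun, if_neg this, AnonHist.prev, nsmul_eq_mul, mul_comm]

theorem unitLip_coeffFun {a : ℕ → ℕ → ℝ} {N : ℕ} {L : ℝ} (hL : 0 < L)
    (h : lipschitzConst a N ≤ ENNReal.ofReal L) : UnitLip fun r => coeffFun a N r / L := by
  refine ⟨by simp [coeffFun], fun r => ?_⟩
  rw [← sub_div, abs_div, abs_of_pos hL, div_le_one hL]
  rw [lipschitzConst, max_le_iff] at h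
  rcases Nat.eq_zero_or_pos r with rfl | hr
  · simpa [coeffFun] using (ENNReal.ofReal_le_ofReal_iff hL.le).1 h.1
  · rw [coeffFun, coeffFun, if_neg (by omega), if_neg (by omega), abs_sub_comm]
    exact (ENNReal.ofReal_le_ofReal_iff hL.le).1 ((le_iSup₂_of_le r hr le_rfl).trans h.2)

theorem phi_histOf {X : Type*} [Fintype X] {g : ℕ → ℝ} (hg : g 0 = 0) (D : X →₀ ℕ) :
    phi g (histOf D).counts = ∑ j, g (D j) := by
  rw [phi, histOf, Multiset.map_map]
  change ∑ j ∈ D.support, g (D j) = _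
  refine Finset.sum_subset (Finset.subset_univ _) fun j _ hj => ?_
  rw [Finsupp.notMem_support_iff.1 hj, hg]

theorem sampleCounts_cons {k n : ℕ} (j : Fin k) (x : Fin n → Fin k) :
    sampleCounts (Fin.cons j x : Fin (n + 1) → Fin k) = Finsupp.single j 1 + sampleCounts x := by
  simp [sampleCounts, Fin.sum_univ_succ]

theorem total_histOf_sampleCounts {k n : ℕ} (x : Fin n → Fin k) :
    (histOf (sampleCounts x)).total = n := by
  have h := phi_histOf (g := fun r => (r : ℝ)) (by simp) (sampleCounts x)
  rw [phi_cast] at h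
  have h1 : ∑ j, sampleCounts x j = n := by
    simp only [sampleCounts, Finsupp.finsetSum_apply]
    rw [Finset.sum_comm]
    simp [Finsupp.single_apply]
  rw [AnonHist.total]
  have : ((histOf (sampleCounts x)).counts.sum : ℝ) = ((∑ j, sampleCounts x j : ℕ) : ℝ) := by
    rw [h]
    push_cast
    rfl
  rw [Nat.cast_inj.1 this, h1]

/-- The mean of `F` over `n` independent samples from `p`. -/
noncomputable def sampleMean {k : ℕ} (p : Fin k → ℝ) (n : ℕ) (F : (Fin n → Fin k) → ℝ≥0∞) : ℝ≥0∞ :=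
  ∑ x, ENNReal.ofReal (∏ i, p (x i)) * F x

theorem sampleMean_mono {k : ℕ} (p : Fin k → ℝ) {n : ℕ} {F F' : (Fin n → Fin k) → ℝ≥0∞}
    (h : ∀ x, F x ≤ F' x) : sampleMean p n F ≤ sampleMean p n F' :=
  Finset.sum_le_sum fun x _ => mul_le_mul_right (h x) _

theorem sampleMean_add {k : ℕ} (p : Fin k → ℝ) {n : ℕ} (F F' : (Fin n → Fin k) → ℝ≥0∞) :
    sampleMean p n (fun x => F x + F' x) = sampleMean p n F + sampleMean p n F' := by
  simp only [sampleMean, mul_add, Finset.sum_add_distrib]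

theorem sum_ofReal_simplex {k : ℕ} {p : Fin k → ℝ} (hp : p ∈ stdSimplex ℝ (Fin k)) :
    ∑ j, ENNReal.ofReal (p j) = 1 := by
  rw [← ENNReal.ofReal_sum_of_nonneg fun j _ => hp.1 j, hp.2, ENNReal.ofReal_one]

theorem sampleMean_succ {k : ℕ} {p : Fin k → ℝ} (hp : p ∈ stdSimplex ℝ (Fin k)) {n : ℕ}
    (F : (Fin (n + 1) → Fin k) → ℝ≥0∞) :
    sampleMean p (n + 1) F =
      ∑ j, ENNReal.ofReal (p j) * sampleMean p n fun x => F (Fin.cons j x) := by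
  rw [sampleMean, ← (Fin.consEquiv fun _ : Fin (n + 1) => Fin k).sum_comp, Fintype.sum_prod_type]
  refine Finset.sum_congr rfl fun j _ => ?_
  rw [sampleMean, Finset.mul_sum]
  refine Finset.sum_congr rfl fun x _ => ?_
  simp only [Fin.consEquiv_apply]
  rw [Fin.prod_univ_succ, ENNReal.ofReal_mul (by simpa using hp.1 j), mul_assoc]
  simp
  rfl

theorem sampleMean_const {k : ℕ} {p : Fin k → ℝ} (hp : p ∈ stdSimplex ℝ (Fin k)) (n : ℕ)
    (c : ℝ≥0∞) : sampleMean p n (fun _ => c) = c := by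
  induction n with
  | zero => simp [sampleMean]
  | succ n ih => rw [sampleMean_succ hp]; simp only [ih]; rw [← Finset.sum_mul, sum_ofReal_simplex hp, one_mul]

/-- The expected error on `n` samples of the linear estimate with the coefficients for `N`. -/
noncomputable def fixedError {k : ℕ} (f : (Fin k → ℝ) → ℝ) (a : ℕ → ℕ → ℝ) (N : ℕ) (p : Fin k → ℝ)
    (n : ℕ) : ℝ≥0∞ :=
  sampleMean p n fun x => ENNReal.ofReal |f p - linearEstimate a N (histOf (sampleCounts x))|

/-- One more sample changes one count by one. -/
theorem abs_linearEstimate_cons_sub_le {a : ℕ → ℕ → ℝ} {N : ℕ} {L : ℝ} (hL : 0 < L)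
    (h : lipschitzConst a N ≤ ENNReal.ofReal L) {k n : ℕ} (j : Fin k) (x : Fin n → Fin k) :
    |linearEstimate a N (histOf (sampleCounts (Fin.cons j x : Fin (n + 1) → Fin k))) -
      linearEstimate a N (histOf (sampleCounts x))| ≤ L := by
  have hg := unitLip_coeffFun hL h
  have h0 : coeffFun a N 0 = 0 := by simp [coeffFun]
  rw [linearEstimate_eq_phi, linearEstimate_eq_phi, phi_histOf h0, phi_histOf h0,
    ← Finset.sum_sub_distrib, sampleCounts_cons, Finset.sum_eq_single j]
  · have := hg.2 (sampleCounts x j)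
    rw [← sub_div, abs_div, abs_of_pos hL, div_le_one hL] at this
    simpa [add_comm] using this
  · intro i _ hi
    simp [hi.symm]
  · simp

theorem fixedError_succ_le {k : ℕ} {f : (Fin k → ℝ) → ℝ} {a : ℕ → ℕ → ℝ} {N : ℕ} {L : ℝ}
    (hL : 0 < L) (h : lipschitzConst a N ≤ ENNReal.ofReal L) {p : Fin k → ℝ}
    (hp : p ∈ stdSimplex ℝ (Fin k)) (n : ℕ) :
    fixedError f a N p (n + 1) ≤ fixedError f a N p n + ENNReal.ofReal L ∧
      fixedError f a N p n ≤ fixedError f a N p (n + 1) + ENNReal.ofReal L := by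
  have key : ∀ u v w : ℝ, |v - w| ≤ L →
      ENNReal.ofReal |u - v| ≤ ENNReal.ofReal |u - w| + ENNReal.ofReal L := by
    intro u v w hvw
    rw [← ENNReal.ofReal_add (abs_nonneg _) hL.le]
    refine ENNReal.ofReal_le_ofReal ?_
    have := abs_sub_le u w v
    rw [abs_sub_comm w v] at this
    linarith
  have hsum : ∀ c : ℝ≥0∞, ∑ j, ENNReal.ofReal (p j) * c = c := fun c => by
    rw [← Finset.sum_mul, sum_ofReal_simplex hp, one_mul]
  constructor
  · rw [fixedError, sampleMean_succ hp, ← hsum (fixedError f a N p n + ENNReal.ofReal L)]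
    refine Finset.sum_le_sum fun j _ => mul_le_mul_right ?_ _
    rw [fixedError, ← sampleMean_const hp n (ENNReal.ofReal L), ← sampleMean_add]
    exact sampleMean_mono _ fun x => by
      exact key _ _ _ (abs_linearEstimate_cons_sub_le hL h j x)
  · rw [← hsum (fixedError f a N p n), ← hsum (ENNReal.ofReal L), fixedError, fixedError,
      sampleMean_succ hp, ← Finset.sum_add_distrib]
    refine Finset.sum_le_sum fun j _ => ?_
    rw [← mul_add]
    refine mul_le_mul_right ?_ _
    rw [← sampleMean_const hp n (ENNReal.ofReal L), ← sampleMean_add]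
    exact sampleMean_mono _ fun x => by
      refine key _ _ _ ?_
      rw [abs_sub_comm]
      exact abs_linearEstimate_cons_sub_le hL h j x

/-- A mismatch between the number of samples and the index of the coefficients costs at most the
Lipschitz constant per sample. -/
theorem fixedError_le {k : ℕ} {f : (Fin k → ℝ) → ℝ} {a : ℕ → ℕ → ℝ} {N : ℕ} {L : ℝ}
    (hL : 0 < L) (h : lipschitzConst a N ≤ ENNReal.ofReal L) {p : Fin k → ℝ}
    (hp : p ∈ stdSimplex ℝ (Fin k)) (n m : ℕ) :
    fixedError f a N p n ≤ fixedError f a N p m + ENNReal.ofReal (Nat.dist n m * L) := by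
  have hstep : ∀ d : ℕ, ENNReal.ofReal ((d + 1 : ℕ) * L) =
      ENNReal.ofReal (d * L) + ENNReal.ofReal L := fun d => by
    rw [← ENNReal.ofReal_add (by positivity) hL.le]
    congr 1
    push_cast
    ring
  have up : ∀ n d : ℕ, fixedError f a N p (n + d) ≤
      fixedError f a N p n + ENNReal.ofReal (d * L) := by
    intro n d
    induction d with
    | zero => simp
    | succ d ih =>
      rw [hstep, ← add_assoc (fixedError f a N p n)]
      exact (fixedError_succ_le hL h hp (n + d)).1.trans (add_le_add_left ih _)
  have down : ∀ n d : ℕ, fixedError f a N p n ≤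
      fixedError f a N p (n + d) + ENNReal.ofReal (d * L) := by
    intro n d
    induction d with
    | zero => simp
    | succ d ih =>
      rw [hstep, add_comm (ENNReal.ofReal _), ← add_assoc]
      exact ih.trans (add_le_add_left (fixedError_succ_le hL h hp (n + d)).2 _)
  rcases le_total n m with hnm | hnm
  · obtain ⟨d, rfl⟩ := Nat.exists_eq_add_of_le hnm
    rw [Nat.dist_eq_sub_of_le hnm, Nat.add_sub_cancel_left]
    exact down n d
  · obtain ⟨d, rfl⟩ := Nat.exists_eq_add_of_le hnm
    rw [Nat.dist_eq_sub_of_le_right hnm, Nat.add_sub_cancel_left]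
    exact up m d

theorem fixedError_self_le {k : ℕ} {f : (Fin k → ℝ) → ℝ} {a : ℕ → ℕ → ℝ} {N : ℕ} {E : ℝ≥0∞}
    (h : worstError f (linearEstimator a) N ≤ E) {p : Fin k → ℝ}
    (hp : p ∈ stdSimplex ℝ (Fin k)) : fixedError f a N p N ≤ E := by
  refine le_trans (le_of_eq ?_) ((le_iSup₂_of_le p hp le_rfl).trans h)
  rw [fixedError, sampleMean, expectedError]
  refine Finset.sum_congr rfl fun x _ => ?_
  rw [linearEstimator, lintegral_dirac' _ (by fun_prop), total_histOf_sampleCounts]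

theorem fixedError_zero {k : ℕ} (f : (Fin k → ℝ) → ℝ) (a : ℕ → ℕ → ℝ) (N : ℕ) (p : Fin k → ℝ) :
    fixedError f a N p 0 = ENNReal.ofReal |f p| := by
  rw [fixedError, sampleMean]
  simp [sampleCounts, linearEstimate_eq_phi, histOf]

/-- A property with an error bound is bounded, as it can be estimated from one sample. -/
theorem abs_le_propertyMax {k : ℕ} {f : (Fin k → ℝ) → ℝ} {a : ℕ → ℕ → ℝ} {E : ℝ}
    (hL : lipschitzConst a 1 ≤ ENNReal.ofReal 1)
    (h : worstError f (linearEstimator a) 1 ≤ ENNReal.ofReal E) {p : Fin k → ℝ}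
    (hp : p ∈ stdSimplex ℝ (Fin k)) : |f p| ≤ propertyMax f := by
  refine le_ciSup (f := fun p : stdSimplex ℝ (Fin k) => |f p|) ⟨max E 0 + 1, ?_⟩ ⟨p, hp⟩
  rintro _ ⟨⟨p, hp⟩, rfl⟩
  have h1 := (fixedError_le (f := f) one_pos hL hp 0 1).trans
    (add_le_add_left (fixedError_self_le h hp) _)
  rw [fixedError_zero] at h1
  have h2 : ENNReal.ofReal E ≤ ENNReal.ofReal (max E 0) := ENNReal.ofReal_le_ofReal (le_max_left _ _)
  have h3 := h1.trans (add_le_add_left h2 _)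
  rw [← ENNReal.ofReal_add (le_max_right _ _) (by positivity),
    ENNReal.ofReal_le_ofReal_iff (by positivity)] at h3
  have h4 : |f p| ≤ max E 0 + 1 := by simpa [Nat.dist] using h3
  exact h4

/-! ### The error of the plug-in estimator -/

theorem lintegral_const_outputLaw_le (ε : ℝ) (hε : 0 < ε) (h : AnonHist) {T M N : ℕ} (hT : 0 < T)
    (hN : N ≠ 0) (cs : Fin T → ℤ) (cl : Multiset ℤ) (c : ℝ≥0∞) :
    ∫⁻ _, c ∂(outputLaw ε h T M N cs cl) ≤ c := by
  unfold outputLaw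
  split_ifs
  · rw [lintegral_dirac]
  · refine (lintegral_map_le _ _).trans ?_
    rw [highPrivacy]
    refine (lintegral_map_le _ _).trans ?_
    set S := boundaries cl T N (ε / 3) with hS
    have h0 : 0 ∉ S := zero_notMem_boundaries (by positivity) hT hN cl
    have hprob : ∀ i, IsProbabilityMeasure (laplace (1 / (ε / 3 * boundaryGap S i))) := fun i =>
      isProbabilityMeasure_laplace (by have := boundaryGap_pos h0 i; positivity)
    rw [lintegral_const, measure_univ, mul_one]

theorem lintegral_const_givenLaw_le {ε : ℝ} (hε : 0 < ε) (h : AnonHist) {N : ℕ} (hN : N ≠ 0)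
    (c : ℝ≥0∞) : ∫⁻ _, c ∂(givenLaw ε h N) ≤ c := by
  have ha0 := (Real.exp_pos (-(ε / 3))).le
  have ha1 : Real.exp (-(ε / 3)) < 1 := Real.exp_lt_one_iff.2 (by linarith)
  have := isProbabilityMeasure_twoSidedGeometric ha0 ha1
  rw [lintegral_givenLaw ε h hN]
  refine (lintegral_mono fun z => ?_).trans (le_of_eq (lintegral_const_geometric ha0 ha1 c))
  simp only
  rw [lintegral_splitLaw]
  refine (lintegral_mono fun zs => (lintegral_mono fun zl =>
    lintegral_const_outputLaw_le ε hε h (threshold_pos hε hN) hN _ _ c)).trans ?_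
  simp only [lintegral_const, measure_univ, mul_one, le_refl]

/-- The error given the noisy number of items: the error of the non-private estimate with the
coefficients for `N`, and the cost of the private histogram. -/
theorem lintegral_givenLaw_error_le {ε : ℝ} (hε : 0 < ε) (h : AnonHist) {N : ℕ} (hN : N ≠ 0)
    {a : ℕ → ℕ → ℝ} {L : ℝ} (hL : 0 < L) (ha : lipschitzConst a N ≤ ENNReal.ofReal L) {K : ℝ}
    (hK : ∀ g, UnitLip g → ∫⁻ o, ENNReal.ofReal |phi g o.1.counts - phi g h.counts|
      ∂(givenLaw ε h N) ≤ ENNReal.ofReal K) (y : ℝ) :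
    ∫⁻ o, ENNReal.ofReal |y - linearEstimate a o.2 o.1| ∂(givenLaw ε h N) ≤
      ENNReal.ofReal |y - linearEstimate a N h| + ENNReal.ofReal (L * K) := by
  set g : ℕ → ℝ := fun r => coeffFun a N r / L with hg
  have hphi : ∀ s, phi (coeffFun a N) s = L * phi g s := fun s => by
    rw [← phi_const_mul]
    congr 1
    funext r
    rw [hg]
    field_simp
  refine (lintegral_givenLaw_mono hN (F' := fun o => ENNReal.ofReal |y - linearEstimate a N h| +
    ENNReal.ofReal L * ENNReal.ofReal |phi g o.1.counts - phi g h.counts|) fun H => ?_).trans ?_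
  · rw [← ENNReal.ofReal_mul hL.le, ← ENNReal.ofReal_add (abs_nonneg _) (by positivity)]
    refine ENNReal.ofReal_le_ofReal ?_
    have h1 := abs_sub_le y (linearEstimate a N h) (linearEstimate a N H)
    refine h1.trans (add_le_add le_rfl (le_of_eq ?_))
    rw [linearEstimate_eq_phi, linearEstimate_eq_phi, hphi, hphi, ← mul_sub, abs_mul,
      abs_of_pos hL, abs_sub_comm]
  · rw [lintegral_add_left .of_discrete, lintegral_const_mul _ .of_discrete, ENNReal.ofReal_mul hL.le]
    exact add_le_add (lintegral_const_givenLaw_le hε h hN _)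
      (mul_le_mul_right (hK g (unitLip_coeffFun hL ha)) _)

/-! ### Error in terms of the noise of the number of items -/

/-- The increments of the error bound are largest at the smaller sample size, as `β < 1`. -/
theorem abs_err_sub_le {err : ℕ → ℝ} {β : ℝ} (hβ : β < 1 / 2)
    (h : ∀ n : ℕ, 1 ≤ n → |err n - err (n + 1)| ≤ (n : ℝ) ^ (β - 1)) {n m : ℕ} (hn : 1 ≤ n)
    (hm : 1 ≤ m) : |err n - err m| ≤ Nat.dist n m * ((min n m : ℕ) : ℝ) ^ (β - 1) := by
  have key : ∀ n d : ℕ, 1 ≤ n → |err n - err (n + d)| ≤ d * (n : ℝ) ^ (β - 1) := by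
    intro n d hn
    have hn' : (0 : ℝ) < n := by exact_mod_cast hn
    induction d with
    | zero => simp
    | succ d ih =>
      have h1 := h (n + d) (by omega)
      have h2 : ((n + d : ℕ) : ℝ) ^ (β - 1) ≤ (n : ℝ) ^ (β - 1) :=
        Real.rpow_le_rpow_of_nonpos hn' (by push_cast; linarith [Nat.cast_nonneg (α := ℝ) d])
          (by linarith)
      have h3 := abs_sub_le (err n) (err (n + d)) (err (n + d + 1))
      push_cast
      rw [← add_assoc]
      linarith
  rcases le_total n m with hnm | hnm
  · obtain ⟨d, rfl⟩ := Nat.exists_eq_add_of_le hnm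
    rw [Nat.dist_eq_sub_of_le hnm, Nat.add_sub_cancel_left, min_eq_left hnm]
    exact key n d hn
  · obtain ⟨d, rfl⟩ := Nat.exists_eq_add_of_le hnm
    rw [Nat.dist_eq_sub_of_le_right hnm, Nat.add_sub_cancel_left, min_eq_right hnm, abs_sub_comm]
    exact key m d hm

theorem rpow_le_of_le_two_mul {n N : ℕ} (hn : 1 ≤ n) (hN : n ≤ 2 * N) {x : ℝ} (hx : x ≤ 0) :
    (N : ℝ) ^ x ≤ 2 ^ (-x) * (n : ℝ) ^ x := by
  have hn' : (0 : ℝ) < n := by exact_mod_cast hn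
  have h2 : (n : ℝ) / 2 ≤ N := by
    have : (n : ℝ) ≤ 2 * N := by exact_mod_cast hN
    linarith
  refine (Real.rpow_le_rpow_of_nonpos (by positivity) h2 hx).trans (le_of_eq ?_)
  rw [Real.div_rpow hn'.le two_pos.le, Real.rpow_neg two_pos.le, div_eq_inv_mul]

/-- For `N ≥ n / 2`, the Lipschitz constant for `N` times the rate is of order `n ^ (β - 1/2)`;
if `N` is much larger than `n`, this holds because both `β - 1/2` and `β - 1` are negative. -/
theorem rpow_mul_rate_le {n N : ℕ} (hn : 1 ≤ n) (hN : n ≤ 2 * N) {β : ℝ} (hβ : β < 1 / 2) :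
    (N : ℝ) ^ (β - 1) * rate n N ≤ 2 ^ (4 - β) * (n : ℝ) ^ (β - 1 / 2) := by
  have hn' : (0 : ℝ) < n := by exact_mod_cast hn
  have hN' : (0 : ℝ) < N := by exact_mod_cast (show 0 < N by omega)
  have e1 : (N : ℝ) ^ (β - 1) * √(N : ℝ) = (N : ℝ) ^ (β - 1 / 2) := by
    rw [Real.sqrt_eq_rpow, ← Real.rpow_add hN']
    congr 1
    ring
  have e2 : (N : ℝ) ^ (β - 1) * ((n : ℝ) ^ 2 / √(N : ℝ) ^ 3) =
      (n : ℝ) ^ 2 * (N : ℝ) ^ (β - 5 / 2) := by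
    have : √(N : ℝ) ^ 3 = (N : ℝ) ^ (3 / 2 : ℝ) := by
      rw [Real.sqrt_eq_rpow, ← Real.rpow_natCast, ← Real.rpow_mul hN'.le]
      norm_num
    rw [this, show β - 5 / 2 = (β - 1) - 3 / 2 by ring, Real.rpow_sub hN' (β - 1)]
    ring
  have e3 : (n : ℝ) ^ 2 * (n : ℝ) ^ (β - 5 / 2) = (n : ℝ) ^ (β - 1 / 2) := by
    rw [← Real.rpow_natCast, ← Real.rpow_add hn']
    congr 1
    push_cast
    ring
  have e4 : (2 : ℝ) ^ (4 - β) = 2 ^ (3 - β) + 2 ^ (3 - β) := by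
    rw [show (4 - β) = (3 - β) + 1 by ring, Real.rpow_add two_pos, Real.rpow_one]
    ring
  have h1 := rpow_le_of_le_two_mul hn hN (show β - 1 / 2 ≤ 0 by linarith)
  have h2 := rpow_le_of_le_two_mul hn hN (show β - 5 / 2 ≤ 0 by linarith)
  have h3 : (2 : ℝ) ^ (-(β - 1 / 2)) ≤ 2 ^ (3 - β) :=
    Real.rpow_le_rpow_of_exponent_le (by norm_num) (by linarith)
  have h4 : (2 : ℝ) ^ (-(β - 5 / 2)) ≤ 2 ^ (3 - β) :=
    Real.rpow_le_rpow_of_exponent_le (by norm_num) (by linarith)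
  rw [rate, mul_add, e1, e2, e4, add_mul]
  refine add_le_add (h1.trans (by gcongr)) ?_
  calc (n : ℝ) ^ 2 * (N : ℝ) ^ (β - 5 / 2) ≤
        (n : ℝ) ^ 2 * (2 ^ (3 - β) * (n : ℝ) ^ (β - 5 / 2)) := by
        gcongr
        exact h2.trans (by gcongr)
    _ = 2 ^ (3 - β) * ((n : ℝ) ^ 2 * (n : ℝ) ^ (β - 5 / 2)) := by ring
    _ = _ := by rw [e3]

/-- The error terms for a given noisy number `N` of items. If `N` is of the order of `n`, it can be
replaced by `n`; otherwise a polynomial bound suffices, as this is unlikely. -/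
theorem error_terms_le {n N : ℕ} (hn : 1 ≤ n) (hN : 1 ≤ N) {β B : ℝ} (hβ : β < 1 / 2) (hB : 0 ≤ B) :
    (Nat.dist n N : ℝ) * ((min n N : ℕ) : ℝ) ^ (β - 1) + Nat.dist n N * (N : ℝ) ^ (β - 1) +
      (N : ℝ) ^ (β - 1) * ((if 2 * N < n then (n : ℝ) else 0) + B * rate n N) ≤
    2 ^ (4 - β) * (n : ℝ) ^ (β - 1) * Nat.dist n N + 2 ^ (4 - β) * B * (n : ℝ) ^ (β - 1 / 2) +
      (if 2 * N < n then (3 + 2 * B) * (n : ℝ) ^ 2 else 0) := by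
  have hn' : (1 : ℝ) ≤ n := by exact_mod_cast hn
  have hN' : (1 : ℝ) ≤ N := by exact_mod_cast hN
  split_ifs with h
  · have hd : (Nat.dist n N : ℝ) ≤ n := by
      have : Nat.dist n N ≤ n := by
        rw [Nat.dist]
        omega
      exact_mod_cast this
    have hNn : (N : ℝ) ≤ n := by exact_mod_cast (show N ≤ n by omega)
    have h1 : (N : ℝ) ^ (β - 1) ≤ 1 := Real.rpow_le_one_of_one_le_of_nonpos hN' (by linarith)
    have h0 : 0 ≤ (N : ℝ) ^ (β - 1) := by positivity
    have hn2 : (n : ℝ) ≤ n ^ 2 := by nlinarith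
    have hrate : rate n N ≤ 2 * (n : ℝ) ^ 2 := by
      have hs := one_le_sqrt_natCast (show N ≠ 0 by omega)
      have hs2 : √(N : ℝ) ≤ N := by
        rw [Real.sqrt_le_left (by linarith)]
        nlinarith
      have h3 : (n : ℝ) ^ 2 / √(N : ℝ) ^ 3 ≤ n ^ 2 :=
        div_le_self (by positivity) (one_le_pow₀ hs)
      rw [rate]
      linarith
    have hr0 := rate_nonneg n N
    rw [min_eq_right (by omega)]
    have t1 : (Nat.dist n N : ℝ) * (N : ℝ) ^ (β - 1) ≤ n ^ 2 :=
      (mul_le_of_le_one_right (Nat.cast_nonneg _) h1).trans (hd.trans hn2)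
    have t2 : (N : ℝ) ^ (β - 1) * ((n : ℝ) + B * rate n N) ≤ n ^ 2 + B * (2 * n ^ 2) :=
      (mul_le_of_le_one_left (by positivity) h1).trans (by gcongr)
    have : 0 ≤ 2 ^ (4 - β) * (n : ℝ) ^ (β - 1) * Nat.dist n N +
        2 ^ (4 - β) * B * (n : ℝ) ^ (β - 1 / 2) := by positivity
    linarith
  · rw [zero_add, add_zero]
    have h1 := rpow_le_of_le_two_mul hn (show n ≤ 2 * N by omega) (show β - 1 ≤ 0 by linarith)
    have h2 := rpow_le_of_le_two_mul (N := min n N) hn (by omega) (show β - 1 ≤ 0 by linarith)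
    have h3 : (2 : ℝ) ^ (-(β - 1)) + 2 ^ (-(β - 1)) ≤ 2 ^ (4 - β) := by
      have : (2 : ℝ) ^ (2 - β) = 2 ^ (-(β - 1)) + 2 ^ (-(β - 1)) := by
        rw [show (2 - β) = -(β - 1) + 1 by ring, Real.rpow_add two_pos, Real.rpow_one]
        ring
      rw [← this]
      exact Real.rpow_le_rpow_of_exponent_le (by norm_num) (by linarith)
    have h4 := rpow_mul_rate_le hn (show n ≤ 2 * N by omega) hβ
    have hd : (0 : ℝ) ≤ Nat.dist n N := Nat.cast_nonneg _
    refine add_le_add ?_ ?_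
    · calc _ ≤ (Nat.dist n N : ℝ) * (2 ^ (-(β - 1)) * (n : ℝ) ^ (β - 1)) +
            Nat.dist n N * (2 ^ (-(β - 1)) * (n : ℝ) ^ (β - 1)) := by gcongr
        _ = (2 ^ (-(β - 1)) + 2 ^ (-(β - 1))) * (n : ℝ) ^ (β - 1) * Nat.dist n N := by ring
        _ ≤ _ := by gcongr
    · calc (N : ℝ) ^ (β - 1) * (B * rate n N) = B * ((N : ℝ) ^ (β - 1) * rate n N) := by ring
        _ ≤ B * (2 ^ (4 - β) * (n : ℝ) ^ (β - 1 / 2)) := by gcongr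
        _ = _ := by ring

/-- The expected error of the plug-in estimator, for a mechanism whose cost is at most `B` times
`rate`. -/
theorem expectedError_privateEstimator_le {ε β α B V : ℝ} (hε : 0 < ε) (hβ : β < 1 / 2)
    (hα : 0 ≤ α) (hB : 0 ≤ B) (hV0 : 0 ≤ V) {k : ℕ} {f : (Fin k → ℝ) → ℝ} {a : ℕ → ℕ → ℝ}
    (hL : ∀ n : ℕ, 1 ≤ n → lipschitzConst a n ≤ ENNReal.ofReal ((n : ℝ) ^ (β - 1))) {err : ℕ → ℝ}
    (herr : ∀ n : ℕ, 1 ≤ n → worstError f (linearEstimator a) n ≤ ENNReal.ofReal (err n))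
    (hvar : ∀ n : ℕ, 1 ≤ n → |err n - err (n + 1)| ≤ (n : ℝ) ^ (β - 1)) {n : ℕ} (hn : 1 ≤ n)
    (hnα : err n ≤ α) {t : ℝ} (ht : t = Real.exp (-(ε / 3)))
    (hV : ∫⁻ z, (z.natAbs : ℝ≥0∞) ∂twoSidedGeometric t ≤ ENNReal.ofReal V)
    (hcost : ∀ h : AnonHist, h.total = n → ∀ N : ℕ, N ≠ 0 → ∀ g, UnitLip g →
      ∫⁻ o, ENNReal.ofReal |phi g o.1.counts - phi g h.counts| ∂(givenLaw ε h N) ≤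
        ENNReal.ofReal ((if 2 * N < n then (n : ℝ) else 0) + B * rate n N))
    {p : Fin k → ℝ} (hp : p ∈ stdSimplex ℝ (Fin k)) :
    expectedError f (privateEstimator ε a) p n ≤
      ENNReal.ofReal (α + max (propertyMax f - α) 0 * (2 * t ^ n) +
        2 ^ (4 - β) * (V * (n : ℝ) ^ (β - 1) + B * (n : ℝ) ^ (β - 1 / 2)) +
        (3 + 2 * B) * (n : ℝ) ^ 2 * (2 * t ^ ((n + 1) / 2))) := by
  have ht0 : 0 ≤ t := ht ▸ (Real.exp_pos _).le
  have ht1 : t < 1 := by rw [ht, Real.exp_lt_one_iff]; linarith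
  have hprob := isProbabilityMeasure_twoSidedGeometric ht0 ht1
  have hn' : (0 : ℝ) < n := by exact_mod_cast hn
  set F : ℝ := max (propertyMax f - α) 0 with hF
  have hF0 : 0 ≤ F := le_max_right _ _
  have hfp : |f p| ≤ α + F := by
    have := abs_le_propertyMax (by simpa using hL 1 le_rfl) (herr 1 le_rfl) hp
    have := le_max_left (propertyMax f - α) 0
    linarith
  set c₁ : ℝ := 2 ^ (4 - β) * (n : ℝ) ^ (β - 1) with hc₁
  set c₂ : ℝ := 2 ^ (4 - β) * B * (n : ℝ) ^ (β - 1 / 2) with hc₂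
  set c₃ : ℝ := (3 + 2 * B) * (n : ℝ) ^ 2 with hc₃
  have hc₁0 : 0 ≤ c₁ := by positivity
  have hc₂0 : 0 ≤ c₂ := by positivity
  have hc₃0 : 0 ≤ c₃ := by positivity
  have e1 : expectedError f (privateEstimator ε a) p n = ∫⁻ z, sampleMean p n (fun x =>
      ∫⁻ o, ENNReal.ofReal |f p - linearEstimate a o.2 o.1|
        ∂(givenLaw ε (histOf (sampleCounts x)) (max ((n : ℤ) + z) 0).toNat))
      ∂twoSidedGeometric t := by
    simp only [sampleMean]
    rw [lintegral_finsetSum _ fun i _ => .of_discrete, expectedError]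
    refine Finset.sum_congr rfl fun x _ => ?_
    rw [lintegral_const_mul _ .of_discrete, privateEstimator,
      lintegral_map (by fun_prop) .of_discrete, lintegral_privHist, total_histOf_sampleCounts, ht]
  have hpt : ∀ z : ℤ, sampleMean p n (fun x =>
      ∫⁻ o, ENNReal.ofReal |f p - linearEstimate a o.2 o.1|
        ∂(givenLaw ε (histOf (sampleCounts x)) (max ((n : ℤ) + z) 0).toNat)) ≤
      ENNReal.ofReal (α + c₂) + ENNReal.ofReal F * (if n ≤ z.natAbs then 1 else 0) +
        ENNReal.ofReal c₁ * z.natAbs +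
        ENNReal.ofReal c₃ * (if (n + 1) / 2 ≤ z.natAbs then 1 else 0) := by
    intro z
    set N := (max ((n : ℤ) + z) 0).toNat with hN
    by_cases hN0 : N = 0
    · -- the estimate from the empty output is `0`
      have hz : n ≤ z.natAbs := by omega
      have : ∀ x : Fin n → Fin k, ∫⁻ o, ENNReal.ofReal |f p - linearEstimate a o.2 o.1|
          ∂(givenLaw ε (histOf (sampleCounts x)) N) = ENNReal.ofReal |f p| := by
        intro x
        rw [givenLaw, if_pos hN0, lintegral_dirac]
        simp [linearEstimate_eq_phi, AnonHist.ofCounts]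
      simp only [this]
      rw [sampleMean_const hp, if_pos hz, mul_one]
      refine le_trans ?_ (le_self_add.trans le_self_add)
      rw [← ENNReal.ofReal_add (by positivity) hF0]
      exact ENNReal.ofReal_le_ofReal (by linarith)
    · have hN1 : 1 ≤ N := Nat.one_le_iff_ne_zero.2 hN0
      have hN' : (0 : ℝ) < N := by exact_mod_cast hN1
      have hL0 : 0 < (N : ℝ) ^ (β - 1) := by positivity
      have hNz : Nat.dist n N = z.natAbs := by
        rw [Nat.dist]
        omega
      have h1 : sampleMean p n (fun x => ∫⁻ o, ENNReal.ofReal |f p - linearEstimate a o.2 o.1|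
          ∂(givenLaw ε (histOf (sampleCounts x)) N)) ≤ fixedError f a N p n +
          ENNReal.ofReal ((N : ℝ) ^ (β - 1) *
            ((if 2 * N < n then (n : ℝ) else 0) + B * rate n N)) := by
        rw [fixedError, ← sampleMean_const hp n (ENNReal.ofReal ((N : ℝ) ^ (β - 1) * _)),
          ← sampleMean_add]
        exact sampleMean_mono _ fun x => lintegral_givenLaw_error_le hε _ hN0 hL0 (hL N hN1)
          (hcost _ (total_histOf_sampleCounts x) N hN0) _
      have h2 : fixedError f a N p n ≤ ENNReal.ofReal (α + Nat.dist n N *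
          ((min n N : ℕ) : ℝ) ^ (β - 1)) + ENNReal.ofReal (Nat.dist n N * (N : ℝ) ^ (β - 1)) := by
        refine (fixedError_le hL0 (hL N hN1) hp n N).trans (add_le_add_left ?_ _)
        refine (fixedError_self_le (herr N hN1) hp).trans (ENNReal.ofReal_le_ofReal ?_)
        have := (abs_le.1 (abs_err_sub_le hβ hvar hn hN1)).1
        linarith
      refine h1.trans ((add_le_add_left h2 _).trans ?_)
      have hr0 := rate_nonneg n N
      have hm0 : (0 : ℝ) ≤ ((min n N : ℕ) : ℝ) ^ (β - 1) := by positivity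
      have hite : (0 : ℝ) ≤ if 2 * N < n then (n : ℝ) else 0 := by split_ifs <;> positivity
      rw [← ENNReal.ofReal_add (by positivity) (by positivity),
        ← ENNReal.ofReal_add (by positivity) (by positivity)]
      have h3 := error_terms_le hn hN1 hβ hB
      have h4 : α + Nat.dist n N * ((min n N : ℕ) : ℝ) ^ (β - 1) + Nat.dist n N * (N : ℝ) ^ (β - 1) +
          (N : ℝ) ^ (β - 1) * ((if 2 * N < n then (n : ℝ) else 0) + B * rate n N) ≤
          (α + c₂) + c₁ * z.natAbs + c₃ * (if (n + 1) / 2 ≤ z.natAbs then 1 else 0) := by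
        have h5 : (if 2 * N < n then (3 + 2 * B) * (n : ℝ) ^ 2 else 0) ≤
            c₃ * (if (n + 1) / 2 ≤ z.natAbs then 1 else 0) := by
          by_cases h6 : 2 * N < n
          · rw [if_pos h6, if_pos (by omega), mul_one]
          · rw [if_neg h6]
            positivity
        rw [hNz] at h3 ⊢
        linarith
      refine (ENNReal.ofReal_le_ofReal h4).trans ?_
      refine ENNReal.ofReal_add_le.trans (add_le_add (ENNReal.ofReal_add_le.trans
        (add_le_add le_self_add (le_of_eq ?_))) (le_of_eq ?_))
      · rw [ENNReal.ofReal_mul hc₁0, ENNReal.ofReal_natCast]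
      · split_ifs <;> simp
  rw [e1]
  refine (lintegral_mono hpt).trans ?_
  rw [lintegral_add_left .of_discrete, lintegral_add_left .of_discrete,
    lintegral_add_left .of_discrete, lintegral_const_geometric ht0 ht1,
    lintegral_const_mul _ .of_discrete, lintegral_const_mul _ .of_discrete,
    lintegral_const_mul _ .of_discrete]
  refine (add_le_add (add_le_add (add_le_add_right (mul_le_mul_right
    (tail_twoSidedGeometric_le ht0 ht1 n) _) _) (mul_le_mul_right hV _))
    (mul_le_mul_right (tail_twoSidedGeometric_le ht0 ht1 _) _)).trans (le_of_eq ?_)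
  rw [← ENNReal.ofReal_mul hF0, ← ENNReal.ofReal_mul hc₁0, ← ENNReal.ofReal_mul hc₃0,
    ← ENNReal.ofReal_add (by positivity) (by positivity),
    ← ENNReal.ofReal_add (by positivity) (by positivity),
    ← ENNReal.ofReal_add (by positivity) (by positivity)]
  congr 1
  rw [hc₁, hc₂]
  ring

/-! ### Sample complexity -/

theorem rpow_le_rpow_mul_exp {γ x : ℝ} (hγ : 0 < γ) (hx : 0 ≤ x) : x ^ γ ≤ γ ^ γ * Real.exp x := by
  have h1 : x / γ ≤ Real.exp (x / γ) := by linarith [Real.add_one_le_exp (x / γ)]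
  have h2 : (x / γ) ^ γ ≤ Real.exp (x / γ) ^ γ := Real.rpow_le_rpow (by positivity) h1 hγ.le
  rw [← Real.exp_mul, div_mul_cancel₀ _ hγ.ne', Real.div_rpow hx hγ.le,
    div_le_iff₀ (by positivity)] at h2
  linarith

/-- A power of `n` is outweighed by `e^{-s n}`. -/
theorem sq_mul_exp_le {β n s : ℝ} (hβ : β < 1 / 2) (hn : 0 < n) (hs : 0 < s) :
    n ^ 2 * Real.exp (-(s * n)) ≤
      (5 / 2 - β) ^ (5 / 2 - β) * (1 / s) ^ (5 / 2 - β) * n ^ (β - 1 / 2) := by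
  set γ := 5 / 2 - β with hγ
  have hγ0 : 0 < γ := by rw [hγ]; linarith
  have h1 := rpow_le_rpow_mul_exp hγ0 (show 0 ≤ s * n by positivity)
  have e1 : n ^ 2 = n ^ γ * n ^ (β - 1 / 2) := by
    rw [← Real.rpow_add hn, ← Real.rpow_natCast]
    congr 1
    rw [hγ]
    push_cast
    ring
  have e2 : n ^ γ = (1 / s) ^ γ * (s * n) ^ γ := by
    rw [← Real.mul_rpow (by positivity) (by positivity)]
    congr 1
    field_simp
  have e3 : Real.exp (s * n) * Real.exp (-(s * n)) = 1 := by
    rw [← Real.exp_add, add_neg_cancel, Real.exp_zero]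
  calc n ^ 2 * Real.exp (-(s * n)) =
        (1 / s) ^ γ * (s * n) ^ γ * n ^ (β - 1 / 2) * Real.exp (-(s * n)) := by rw [e1, e2]
    _ ≤ (1 / s) ^ γ * (γ ^ γ * Real.exp (s * n)) * n ^ (β - 1 / 2) * Real.exp (-(s * n)) := by
        gcongr
    _ = γ ^ γ * (1 / s) ^ γ * n ^ (β - 1 / 2) * (Real.exp (s * n) * Real.exp (-(s * n))) := by ring
    _ = _ := by rw [e3, mul_one]

/-- The output without items is unlikely enough for the range of the property. -/
theorem propertyMax_term_le {ε α F n : ℝ} (hε : 0 < ε) (hα : 0 < α)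
    (hn : 12 * (1 / ε * Real.log (max (F / α) 1)) ≤ n) :
    max (F - α) 0 * (2 * Real.exp (-(ε / 3) * n)) ≤ α / 2 := by
  set Φ := max (F / α) 1 with hΦ
  have hΦ1 : 1 ≤ Φ := le_max_right _ _
  have e1 : max (F - α) 0 = α * (Φ - 1) := by
    rw [hΦ, max_sub_sub_right _ _ _ |>.symm, mul_max_of_nonneg _ _ hα.le, mul_sub,
      mul_div_cancel₀ _ hα.ne']
    simp
  have h1 : Real.exp (-(ε / 3) * n) ≤ 1 / Φ ^ 4 := by
    have : Real.exp (-(ε / 3) * n) ≤ Real.exp (-(4 * Real.log Φ)) := by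
      refine Real.exp_le_exp.2 ?_
      have h2 : 12 * Real.log Φ ≤ ε * n := by
        have := mul_le_mul_of_nonneg_left hn hε.le
        refine le_of_eq_of_le ?_ this
        field_simp
      linarith
    refine this.trans (le_of_eq ?_)
    rw [Real.exp_neg, one_div]
    congr 1
    have := Real.exp_nat_mul (Real.log Φ) 4
    rw [Real.exp_log (by linarith)] at this
    exact_mod_cast this
  have h2 : 4 * (Φ - 1) ≤ Φ ^ 4 := by nlinarith [sq_nonneg (Φ ^ 2 - 1), sq_nonneg (Φ - 1)]
  rw [e1]
  calc α * (Φ - 1) * (2 * Real.exp (-(ε / 3) * n)) ≤ α * (Φ - 1) * (2 * (1 / Φ ^ 4)) := by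
        have : 0 ≤ Φ - 1 := by linarith
        gcongr
    _ = α / 2 * (4 * (Φ - 1) / Φ ^ 4) := by ring
    _ ≤ α / 2 * 1 := by
        gcongr
        rw [div_le_one (by positivity)]
        exact h2
    _ = _ := mul_one _

/-- Solving `K b n ^ (-δ) ≤ α / 2` for `n`. -/
theorem mul_rpow_le_half {δ K b α n : ℝ} (hδ : 0 < δ) (hK : 0 < K) (hb : 0 ≤ b) (hα : 0 < α)
    (hn0 : 0 < n) (hn : (2 * K) ^ (1 / δ) * (b / α) ^ (1 / δ) ≤ n) :
    K * b * n ^ (-δ) ≤ α / 2 := by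
  rw [← Real.mul_rpow (by positivity) (by positivity)] at hn
  have h1 := Real.rpow_le_rpow (by positivity) hn hδ.le
  rw [← Real.rpow_mul (by positivity), one_div_mul_cancel hδ.ne', Real.rpow_one] at h1
  rw [Real.rpow_neg hn0.le, ← div_eq_mul_inv, div_le_iff₀ (by positivity)]
  have : K * b = α / 2 * (2 * K * (b / α)) := by field_simp
  rw [this]
  gcongr

theorem exp_pow_half_le {ε : ℝ} (hε : 0 < ε) (n : ℕ) :
    Real.exp (-(ε / 3)) ^ ((n + 1) / 2) ≤ Real.exp (-(ε / 12 * n)) * Real.exp (-(ε / 12 * n)) := by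
  rw [← Real.exp_nat_mul, ← Real.exp_add]
  refine Real.exp_le_exp.2 ?_
  have : (n : ℝ) ≤ 2 * ((n + 1) / 2 : ℕ) := by exact_mod_cast (by omega : n ≤ 2 * ((n + 1) / 2))
  nlinarith

/-- The constant in front of the cost terms. -/
noncomputable def costConst (β : ℝ) : ℝ :=
  2 ^ (4 - β) * 1000064 + 4000006 * ((5 / 2 - β) ^ (5 / 2 - β) * 12 ^ (5 / 2 - β))

theorem costConst_pos {β : ℝ} (hβ : β < 1 / 2) : 0 < costConst β := by
  have : 0 < 5 / 2 - β := by linarith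
  unfold costConst
  positivity

/-- One half of the decay `e^{-ε n / 6}` of `t ^ (n / 2)` provides the factor `e^{-ε/12}`, the other
half outweighs the powers of `n`. -/
theorem low_terms_le {ε β : ℝ} (hε : 1 < ε) (hβ : β < 1 / 2) {n : ℕ} (hn : 1 ≤ n) {t : ℝ}
    (ht : t = Real.exp (-(ε / 3))) :
    2 ^ (4 - β) * (64 * t * (n : ℝ) ^ (β - 1) + 10 ^ 6 * t * (n : ℝ) ^ (β - 1 / 2)) +
      (3 + 2 * (10 ^ 6 * t)) * (n : ℝ) ^ 2 * (2 * t ^ ((n + 1) / 2)) ≤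
      costConst β * Real.exp (-(ε / 12)) * (n : ℝ) ^ (-(1 / 2 - β)) := by
  have hn' : (1 : ℝ) ≤ n := by exact_mod_cast hn
  have hn0 : (0 : ℝ) < n := by linarith
  have ht0 : 0 < t := ht ▸ Real.exp_pos _
  have ht1 : t ≤ 1 := by rw [ht]; exact Real.exp_le_one_iff.2 (by linarith)
  set b := Real.exp (-(ε / 12)) with hb
  have hb0 : 0 < b := Real.exp_pos _
  have htb : t ≤ b := by rw [ht, hb]; exact Real.exp_le_exp.2 (by linarith)
  have hpow : (n : ℝ) ^ (β - 1) ≤ (n : ℝ) ^ (β - 1 / 2) :=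
    Real.rpow_le_rpow_of_exponent_le hn' (by linarith)
  have h1 := exp_pow_half_le (by linarith : 0 < ε) n
  rw [← ht] at h1
  have h2 : Real.exp (-(ε / 12 * n)) ≤ b := by
    rw [hb]
    exact Real.exp_le_exp.2 (by nlinarith)
  have h3 : Real.exp (-(ε / 12 * n)) ≤ Real.exp (-(1 / 12 * n)) :=
    Real.exp_le_exp.2 (by nlinarith)
  have h4 := sq_mul_exp_le hβ hn0 (show (0 : ℝ) < 1 / 12 by norm_num)
  rw [one_div_one_div] at h4
  set κ := (5 / 2 - β) ^ (5 / 2 - β) * 12 ^ (5 / 2 - β) with hκ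
  rw [show -(1 / 2 - β) = β - 1 / 2 by ring]
  set w := (n : ℝ) ^ (β - 1 / 2) with hw
  have hw0 : 0 < w := by positivity
  have t1 : 2 ^ (4 - β) * (64 * t * (n : ℝ) ^ (β - 1) + 10 ^ 6 * t * w) ≤
      2 ^ (4 - β) * 1000064 * b * w := by
    calc _ ≤ 2 ^ (4 - β) * (64 * b * w + 10 ^ 6 * b * w) := by gcongr
      _ = _ := by ring
  have t2 : (3 + 2 * (10 ^ 6 * t)) * (n : ℝ) ^ 2 * (2 * t ^ ((n + 1) / 2)) ≤
      4000006 * κ * b * w := by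
    calc _ ≤ (3 + 2 * (10 ^ 6 * 1)) * (n : ℝ) ^ 2 * (2 * (b * Real.exp (-(1 / 12 * n)))) := by
          gcongr
          exact h1.trans (by gcongr)
      _ = 4000006 * b * ((n : ℝ) ^ 2 * Real.exp (-(1 / 12 * n))) := by ring
      _ ≤ 4000006 * b * (κ * w) := by gcongr
      _ = _ := by ring
  rw [costConst, add_mul, add_mul]
  linarith

theorem highFactor_sq {ε : ℝ} (hε : 0 < ε) (hε1 : ε ≤ 1) :
    highFactor ε ^ 2 = 3 / ε * Real.log (3 / ε) ∧ 3 / ε ≤ highFactor ε ^ 2 ∧ 1 ≤ highFactor ε := by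
  have h1 : 1 ≤ Real.log (3 / ε) := by
    refine one_le_log_three.trans (Real.log_le_log (by norm_num) ?_)
    rw [le_div_iff₀ hε]
    linarith
  have h2 : highFactor ε ^ 2 = 3 / ε * Real.log (3 / ε) := by
    rw [highFactor, one_div_div, Real.sq_sqrt (by positivity), div_div_eq_mul_div]
    ring
  have h3 : 3 / ε ≤ highFactor ε ^ 2 := by
    rw [h2]
    exact le_mul_of_one_le_right (by positivity) h1
  refine ⟨h2, h3, ?_⟩
  have h4 : 1 ≤ 3 / ε := by rw [le_div_iff₀ hε]; linarith
  have h5 : 0 ≤ highFactor ε := Real.sqrt_nonneg _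
  nlinarith

/-- The additive term `(1/ε) log (1/ε)` of the sample size ensures that `highFactor ε` is at most of
order `√n`. -/
theorem highFactor_sq_le {ε : ℝ} (hε : 0 < ε) (hε1 : ε ≤ 1) {n : ℝ} (hn : 1 ≤ n)
    (hn2 : 9 * (1 / ε * Real.log (1 / ε)) ≤ n) : highFactor ε ^ 2 ≤ 16 * n := by
  rw [(highFactor_sq hε hε1).1]
  rcases le_total (1 / 2) ε with h | h
  · have h1 : Real.log (3 / ε) ≤ 2 := by
      rw [Real.log_le_iff_le_exp (by positivity), show (2 : ℝ) = 1 + 1 by norm_num, Real.exp_add]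
      have h2 : 3 / ε ≤ 6 := by rw [div_le_iff₀ hε]; linarith
      nlinarith [Real.exp_one_gt_d9]
    have h2 : 3 / ε ≤ 6 := by rw [div_le_iff₀ hε]; linarith
    have h3 : 0 ≤ 3 / ε := by positivity
    nlinarith
  · have h1 : Real.log (3 / ε) ≤ 3 * Real.log (1 / ε) := by
      have : Real.log ((1 / ε) ^ 3) = 3 * Real.log (1 / ε) := by
        rw [Real.log_pow]
        norm_num
      rw [← this]
      refine Real.log_le_log (by positivity) ?_
      rw [div_le_iff₀ hε]
      have : (1 / ε) ^ 3 * ε = (1 / ε) ^ 2 := by field_simp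
      rw [this]
      have : 2 ≤ 1 / ε := by rw [le_div_iff₀ hε]; linarith
      nlinarith
    calc 3 / ε * Real.log (3 / ε) ≤ 3 / ε * (3 * Real.log (1 / ε)) := by gcongr
      _ = 9 * (1 / ε * Real.log (1 / ε)) := by ring
      _ ≤ 16 * n := by linarith

theorem highFactor_le {ε : ℝ} (hε : 0 < ε) (hε1 : ε ≤ 1) :
    highFactor ε ≤ 3 * √(Real.log (2 / ε) / ε) := by
  have h0 : 0 ≤ Real.log (2 / ε) := Real.log_nonneg (by rw [le_div_iff₀ hε]; linarith)
  refine abs_le_of_sq_le_sq' ?_ (by positivity) |>.2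
  rw [(highFactor_sq hε hε1).1, mul_pow, Real.sq_sqrt (by positivity)]
  have h1 : Real.log (3 / ε) ≤ 3 * Real.log (2 / ε) := by
    have : Real.log ((2 / ε) ^ 3) = 3 * Real.log (2 / ε) := by
      rw [Real.log_pow]
      norm_num
    rw [← this]
    refine Real.log_le_log (by positivity) ?_
    rw [div_le_iff₀ hε]
    have : (2 / ε) ^ 3 * ε = 8 * (1 / ε) ^ 2 := by field_simp; norm_num
    rw [this]
    have : 1 ≤ 1 / ε := by rw [le_div_iff₀ hε]; linarith
    nlinarith
  calc 3 / ε * Real.log (3 / ε) ≤ 3 / ε * (3 * Real.log (2 / ε)) := by gcongr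
    _ = _ := by ring

/-- Like `low_terms_le`; here one half of the decay outweighs powers of `1 / ε`, for which `n` has
to exceed a multiple of `(1/ε) log (1/ε)`. -/
theorem high_terms_le {ε β : ℝ} (hε : 0 < ε) (hε1 : ε ≤ 1) (hβ : β < 1 / 2) {n : ℕ} (hn : 1 ≤ n)
    {t : ℝ} (ht : t = Real.exp (-(ε / 3))) (hn2 : highFactor ε ^ 2 ≤ 16 * n)
    (hn3 : 12 * (5 / 2 - β) * (1 / ε * Real.log (1 / ε)) ≤ n) :
    2 ^ (4 - β) * (5 / (ε / 3) * (n : ℝ) ^ (β - 1) +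
        400 * highFactor ε * (n : ℝ) ^ (β - 1 / 2)) +
      (3 + 2 * (400 * highFactor ε)) * (n : ℝ) ^ 2 * (2 * t ^ ((n + 1) / 2)) ≤
      costConst β * highFactor ε * (n : ℝ) ^ (-(1 / 2 - β)) := by
  have hn' : (1 : ℝ) ≤ n := by exact_mod_cast hn
  have hn0 : (0 : ℝ) < n := by linarith
  have ht0 : 0 < t := ht ▸ Real.exp_pos _
  obtain ⟨-, hr2, hr1⟩ := highFactor_sq hε hε1
  set r := highFactor ε with hr
  have hr4 : r ≤ 4 * √(n : ℝ) := by
    have h1 : r ≤ √(16 * n) := Real.le_sqrt_of_sq_le hn2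
    rwa [Real.sqrt_mul (by norm_num), show (16 : ℝ) = 4 ^ 2 by norm_num,
      Real.sqrt_sq (by norm_num)] at h1
  have h1 := exp_pow_half_le hε n
  rw [← ht] at h1
  have h4 := sq_mul_exp_le hβ hn0 (show (0 : ℝ) < ε / 12 by positivity)
  set γ := 5 / 2 - β with hγ
  have hγ0 : 0 < γ := by rw [hγ]; linarith
  have h2 : Real.exp (-(ε / 12 * n)) ≤ ε ^ γ := by
    rw [Real.rpow_def_of_pos hε]
    refine Real.exp_le_exp.2 ?_
    rw [one_div ε, Real.log_inv] at hn3
    have h5 : 12 * γ * (-Real.log ε) ≤ ε * n := by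
      have := mul_le_mul_of_nonneg_left hn3 hε.le
      refine le_of_eq_of_le ?_ this
      field_simp
    linarith
  have e1 : (1 / (ε / 12)) ^ γ * ε ^ γ = 12 ^ γ := by
    rw [← Real.mul_rpow (by positivity) hε.le]
    congr 1
    field_simp
  have e2 : √(n : ℝ) * (n : ℝ) ^ (β - 1) = (n : ℝ) ^ (β - 1 / 2) := by
    rw [Real.sqrt_eq_rpow, ← Real.rpow_add hn0]
    congr 1
    ring
  rw [show -(1 / 2 - β) = β - 1 / 2 by ring]
  set w := (n : ℝ) ^ (β - 1 / 2) with hw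
  have hw0 : 0 < w := by positivity
  have t0 : 5 / (ε / 3) * (n : ℝ) ^ (β - 1) ≤ 20 * (r * w) := by
    calc 5 / (ε / 3) * (n : ℝ) ^ (β - 1) = 5 * (3 / ε) * (n : ℝ) ^ (β - 1) := by field_simp
      _ ≤ 5 * (r * (4 * √(n : ℝ))) * (n : ℝ) ^ (β - 1) := by
          gcongr
          nlinarith
      _ = 20 * (r * (√(n : ℝ) * (n : ℝ) ^ (β - 1))) := by ring
      _ = _ := by rw [e2]
  have t1 : 2 ^ (4 - β) * (5 / (ε / 3) * (n : ℝ) ^ (β - 1) + 400 * r * w) ≤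
      2 ^ (4 - β) * 1000064 * r * w := by
    have : 0 ≤ r * w := by positivity
    rw [mul_assoc ((2 : ℝ) ^ (4 - β) * _), mul_assoc ((2 : ℝ) ^ (4 - β))]
    gcongr
    linarith
  have t2 : (3 + 2 * (400 * r)) * (n : ℝ) ^ 2 * (2 * t ^ ((n + 1) / 2)) ≤
      4000006 * (γ ^ γ * 12 ^ γ) * r * w := by
    calc _ ≤ (2000003 * r) * (n : ℝ) ^ 2 *
          (2 * (Real.exp (-(ε / 12 * n)) * ε ^ γ)) := by
          gcongr
          · linarith
          · exact h1.trans (by gcongr)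
      _ = 4000006 * r * ε ^ γ * ((n : ℝ) ^ 2 * Real.exp (-(ε / 12 * n))) := by ring
      _ ≤ 4000006 * r * ε ^ γ * (γ ^ γ * (1 / (ε / 12)) ^ γ * w) := by gcongr
      _ = 4000006 * (γ ^ γ * ((1 / (ε / 12)) ^ γ * ε ^ γ)) * r * w := by ring
      _ = _ := by rw [e1]
  rw [costConst, add_mul, add_mul]
  linarith

/-- Sample sizes are integers, so a bound has to be established from half the stated one on. -/
theorem sampleComplexity_le_max {e₁ : ℕ → ℝ≥0∞} {e₂ : ℕ → ℝ} {α R : ℝ} (hα : 0 < α) (hR : 0 ≤ R)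
    (h : ∀ n : ℕ, 1 ≤ n → e₂ n ≤ α → R / 2 ≤ n → e₁ n ≤ ENNReal.ofReal (2 * α)) :
    sampleComplexity e₁ (2 * α) ≤
      max (sampleComplexity (fun n => ENNReal.ofReal (e₂ n)) α) (ENNReal.ofReal R) := by
  by_contra! hlt
  obtain ⟨h1, h2⟩ := max_lt_iff.1 hlt
  rw [sampleComplexity, iInf_lt_iff] at h1
  obtain ⟨n, h1⟩ := h1
  rw [iInf_lt_iff] at h1
  obtain ⟨⟨hn1, hn⟩, h1⟩ := h1
  have h3 : sampleComplexity e₁ (2 * α) ≤ (max n ⌊R⌋₊ : ℕ) := by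
    refine iInf₂_le (max n ⌊R⌋₊) ⟨by omega, fun m hm => ?_⟩
    refine h m (by omega) ((ENNReal.ofReal_le_ofReal_iff hα.le).1 (hn m (by omega))) ?_
    rcases lt_or_ge R 1 with hR1 | hR1
    · have : (1 : ℝ) ≤ m := by exact_mod_cast (show 1 ≤ m by omega)
      linarith
    · have h4 : (⌊R⌋₊ : ℝ) ≤ m := by exact_mod_cast (show ⌊R⌋₊ ≤ m by omega)
      have h5 := Nat.lt_floor_add_one R
      have h6 : (1 : ℝ) ≤ ⌊R⌋₊ := by exact_mod_cast (Nat.one_le_floor_iff R).2 hR1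
      linarith
  have h4 : ((⌊R⌋₊ : ℕ) : ℝ≥0∞) ≤ ENNReal.ofReal R := by
    rw [← ENNReal.ofReal_natCast]
    exact ENNReal.ofReal_le_ofReal (Nat.floor_le hR)
  rcases max_choice n ⌊R⌋₊ with h5 | h5 <;> rw [h5] at h3
  · exact absurd h3 (not_le.2 h1)
  · exact absurd (h3.trans h4) (not_le.2 h2)

/-- For `ε > 1`, each of the two kinds of excess error is at most `α / 2`. -/
theorem worstError_low_le {ε α β R : ℝ} (hε : 1 < ε) (hα : 0 < α) (hβ : β < 1 / 2) {k : ℕ}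
    {f : (Fin k → ℝ) → ℝ} {a : ℕ → ℕ → ℝ}
    (hL : ∀ n : ℕ, 1 ≤ n → lipschitzConst a n ≤ ENNReal.ofReal ((n : ℝ) ^ (β - 1))) {err : ℕ → ℝ}
    (herr : ∀ n : ℕ, 1 ≤ n → worstError f (linearEstimator a) n ≤ ENNReal.ofReal (err n))
    (hvar : ∀ n : ℕ, 1 ≤ n → |err n - err (n + 1)| ≤ (n : ℝ) ^ (β - 1)) {n : ℕ} (hn : 1 ≤ n)
    (hnα : err n ≤ α)
    (hR : R = (2 * costConst β) ^ (1 / (1 / 2 - β)) *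
      (Real.exp (-(ε / 12)) / α) ^ (1 / (1 / 2 - β)))
    (hRn : R ≤ n) (hmax : 12 * (1 / ε * Real.log (max (propertyMax f / α) 1)) ≤ n) :
    worstError f (privateEstimator ε a) n ≤ ENNReal.ofReal (2 * α) := by
  have hε0 : 0 < ε := by linarith
  have ha0 := (Real.exp_pos (-(ε / 3))).le
  have ha1 : Real.exp (-(ε / 3)) < 1 := Real.exp_lt_one_iff.2 (by linarith)
  have hn0 : (0 : ℝ) < n := by exact_mod_cast hn
  refine iSup₂_le fun p hp => ?_
  refine (expectedError_privateEstimator_le hε0 hβ hα.le (B := 10 ^ 6 * Real.exp (-(ε / 3)))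
    (V := 64 * Real.exp (-(ε / 3))) (by positivity) (by positivity) hL herr hvar hn hnα rfl
    ((lintegral_natAbs_le ha0 ha1).trans (ENNReal.ofReal_le_ofReal
      (noiseVar_le ha0 (exp_neg_third_le hε)))) (fun h hh N hN g hg => ?_) hp).trans
    (ENNReal.ofReal_le_ofReal ?_)
  · refine (lintegral_cost_low_le hε h hN hg).trans (ENNReal.ofReal_le_ofReal ?_)
    rw [hh]
    refine le_add_of_nonneg_left ?_
    split_ifs <;> positivity
  · have h1 := propertyMax_term_le hε0 hα hmax
    rw [mul_comm (-(ε / 3)), Real.exp_nat_mul] at h1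
    have h2 := low_terms_le hε hβ hn rfl
    have h3 := mul_rpow_le_half (δ := 1 / 2 - β) (by linarith) (costConst_pos hβ)
      (Real.exp_pos (-(ε / 12))).le hα hn0 (hR ▸ hRn)
    linarith

/-- For `ε ≤ 1`, each of the two kinds of excess error is at most `α / 2`. -/
theorem worstError_high_le {ε α β R : ℝ} (hε : 0 < ε) (hε1 : ε ≤ 1) (hα : 0 < α)
    (hβ : β < 1 / 2) {k : ℕ} {f : (Fin k → ℝ) → ℝ} {a : ℕ → ℕ → ℝ}
    (hL : ∀ n : ℕ, 1 ≤ n → lipschitzConst a n ≤ ENNReal.ofReal ((n : ℝ) ^ (β - 1))) {err : ℕ → ℝ}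
    (herr : ∀ n : ℕ, 1 ≤ n → worstError f (linearEstimator a) n ≤ ENNReal.ofReal (err n))
    (hvar : ∀ n : ℕ, 1 ≤ n → |err n - err (n + 1)| ≤ (n : ℝ) ^ (β - 1)) {n : ℕ} (hn : 1 ≤ n)
    (hnα : err n ≤ α)
    (hR : R = (2 * (3 * costConst β)) ^ (1 / (1 / 2 - β)) *
      (√(Real.log (2 / ε) / ε) / α) ^ (1 / (1 / 2 - β)))
    (hRn : R ≤ n) (hmax : 12 * (1 / ε * Real.log (max (propertyMax f / α) 1)) ≤ n)
    (hlog : 12 * (5 / 2 - β) * (1 / ε * Real.log (1 / ε)) ≤ n) :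
    worstError f (privateEstimator ε a) n ≤ ENNReal.ofReal (2 * α) := by
  have hn1 : (1 : ℝ) ≤ n := by exact_mod_cast hn
  have hn0 : (0 : ℝ) < n := by linarith
  have hlog0 : 0 ≤ 1 / ε * Real.log (1 / ε) := by
    have : 0 ≤ Real.log (1 / ε) := Real.log_nonneg (by rw [le_div_iff₀ hε]; linarith)
    positivity
  have hn2 : highFactor ε ^ 2 ≤ 16 * n :=
    highFactor_sq_le hε hε1 hn1 (le_trans (by nlinarith) hlog)
  refine iSup₂_le fun p hp => ?_
  have hr0 : 0 ≤ highFactor ε := Real.sqrt_nonneg _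
  refine (expectedError_privateEstimator_le hε hβ hα.le (B := 400 * highFactor ε)
    (V := 5 / (ε / 3)) (by positivity) (by positivity) hL herr hvar hn hnα rfl
    (lintegral_natAbs_exp_le (by positivity) (by linarith)) (fun h hh N hN g hg => ?_) hp).trans
    (ENNReal.ofReal_le_ofReal ?_)
  · rw [← hh]
    exact lintegral_cost_high_le hε hε1 h hN hg (by rw [hh]; exact hn2)
  · have h1 := propertyMax_term_le hε hα hmax
    rw [mul_comm (-(ε / 3)), Real.exp_nat_mul] at h1
    have h2 := high_terms_le hε hε1 hβ hn rfl hn2 hlog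
    have hK := costConst_pos hβ
    have h3 := mul_rpow_le_half (δ := 1 / 2 - β) (K := 3 * costConst β) (by linarith) (by positivity)
      (Real.sqrt_nonneg (Real.log (2 / ε) / ε)) hα hn0 (hR ▸ hRn)
    have h4 : costConst β * highFactor ε * (n : ℝ) ^ (-(1 / 2 - β)) ≤
        3 * costConst β * √(Real.log (2 / ε) / ε) * (n : ℝ) ^ (-(1 / 2 - β)) := by
      have := highFactor_le hε hε1
      calc _ ≤ costConst β * (3 * √(Real.log (2 / ε) / ε)) * (n : ℝ) ^ (-(1 / 2 - β)) := by gcongr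
        _ = _ := by ring
    linarith

end PrivHist

theorem corollary1 :
    -- privacy of the plug-in estimator
    (∀ (ε : ℝ) (_ : 0 < ε) (a : ℕ → ℕ → ℝ),
      PrivHist.IsDP ε (PrivHist.privateEstimator ε a)) ∧
    -- sample complexity of the plug-in estimator
    ∃ c : ℝ, 0 < c ∧ ∀ β : ℝ, β < 1 / 2 → ∃ C : ℝ, 0 < C ∧
      ∀ (k : ℕ) (f : (Fin k → ℝ) → ℝ) (_ : PrivHist.IsSymmetricProperty f)
        (a : ℕ → ℕ → ℝ)
        (_ : ∀ n : ℕ, 1 ≤ n →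
          PrivHist.lipschitzConst a n ≤ ENNReal.ofReal ((n : ℝ) ^ (β - 1)))
        (err : ℕ → ℝ)
        (_ : ∀ n : ℕ, 1 ≤ n →
          PrivHist.worstError f (PrivHist.linearEstimator a) n ≤ ENNReal.ofReal (err n))
        (_ : ∀ n : ℕ, 1 ≤ n → |err n - err (n + 1)| ≤ (n : ℝ) ^ (β - 1))
        (ε α : ℝ) (_ : 0 < ε) (_ : 0 < α),
        (1 < ε →
          PrivHist.sampleComplexity
              (PrivHist.worstError f (PrivHist.privateEstimator ε a)) (2 * α) ≤
            max (PrivHist.sampleComplexity (fun n => ENNReal.ofReal (err n)) α)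
              (ENNReal.ofReal (C *
                ((1 / (α * Real.exp (c * ε))) ^ (2 / (1 - 2 * β)) +
                  1 / ε * Real.log (max (PrivHist.propertyMax f / α) 1))))) ∧
        (ε ≤ 1 →
          PrivHist.sampleComplexity
              (PrivHist.worstError f (PrivHist.privateEstimator ε a)) (2 * α) ≤
            max (PrivHist.sampleComplexity (fun n => ENNReal.ofReal (err n)) α)
              (ENNReal.ofReal (C *
                ((Real.log (2 / ε) / (α ^ 2 * ε)) ^ (1 / (1 - 2 * β)) +
                  1 / ε * Real.log (max (PrivHist.propertyMax f / α) 1 / ε))))) := by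
  refine ⟨fun ε hε a => PrivHist.isDP_privateEstimator hε a, 1 / 12, by norm_num, fun β hβ => ?_⟩
  have hK := PrivHist.costConst_pos hβ
  have hδ : 0 < 1 / 2 - β := by linarith
  set A := (2 * (3 * PrivHist.costConst β)) ^ (1 / (1 / 2 - β)) with hA
  have hA0 : 0 < A := by positivity
  have hγ : 12 ≤ 12 * (5 / 2 - β) := by linarith
  have hA1 : (2 * PrivHist.costConst β) ^ (1 / (1 / 2 - β)) ≤ A := by
    rw [hA]
    refine Real.rpow_le_rpow (by positivity) (by linarith) (by positivity)
  -- both terms have to be covered by half the stated bound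
  refine ⟨2 * (A + 12 * (5 / 2 - β)), by positivity, ?_⟩
  intro k f _ a hL err herr hvar ε α hε hα
  have hΦ : 1 ≤ max (PrivHist.propertyMax f / α) 1 := le_max_right _ _
  set Φ := max (PrivHist.propertyMax f / α) 1 with hΦd
  have hlogΦ : 0 ≤ 1 / ε * Real.log Φ := by
    have := Real.log_nonneg hΦ
    positivity
  refine ⟨fun hε1 => ?_, fun hε1 => ?_⟩
  · have hX : (1 / (α * Real.exp (1 / 12 * ε))) ^ (2 / (1 - 2 * β)) =
        (Real.exp (-(ε / 12)) / α) ^ (1 / (1 / 2 - β)) := by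
      congr 1
      · rw [show 1 / 12 * ε = ε / 12 by ring, Real.exp_neg]
        field_simp
      · rw [div_eq_div_iff (by linarith) (by linarith)]
        ring
    rw [hX]
    set X := (Real.exp (-(ε / 12)) / α) ^ (1 / (1 / 2 - β)) with hXd
    have hX0 : 0 ≤ X := by positivity
    refine PrivHist.sampleComplexity_le_max hα (by positivity) fun n hn hnα hRn => ?_
    have hsplit : A * X + 12 * (1 / ε * Real.log Φ) ≤ n := by nlinarith
    refine PrivHist.worstError_low_le hε1 hα hβ hL herr hvar hn hnα rfl ?_ ?_
    · have : (2 * PrivHist.costConst β) ^ (1 / (1 / 2 - β)) * X ≤ A * X := by gcongr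
      linarith
    · have : 0 ≤ A * X := by positivity
      linarith
  · have hlogε : 0 ≤ 1 / ε * Real.log (1 / ε) := by
      have : 0 ≤ Real.log (1 / ε) := Real.log_nonneg (by rw [le_div_iff₀ hε]; linarith)
      positivity
    have hlog2 : 0 ≤ Real.log (2 / ε) := Real.log_nonneg (by rw [le_div_iff₀ hε]; linarith)
    have hX : (Real.log (2 / ε) / (α ^ 2 * ε)) ^ (1 / (1 - 2 * β)) =
        (√(Real.log (2 / ε) / ε) / α) ^ (1 / (1 / 2 - β)) := by
      have e1 : Real.log (2 / ε) / (α ^ 2 * ε) = (√(Real.log (2 / ε) / ε) / α) ^ (2 : ℝ) := by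
        rw [Real.rpow_two, div_pow, Real.sq_sqrt (by positivity), div_div, mul_comm ε]
      rw [e1, ← Real.rpow_mul (by positivity)]
      congr 1
      rw [mul_one_div, div_eq_div_iff (by linarith) (by linarith)]
      ring
    have hlogsplit : 1 / ε * Real.log (Φ / ε) = 1 / ε * Real.log Φ + 1 / ε * Real.log (1 / ε) := by
      rw [div_eq_mul_one_div Φ ε, Real.log_mul (by linarith) (by positivity), mul_add]
    rw [hX, hlogsplit]
    set X := (√(Real.log (2 / ε) / ε) / α) ^ (1 / (1 / 2 - β)) with hXd
    have hX0 : 0 ≤ X := by positivity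
    refine PrivHist.sampleComplexity_le_max hα (by positivity) fun n hn hnα hRn => ?_
    have hAX : 0 ≤ A * X := by positivity
    have hsplit : A * X + 12 * (1 / ε * Real.log Φ) +
        12 * (5 / 2 - β) * (1 / ε * Real.log (1 / ε)) ≤ n := by
      have h1 : 12 * (1 / ε * Real.log Φ) ≤ 12 * (5 / 2 - β) * (1 / ε * Real.log Φ) := by gcongr
      have h2 : 0 ≤ A * (1 / ε * Real.log Φ + 1 / ε * Real.log (1 / ε)) := by positivity
      have h3 : 0 ≤ 12 * (5 / 2 - β) * X := by positivity
      nlinarith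
    have hγlog : 0 ≤ 12 * (5 / 2 - β) * (1 / ε * Real.log (1 / ε)) := by positivity
    exact PrivHist.worstError_high_le hε hε1 hα hβ hL herr hvar hn hnα rfl (by linarith)
      (by linarith) (by linarith)
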